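/- Let $k$ be a field. By a $k$-scheme we mean a separated scheme locally of finite type over $k$; group schemes over $k$ are assumed to be of this kind. Let $G$ be an algebraic group over $k$ (a $k$-group scheme of finite type), and let $H$ be a smooth $k$-group scheme. Let $\mathbf{Hom}_{\mathrm{gp}}(G,H)$ denote the functor sending a scheme $S$ over $k$ to the set of morphisms $f: G\times S\to H$ over $k$ such that $f(g_1g_2,s)=f(g_1,s)f(g_2,s)$ identically on $G\times G\times S$ (equivalently, to the set of homomorphisms of $S$-group schemes $G_S\to H_S$). Assume that this functor is represented by a $k$-scheme $M$. Then the following conditions are equivalent: (i) The morphism $$\gamma : H\times M\longrightarrow M\times M,\qquad (h,f)\longmapsto (hfh^{-1},f)$$ is smooth, where $hfh^{-1}$ denotes the homomorphism $g\mapsto hf(g)h^{-1}$. (ii) For any field extension $K/k$ and any $f\in M(K)=\mathrm{Hom}_{K\text{-gp}}(G_K,H_K)$, the morphism $$\gamma_f: H_K\longrightarrow M_K,\qquad h\longmapsto (g\mapsto hf(g)h^{-1})$$ is smooth. (iii) For any field extension $K/k$ and any $f\in M(K)$, we have $H^1(G_K,\mathrm{Lie}(H_K))=0$, where $\mathrm{Lie}(H_K)$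 is a $G_K$-module via $\mathrm{Ad}\circ f$. Here $H^1(G_K,\mathrm{Lie}(H_K))=Z^1/B^1$ is the first Hochschild cohomology group: $Z^1$ is the space of morphisms $\varphi: G_K\to \mathrm{Lie}(H_K)$ such that $\varphi(g_1g_2)=\varphi(g_1)+\mathrm{Ad}(f(g_1))\varphi(g_2)$ identically on $G_K\times G_K$, and $B^1$ is the subspace of the morphisms $g\mapsto \mathrm{Ad}(f(g))x-x$ with $x\in\mathrm{Lie}(H_K)$. Moreover, conditions (i), (ii), (iii) hold whenever the affine group scheme $G^{\mathrm{aff}}=\mathrm{Spec}\,\mathcal{O}(G)$ is linearly reductive, i.e., every $G^{\mathrm{aff}}$-module is semi-simple. -/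

import Mathlib

open CategoryTheory MonoidalCategory CartesianMonoidalCategory MonObj AlgebraicGeometry Opposite
open CategoryTheory.Limits hiding prodComparison
open scoped CategoryTheory.Obj

universe u
noncomputable section
namespace HomScheme

section AlgOver
variable (K : Type u) [Field K]

/-- `Spec A` as a `K`-scheme, for a `K`-algebra `A`. -/
abbrev algOver (A : Type u) [CommRing A] [Algebra K A] : Over (Spec (.of K)) :=
  Over.mk (Spec.map (CommRingCat.ofHom (algebraMap K A)))

variable {K} in
/-- The morphism `Spec B ⟶ Spec A` of `K`-schemes given by a `K`-algebra map `A → B`. -/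
def algOverMap {A B : Type u} [CommRing A] [Algebra K A] [CommRing B] [Algebra K B]
    (φ : A →ₐ[K] B) : algOver K B ⟶ algOver K A :=
  Over.homMk (Spec.map (CommRingCat.ofHom φ.toRingHom)) (by
    simp only [algOver, Over.mk_hom, ← Spec.map_comp, ← CommRingCat.ofHom_comp]
    congr 2
    exact φ.comp_algebraMap)

end AlgOver

section Functor
variable {S : Scheme.{u}} (G H : Over S) [GrpObj G] [GrpObj H]

/-- The set `Hom_gp(G, H)(T)`: morphisms `f : G × T ⟶ H` over the base such that
`f(g₁ g₂, t) = f(g₁, t) f(g₂, t)` identically on `G × G × T`. Equivalently, homomorphisms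
`G_T ⟶ H_T` of group schemes over `T`. -/
def HomPoints (T : Over S) : Type u :=
  {f : G ⊗ T ⟶ H // (μ[G] ▷ T) ≫ f = ((fst G G ▷ T) ≫ f) * ((snd G G ▷ T) ≫ f)}

variable {G H} in
/-- Restriction `f(g, t) ↦ f(g, u(t'))` along `u : T' ⟶ T`. -/
def HomPoints.pullback {T T' : Over S} (u : T' ⟶ T) (f : HomPoints G H T) : HomPoints G H T' :=
  ⟨G ◁ u ≫ f.1, by
    have h := congr(((G ⊗ G) ◁ u) ≫ $(f.2))
    simpa only [comp_mul, whisker_exchange_assoc] using h⟩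

/-- The functor of group homomorphisms `T ↦ Hom_gp(G, H)(T)`, on all schemes over the base. -/
def homGp : (Over S)ᵒᵖ ⥤ Type u where
  obj T := HomPoints G H T.unop
  map u := ↾ HomPoints.pullback u.unop
  map_id T := by
    ext f; apply Subtype.ext; simp [HomPoints.pullback]
  map_comp u v := by
    ext f; apply Subtype.ext; simp [HomPoints.pullback]

variable {G H} in
/-- The action of `H(T)` on `Hom_gp(G, H)(T)` by conjugation on the target:
`(g, t) ↦ h(t) f(g, t) h(t)⁻¹`. -/
def HomPoints.conj {T : Over S} (h : T ⟶ H) (f : HomPoints G H T) : HomPoints G H T :=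
  ⟨(snd G T ≫ h) * f.1 * (snd G T ≫ h)⁻¹, by
    simp only [comp_mul, GrpObj.comp_inv, whiskerRight_snd_assoc, f.2]
    group⟩

end Functor

section Conj
variable {S : Scheme.{u}} {G H M : Over S} [GrpObj G] [GrpObj H]

/-- The morphism `γ : H × M ⟶ M × M`, `(h, f) ↦ (h f h⁻¹, f)`, where `M` represents
`Hom_gp(G, H)`. -/
def conjGraph (α : (homGp G H).RepresentableBy M) : H ⊗ M ⟶ M ⊗ M :=
  lift (α.homEquiv.symm (HomPoints.conj (fst H M) (α.homEquiv (snd H M)))) (snd H M)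
end Conj

section Field
variable {k : Type u} [Field k] (K : Type u) [Field K] [Algebra k K]

/-- The base change `X_K` of a `k`-scheme `X`. For a group scheme `X` it carries the group
structure obtained from that of `X`, as base change preserves finite products. -/
abbrev baseChange (X : Over (Spec (.of k))) : Over (Spec (.of K)) :=
  (Over.pullback (Spec.map (CommRingCat.ofHom (algebraMap k K)))).obj X

variable {K}
variable {G H M : Over (Spec (.of k))} [GrpObj G] [GrpObj H]

/-- The `K`-morphism `X_K ⟶ Y_K` with first component a given `k`-morphism `X × Spec K ⟶ Y`. -/
def toBaseChange {X Y : Over (Spec (.of k))} (φ : X ⊗ algOver k K ⟶ Y) :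
    baseChange K X ⟶ baseChange K Y :=
  Over.homMk (pullback.lift φ.left (pullback.snd X.hom (algOver k K).hom)
    ((Over.w φ).trans pullback.condition)) (pullback.lift_snd _ _ _)

theorem toBaseChange_left_fst {X Y : Over (Spec (.of k))} (φ : X ⊗ algOver k K ⟶ Y) :
    (toBaseChange φ).left ≫ pullback.fst Y.hom (algOver k K).hom = φ.left :=
  pullback.lift_fst _ _ _

theorem toBaseChange_left_snd {X Y : Over (Spec (.of k))} (φ : X ⊗ algOver k K ⟶ Y) :
    (toBaseChange φ).left ≫ pullback.snd Y.hom (algOver k K).hom =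
      pullback.snd X.hom (algOver k K).hom :=
  pullback.lift_snd _ _ _

/-- An element of `Hom_gp(G, H)(Spec K)`, as a homomorphism `G_K ⟶ H_K`. -/
def HomPoints.toHom (f : HomPoints G H (algOver k K)) : baseChange K G ⟶ baseChange K H :=
  toBaseChange f.1

theorem HomPoints.mul_toHom (f : HomPoints G H (algOver k K)) :
    μ[baseChange K G] ≫ f.toHom = (f.toHom ⊗ₘ f.toHom) ≫ μ[baseChange K H] := by
  let F := Over.pullback (Spec.map (CommRingCat.ofHom (algebraMap k K)))
  ext : 1
  apply pullback.hom_ext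
  · have e1 : (μ[baseChange K G] ≫ f.toHom).left ≫ pullback.fst H.hom (algOver k K).hom =
      (Functor.LaxMonoidal.μ F G G).left ≫ ((μ[G] ▷ algOver k K) ≫ f.1).left := by
      rw [Over.comp_left, Category.assoc, HomPoints.toHom, toBaseChange_left_fst,
        Functor.obj.μ_def, Over.comp_left, Over.comp_left, Category.assoc]
      rfl
    have e2 : (F.map μ[H]).left ≫ pullback.fst H.hom (algOver k K).hom =
      pullback.fst (H ⊗ H).hom (algOver k K).hom ≫ μ[H].left := by
      exact pullback.lift_fst _ _ _
    have e3 : ((f.toHom ⊗ₘ f.toHom) ≫ μ[baseChange K H]).left ≫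
        pullback.fst H.hom (algOver k K).hom =
      (f.toHom ⊗ₘ f.toHom).left ≫ (Functor.LaxMonoidal.μ F H H).left ≫
        pullback.fst (H ⊗ H).hom (algOver k K).hom ≫ μ[H].left := by
      rw [Over.comp_left, Functor.obj.μ_def, Over.comp_left, Category.assoc, Category.assoc]
      erw [e2]
    refine e1.trans (Eq.trans ?_ e3.symm)
    rw [f.2, Hom.mul_def, Over.comp_left]
    simp only [← Category.assoc]
    congr 1
    apply pullback.hom_ext
    · have a1 : (Functor.LaxMonoidal.μ F G G).left ≫ (fst G G ▷ algOver k K).left =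
          (fst (F.obj G) (F.obj G)).left :=
        congr(($(Functor.Monoidal.μ_fst F G G)).left)
      have a2 : (f.toHom ⊗ₘ f.toHom).left ≫ (fst (F.obj H) (F.obj H)).left =
          (fst (F.obj G) (F.obj G)).left ≫ f.toHom.left :=
        congr(($(tensorHom_fst f.toHom f.toHom)).left)
      have a3 := Over.μ_pullback_left_fst_fst (f := (algOver k K).hom) H H
      have a4 : f.toHom.left ≫ pullback.fst H.hom (algOver k K).hom = f.1.left :=
        toBaseChange_left_fst f.1
      rw [Category.assoc, Category.assoc, Category.assoc]
      refine (congr((Functor.LaxMonoidal.μ F G G).left ≫ ($(lift_fst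
        (fst G G ▷ algOver k K ≫ f.1) (snd G G ▷ algOver k K ≫ f.1))).left)).trans ?_
      refine Eq.trans ?_ (congr(_ ≫ $a3)).symm
      rw [Over.comp_left, reassoc_of% a1]
      refine Eq.trans ?_ (congr($a2 ≫ pullback.fst H.hom (algOver k K).hom)).symm
      rw [Category.assoc, a4]
    · have a1 : (Functor.LaxMonoidal.μ F G G).left ≫ (snd G G ▷ algOver k K).left =
          (snd (F.obj G) (F.obj G)).left :=
        congr(($(Functor.Monoidal.μ_snd F G G)).left)
      have a2 : (f.toHom ⊗ₘ f.toHom).left ≫ (snd (F.obj H) (F.obj H)).left =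
          (snd (F.obj G) (F.obj G)).left ≫ f.toHom.left :=
        congr(($(tensorHom_snd f.toHom f.toHom)).left)
      have a3 := Over.μ_pullback_left_fst_snd (f := (algOver k K).hom) H H
      have a4 : f.toHom.left ≫ pullback.fst H.hom (algOver k K).hom = f.1.left :=
        toBaseChange_left_fst f.1
      rw [Category.assoc, Category.assoc, Category.assoc]
      refine (congr((Functor.LaxMonoidal.μ F G G).left ≫ ($(lift_snd
        (fst G G ▷ algOver k K ≫ f.1) (snd G G ▷ algOver k K ≫ f.1))).left)).trans ?_
      refine Eq.trans ?_ (congr(_ ≫ $a3)).symm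
      rw [Over.comp_left, reassoc_of% a1]
      refine Eq.trans ?_ (congr($a2 ≫ pullback.fst H.hom (algOver k K).hom)).symm
      rw [Category.assoc, a4]
  · exact (μ[baseChange K G] ≫ f.toHom).w.trans ((f.toHom ⊗ₘ f.toHom) ≫ μ[baseChange K H]).w.symm

theorem isMonHom_of_mul {C : Type*} [Category C] [CartesianMonoidalCategory C] {A B : C} [GrpObj A]
    [GrpObj B] (f : A ⟶ B) (h : μ[A] ≫ f = (f ⊗ₘ f) ≫ μ[B]) : IsMonHom f where
  one_hom := by
    have h1 := congr(lift η[A] η[A] ≫ $h)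
    have h2 : lift η[A] η[A] ≫ μ[A] = η[A] := by
      have := mul_one (η[A] : 𝟙_ C ⟶ A)
      rw [Hom.one_def, Hom.mul_def] at this
      simpa using this
    have h3 : (η[A] ≫ f) * (η[A] ≫ f) = η[A] ≫ f := by
      rw [Hom.mul_def]
      simpa [reassoc_of% h2] using h1.symm
    have := mul_eq_left.mp h3
    rw [this, Hom.one_def]; simp
  mul_hom := h

instance HomPoints.isMonHom_toHom (f : HomPoints G H (algOver k K)) : IsMonHom f.toHom := isMonHom_of_mul _ f.mul_toHom

/-- The orbit map `γ_f : H_K ⟶ M_K`, `h ↦ (g ↦ h f(g) h⁻¹)`, of a point `f ∈ M(K)`. -/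
def orbitMap (α : (homGp G H).RepresentableBy M) (f : algOver k K ⟶ M) :
    baseChange K H ⟶ baseChange K M :=
  toBaseChange (α.homEquiv.symm (HomPoints.conj (fst H (algOver k K))
    (α.homEquiv (snd H (algOver k K) ≫ f))))
end Field

theorem eq_of_isSchemeTheoreticallyDominant {X Y Z S : Scheme.{u}} (f : X ⟶ Y)
    [IsSchemeTheoreticallyDominant f] (s : Z ⟶ S) [IsSeparated s] {a b : Y ⟶ Z}
    (hs : a ≫ s = b ≫ s) (h : f ≫ a = f ≫ b) : a = b := by
  let Y' : Over S := Over.mk (a ≫ s)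
  let Z' : Over S := Over.mk s
  let a' : Y' ⟶ Z' := Over.homMk a
  let b' : Y' ⟶ Z' := Over.homMk b
  let f' : Over.mk (f ≫ a ≫ s) ⟶ Y' := Over.homMk f
  have : IsSeparated Z'.hom := ‹_›
  have e : (equalizer.lift f' (by ext1; exact h) : _ ⟶ equalizer a' b').left ≫
      (equalizer.ι a' b').left = f := by
    rw [← Over.comp_left, equalizer.lift_ι]; rfl
  have hk : (equalizer.ι a' b').left.ker = ⊥ := by
    rw [eq_bot_iff, ← f.ker_eq_bot]
    conv_rhs => rw [← e]
    exact Scheme.Hom.le_ker_comp _ _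
  have := IsClosedImmersion.isIso_iff_ker_eq_bot.mpr hk
  rw [← cancel_epi (equalizer.ι a' b').left]
  exact congr($(equalizer.condition a' b').left)

section Lie
variable (K : Type u) [Field K]

theorem algOver_prod_ext {A B : Type u} [CommRing A] [Algebra K A] [CommRing B] [Algebra K B]
    {T H : Over (Spec (.of K))} (x y : T ⊗ algOver K (A × B) ⟶ H)
    (hA : T ◁ algOverMap (AlgHom.fst K A B) ≫ x = T ◁ algOverMap (AlgHom.fst K A B) ≫ y)
    (hB : T ◁ algOverMap (AlgHom.snd K A B) ≫ x = T ◁ algOverMap (AlgHom.snd K A B) ≫ y) :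
    x = y := by
  have key {C : Type u} [CommRing C] [Algebra K C] (φ : A × B →ₐ[K] C)
      (h : T ◁ algOverMap φ ≫ x = T ◁ algOverMap φ ≫ y) {W : Over (Spec (.of K))}
      (a : W ⟶ T ⊗ algOver K (A × B)) (b : W ⟶ algOver K C)
      (hab : a ≫ snd _ _ = b ≫ algOverMap φ) : a ≫ x = a ≫ y := by
    have ha : a = lift (a ≫ fst _ _) b ≫ (T ◁ algOverMap φ) := by
      apply CartesianMonoidalCategory.hom_ext
      · simp
      · simp [hab]
    rw [ha, Category.assoc, Category.assoc, h]
  let 𝒰 : Scheme.OpenCover.{u} (Spec (.of (A × B))) :=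
    (coprodOpenCover (Spec (.of A)) (Spec (.of B))).pushforwardIso (coprodSpec A B)
  ext1
  refine Scheme.Cover.hom_ext (𝒰.pullback₁ (pullback.snd T.hom (algOver K (A × B)).hom)) _ _ ?_
  have fin {C : Type u} [CommRing C] [Algebra K C] (φ : A × B →ₐ[K] C)
      (h : T ◁ algOverMap φ ≫ x = T ◁ algOverMap φ ≫ y) {W : Scheme.{u}}
      (a : W ⟶ (T ⊗ algOver K (A × B)).left) (b : W ⟶ (algOver K C).left)
      (hab : a ≫ (snd T (algOver K (A × B))).left = b ≫ (algOverMap φ).left) : a ≫ x.left = a ≫ y.left := by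
    refine congr(($(key φ h (W := Over.mk (a ≫ (T ⊗ algOver K (A × B)).hom))
      (Over.homMk a) (Over.homMk b ?_) ?_)).left)
    · rw [← Over.w (algOverMap φ), ← Category.assoc, ← hab, Category.assoc, Over.w]
      rfl
    · ext1; exact hab
  rintro (i | i)
  · refine fin (AlgHom.fst K A B) hA _ (pullback.snd _ _) (pullback.condition.trans ?_)
    exact congr(_ ≫ $(coprodSpec_inl A B))
  · refine fin (AlgHom.snd K A B) hB _ (pullback.snd _ _) (pullback.condition.trans ?_)
    exact congr(_ ≫ $(coprodSpec_inr A B))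

theorem algOver_injective_ext {A B : Type u} [CommRing A] [Algebra K A] [CommRing B] [Algebra K B]
    (φ : A →ₐ[K] B) (hφ : Function.Injective φ)
    {T H : Over (Spec (.of K))} [IsSeparated H.hom] (x y : T ⊗ algOver K A ⟶ H)
    (h : T ◁ algOverMap φ ≫ x = T ◁ algOverMap φ ≫ y) : x = y := by
  have h0 : IsSchemeTheoreticallyDominant (Spec.map (CommRingCat.ofHom φ.toRingHom)) := by
    constructor
    have hz : RingHom.ker (Spec.map (CommRingCat.ofHom φ.toRingHom)).appTop.hom = ⊥ := by
      rw [← RingHom.injective_iff_ker_eq_bot]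
      have e := Scheme.ΓSpecIso_naturality (CommRingCat.ofHom φ.toRingHom)
      intro a b hab
      have ha (c) : φ ((Scheme.ΓSpecIso (.of A)).hom c) = (Scheme.ΓSpecIso (.of B)).hom
          ((Spec.map (CommRingCat.ofHom φ.toRingHom)).appTop c) := congr($(e.symm) c)
      refine (ConcreteCategory.bijective_of_isIso (Scheme.ΓSpecIso (.of A)).hom).1 (hφ ?_)
      rw [ha, ha]
      exact congr((Scheme.ΓSpecIso (.of B)).hom $hab)
    rw [Scheme.ker_of_isAffine, hz]
    exact map_bot Scheme.IdealSheafData.equivOfIsAffine.symm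
  have h1 : IsSchemeTheoreticallyDominant (algOverMap φ).left := h0
  have : QuasiCompact (algOverMap φ).left :=
    inferInstanceAs (QuasiCompact (Spec.map (CommRingCat.ofHom φ.toRingHom)))
  have : Subsingleton (Spec (CommRingCat.of K)) := inferInstanceAs (Subsingleton (PrimeSpectrum K))
  have : Flat T.hom := inferInstance
  have h3 : IsPullback (snd T (algOver K B)).left (T ◁ algOverMap φ).left
      (algOverMap φ).left (snd T (algOver K A)).left := by
    have hA : IsPullback (snd T (algOver K A)).left (fst T (algOver K A)).left
      (algOver K A).hom T.hom := (IsPullback.of_hasPullback T.hom (algOver K A).hom).flip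
    have hB : IsPullback (snd T (algOver K B)).left (fst T (algOver K B)).left
      (algOver K B).hom T.hom := (IsPullback.of_hasPullback T.hom (algOver K B).hom).flip
    refine IsPullback.of_bot ?_ congr(($(whiskerLeft_snd T (algOverMap φ))).left).symm hA
    rw [Over.w, ← Over.comp_left, whiskerLeft_fst]
    exact hB
  have : Flat (snd T (algOver K A)).left := inferInstanceAs (Flat (pullback.snd _ _))
  have : IsSchemeTheoreticallyDominant (T ◁ algOverMap φ).left := .of_isPullback h3
  ext1
  exact eq_of_isSchemeTheoreticallyDominant (T ◁ algOverMap φ).left H.hom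
    ((Over.w x).trans (Over.w y).symm) congr(($h).left)


variable {K} {H T T' T'' G : Over (Spec (.of K))} [GrpObj H]

theorem algOverMap_comp {A B C : Type u} [CommRing A] [Algebra K A] [CommRing B] [Algebra K B]
    [CommRing C] [Algebra K C] (φ : A →ₐ[K] B) (ψ : B →ₐ[K] C) :
    algOverMap ψ ≫ algOverMap φ = algOverMap (ψ.comp φ) := by
  ext1
  exact (Spec.map_comp _ _).symm

theorem algOverMap_id {A : Type u} [CommRing A] [Algebra K A] :
    algOverMap (AlgHom.id K A) = 𝟙 _ := by
  ext1
  exact Spec.map_id _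

variable (K) in
/-- The spectrum of `D(V) = K ⊕ εV` with `(εV)² = 0`; `SpecD K K` is that of the dual numbers. -/
abbrev SpecD (V : Type u) [AddCommGroup V] [Module K V] [Module Kᵐᵒᵖ V] [IsCentralScalar K V] :
    Over (Spec (.of K)) :=
  algOver K (TrivSqZeroExt K V)

/-- The morphism `Spec D(W) ⟶ Spec D(V)` given by a linear map `V → W`. -/
abbrev SpecD.map {V W : Type u} [AddCommGroup V] [Module K V] [Module Kᵐᵒᵖ V] [IsCentralScalar K V]
    [AddCommGroup W] [Module K W] [Module Kᵐᵒᵖ W] [IsCentralScalar K W] (l : V →ₗ[K] W) :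
    SpecD K W ⟶ SpecD K V :=
  algOverMap (TrivSqZeroExt.map l)

variable (K) in
/-- The closed point `Spec K ⟶ Spec D(V)`, i.e. `ε = 0`. -/
abbrev SpecD.zero (V : Type u) [AddCommGroup V] [Module K V] [Module Kᵐᵒᵖ V] [IsCentralScalar K V] :
    algOver K K ⟶ SpecD K V :=
  algOverMap (TrivSqZeroExt.fstHom K K V)

/-- A morphism from `T × Spec D(K × K)` to a separated scheme is determined by its restrictions to
the two copies of `T × Spec D(K)`. -/
theorem SpecD_ext [IsSeparated H.hom] {x y : T ⊗ SpecD K (K × K) ⟶ H}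
    (h1 : T ◁ SpecD.map (LinearMap.fst K K K) ≫ x = T ◁ SpecD.map (LinearMap.fst K K K) ≫ y)
    (h2 : T ◁ SpecD.map (LinearMap.snd K K K) ≫ x = T ◁ SpecD.map (LinearMap.snd K K K) ≫ y) :
    x = y := by
  let φ : TrivSqZeroExt K (K × K) →ₐ[K] TrivSqZeroExt K K × TrivSqZeroExt K K :=
    (TrivSqZeroExt.map (LinearMap.fst K K K)).prod (TrivSqZeroExt.map (LinearMap.snd K K K))
  have hφ : Function.Injective φ := by
    intro a b h
    have ha := congr(($h).1)
    have hb := congr(($h).2)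
    have h1 := congr(($ha).fst)
    have h2 := congr(($ha).snd)
    have h3 := congr(($hb).snd)
    simp [φ] at h1 h2 h3
    exact TrivSqZeroExt.ext h1 (Prod.ext h2 h3)
  apply algOver_injective_ext K φ hφ
  apply algOver_prod_ext
  · rw [← whiskerLeft_comp_assoc, ← whiskerLeft_comp_assoc, algOverMap_comp]
    exact h1
  · rw [← whiskerLeft_comp_assoc, ← whiskerLeft_comp_assoc, algOverMap_comp]
    exact h2

variable (H T) in
/-- The kernel of `H(T[ε]) → H(T)`, where `T[ε] = T × Spec K[ε]`. -/
def lieSubgroup : Subgroup (T ⊗ SpecD K K ⟶ H) where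
  carrier := {x | T ◁ SpecD.zero K K ≫ x = 1}
  one_mem' := comp_one _
  mul_mem' {a b} (ha : _ = 1) (hb : _ = 1) := by
    change _ ≫ _ = 1
    rw [comp_mul, ha, hb, _root_.one_mul]
  inv_mem' {a} (ha : _ = 1) := by
    change _ ≫ _ = 1
    rw [GrpObj.comp_inv, ha, inv_one]

theorem lieSubgroup_comp (x : lieSubgroup H T) {V : Type u} [AddCommGroup V] [Module K V]
    [Module Kᵐᵒᵖ V] [IsCentralScalar K V] {l : K →ₗ[K] V} (hl : l = 0) :
    T ◁ SpecD.map l ≫ x.1 = 1 := by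
  have h : TrivSqZeroExt.map l =
      (TrivSqZeroExt.inlAlgHom K K V).comp (TrivSqZeroExt.fstHom K K K) := by
    subst hl; ext <;> simp
  rw [SpecD.map, h, ← algOverMap_comp, whiskerLeft_comp_assoc,
    show T ◁ SpecD.zero K K ≫ x.1 = 1 from x.2, comp_one]

theorem SpecD_map_map (l : K →ₗ[K] K × K) (m : K × K →ₗ[K] K) (x : T ⊗ SpecD K K ⟶ H) :
    T ◁ SpecD.map m ≫ T ◁ SpecD.map l ≫ x = T ◁ SpecD.map (m ∘ₗ l) ≫ x := by
  rw [← whiskerLeft_comp_assoc, algOverMap_comp, SpecD.map, TrivSqZeroExt.map_comp_map]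

theorem SpecD_map_id (x : T ⊗ SpecD K K ⟶ H) : T ◁ SpecD.map LinearMap.id ≫ x = x := by
  rw [SpecD.map, TrivSqZeroExt.map_id, algOverMap_id, whiskerLeft_id, Category.id_comp]

theorem lieSubgroup_mul_comm [IsSeparated H.hom] (x y : lieSubgroup H T) : x * y = y * x := by
  ext1
  change x.1 * y.1 = y.1 * x.1
  have key :
      (T ◁ SpecD.map (LinearMap.inl K K K) ≫ x.1) * (T ◁ SpecD.map (LinearMap.inr K K K) ≫ y.1) =
      (T ◁ SpecD.map (LinearMap.inr K K K) ≫ y.1) * (T ◁ SpecD.map (LinearMap.inl K K K) ≫ x.1) := by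
    apply SpecD_ext
    · simp only [comp_mul, SpecD_map_map]
      rw [lieSubgroup_comp y (LinearMap.fst_comp_inr ..), _root_.one_mul, _root_.mul_one]
    · simp only [comp_mul, SpecD_map_map]
      rw [lieSubgroup_comp x (LinearMap.snd_comp_inl ..), _root_.one_mul, _root_.mul_one]
  have := congr(T ◁ SpecD.map (LinearMap.coprod LinearMap.id LinearMap.id) ≫ $key)
  simpa only [comp_mul, SpecD_map_map, LinearMap.coprod_inl, LinearMap.coprod_inr,
    SpecD_map_id] using this

theorem lieSubgroup_map_add [IsSeparated H.hom] (x : lieSubgroup H T) (l m : K →ₗ[K] K) :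
    T ◁ SpecD.map (l + m) ≫ x.1 = (T ◁ SpecD.map l ≫ x.1) * (T ◁ SpecD.map m ≫ x.1) := by
  have key : T ◁ SpecD.map (LinearMap.inl K K K + LinearMap.inr K K K) ≫ x.1 =
      (T ◁ SpecD.map (LinearMap.inl K K K) ≫ x.1) *
        (T ◁ SpecD.map (LinearMap.inr K K K) ≫ x.1) := by
    apply SpecD_ext
    · simp only [comp_mul, SpecD_map_map, LinearMap.comp_add]
      rw [lieSubgroup_comp x (LinearMap.fst_comp_inr ..), LinearMap.fst_comp_inr, add_zero,
        _root_.mul_one]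
    · simp only [comp_mul, SpecD_map_map, LinearMap.comp_add]
      rw [lieSubgroup_comp x (LinearMap.snd_comp_inl ..), LinearMap.snd_comp_inl, zero_add,
        _root_.one_mul]
  have := congr(T ◁ SpecD.map (LinearMap.coprod l m) ≫ $key)
  simpa only [comp_mul, SpecD_map_map, LinearMap.comp_add, LinearMap.coprod_inl,
    LinearMap.coprod_inr] using this

variable (H T) in
/-- `Lie(H)(T) = ker (H(T[ε]) → H(T))`, written additively: the `T`-points of the Lie algebra of
`H` viewed as a vector group, that is, the morphisms `T ⟶ Lie(H)`. The Lie algebra itself, as a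
`K`-vector space, is the case `T = Spec K`. -/
def Lie : Type u := Additive (lieSubgroup H T)

namespace Lie

def mk (x : T ⊗ SpecD K K ⟶ H) (hx : T ◁ SpecD.zero K K ≫ x = 1) : Lie H T :=
  Additive.ofMul ⟨x, hx⟩

def val (x : Lie H T) : T ⊗ SpecD K K ⟶ H := (Additive.toMul x).1

theorem zero_val (x : Lie H T) : T ◁ SpecD.zero K K ≫ x.val = 1 := (Additive.toMul x).2

@[ext]
theorem ext {x y : Lie H T} (h : x.val = y.val) : x = y := Subtype.ext h

variable [IsSeparated H.hom]

instance : AddGroup (Lie H T) := inferInstanceAs (AddGroup (Additive (lieSubgroup H T)))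

instance : AddCommGroup (Lie H T) where
  add_comm x y := lieSubgroup_mul_comm (Additive.toMul x) (Additive.toMul y)

theorem val_add (x y : Lie H T) : (x + y).val = x.val * y.val := rfl
theorem val_sub (x y : Lie H T) : (x - y).val = x.val / y.val := rfl
theorem val_zero : (0 : Lie H T).val = 1 := rfl

/-- A scalar `a` acts through the endomorphism `ε ↦ aε` of the dual numbers. -/
instance : SMul K (Lie H T) where
  smul a x := mk (T ◁ SpecD.map (a • LinearMap.id) ≫ x.val) (by
    rw [← whiskerLeft_comp_assoc, algOverMap_comp]
    refine Eq.trans ?_ x.zero_val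
    congr 3
    ext; simp)

theorem val_smul (a : K) (x : Lie H T) : (a • x).val = T ◁ SpecD.map (a • LinearMap.id) ≫ x.val :=
  rfl

instance : Module K (Lie H T) where
  one_smul x := by
    ext1
    rw [val_smul, _root_.one_smul, SpecD_map_id]
  mul_smul a b x := by
    ext1
    simp only [val_smul]
    rw [← whiskerLeft_comp_assoc, algOverMap_comp, ← TrivSqZeroExt.map_comp_map]
    congr 4
    ext; simp
  smul_zero a := by ext1; exact comp_one _
  smul_add a x y := by ext1; exact comp_mul _ _ _
  add_smul a b x := by
    ext1
    rw [val_smul, _root_.add_smul]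
    exact lieSubgroup_map_add (Additive.toMul x) _ _
  zero_smul x := by
    ext1
    rw [val_smul]
    exact lieSubgroup_comp (Additive.toMul x) (_root_.zero_smul ..)

/-- Composition of `T ⟶ Lie(H)` with `t : T' ⟶ T`. -/
def pullback (t : T' ⟶ T) : Lie H T →ₗ[K] Lie H T' where
  toFun x := mk (t ▷ SpecD K K ≫ x.val) (by
    rw [whisker_exchange_assoc, zero_val, comp_one])
  map_add' x y := by ext1; exact comp_mul _ _ _
  map_smul' a x := by
    ext1
    exact (whisker_exchange_assoc _ _ _).symm

/-- The adjoint action of `h ∈ H(T)` on `Lie(H)(T)`: conjugation by `h` in `H(T[ε])`. -/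
def Ad (h : T ⟶ H) : Lie H T →ₗ[K] Lie H T where
  toFun x := mk ((fst T (SpecD K K) ≫ h) * x.val * (fst T (SpecD K K) ≫ h)⁻¹) (by
    rw [comp_mul, comp_mul, zero_val, _root_.mul_one, ← comp_mul, mul_inv_cancel, comp_one])
  map_add' x y := by
    ext1
    change _ * (x.val * y.val) * _ = (_ * _ * _) * (_ * _ * _)
    group
  map_smul' a x := by
    ext1
    change _ * (_ ≫ x.val) * _ = _ ≫ (_ * _ * _)
    simp only [comp_mul, GrpObj.comp_inv, whiskerLeft_fst_assoc]
    rfl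

end Lie

variable [GrpObj G] [IsSeparated H.hom]

/-- The 1-cocycles of the Hochschild complex of `G` with values in `Lie(H)`, on which `G` acts via
`Ad ∘ f`: the morphisms `φ : G ⟶ Lie(H)` such that `φ(g₁ g₂) = φ(g₁) + Ad(f(g₁)) φ(g₂)`
identically on `G × G`. -/
def Z1 (f : G ⟶ H) : Submodule K (Lie H G) :=
  LinearMap.eqLocus (Lie.pullback μ[G])
    (Lie.pullback (fst G G) + Lie.Ad (fst G G ≫ f) ∘ₗ Lie.pullback (snd G G))

/-- `x ↦ (g ↦ Ad(f(g)) x - x)`, for `x` in the vector space `Lie(H)`. -/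
def d0 (f : G ⟶ H) : Lie H (𝟙_ (Over (Spec (.of K)))) →ₗ[K] Lie H G :=
  Lie.Ad f ∘ₗ Lie.pullback (toUnit G) - Lie.pullback (toUnit G)

/-- The 1-coboundaries. -/
def B1 (f : G ⟶ H) : Submodule K (Lie H G) := LinearMap.range (d0 f)

theorem Lie.val_pullback (t : T' ⟶ T) (x : Lie H T) : (pullback t x).val = t ▷ SpecD K K ≫ x.val :=
  rfl

theorem Lie.val_Ad (h : T ⟶ H) (x : Lie H T) :
    (Ad h x).val = (fst T (SpecD K K) ≫ h) * x.val * (fst T (SpecD K K) ≫ h)⁻¹ :=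
  rfl

theorem Lie.pullback_pullback (t : T' ⟶ T) (s : T'' ⟶ T') (x : Lie H T) :
    pullback s (pullback t x) = pullback (s ≫ t) x := by
  ext1; simp [val_pullback]

theorem Lie.pullback_Ad (t : T' ⟶ T) (h : T ⟶ H) (x : Lie H T) :
    pullback t (Ad h x) = Ad (t ≫ h) (pullback t x) := by
  ext1; simp [val_pullback, val_Ad, comp_mul, GrpObj.comp_inv]

theorem Lie.Ad_Ad (h h' : T ⟶ H) (x : Lie H T) : Ad h (Ad h' x) = Ad (h * h') x := by
  ext1; simp only [val_Ad, comp_mul]; group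

theorem mem_Z1 (f : G ⟶ H) (φ : Lie H G) : φ ∈ Z1 f ↔ Lie.pullback μ[G] φ =
    Lie.pullback (fst G G) φ + Lie.Ad (fst G G ≫ f) (Lie.pullback (snd G G) φ) :=
  Iff.rfl

theorem d0_apply (f : G ⟶ H) (x : Lie H (𝟙_ (Over (Spec (.of K))))) :
    d0 f x = Lie.Ad f (Lie.pullback (toUnit G) x) - Lie.pullback (toUnit G) x :=
  rfl

theorem B1_le_Z1 (f : G ⟶ H) [IsMonHom f] : B1 f ≤ Z1 f := by
  rintro _ ⟨x, rfl⟩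
  have hm : μ[G] ≫ f = (fst G G ≫ f) * (snd G G ≫ f) := by
    rw [IsMonHom.mul_hom, Hom.mul_def]; congr 1
  rw [mem_Z1, d0_apply]
  simp only [map_sub, Lie.pullback_Ad, Lie.pullback_pullback, Lie.Ad_Ad, hm, comp_toUnit]
  abel

/-- `H¹(G, Lie(H)) = Z¹(G, Lie(H)) / B¹(G, Lie(H))`, where `G` acts on `Lie(H)` via `Ad ∘ f`. -/
abbrev H1 (f : G ⟶ H) [IsMonHom f] : Type u := Z1 f ⧸ (B1 f).submoduleOf (Z1 f)

end Lie
section Affinization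
variable (k : Type u) [Field k]

/-- The affinization `X ↦ Spec 𝒪(X)`, where `𝒪(X)` is the `k`-algebra of global functions. -/
def affinization : Over (Spec (.of k)) ⥤ Over (Spec (.of k)) :=
  algΓ (.of k) ⋙ algSpec (.of k)

/-- Quasi-compact and quasi-separated `k`-schemes. -/
def IsQcqs : ObjectProperty (Over (Spec (.of k))) :=
  fun X => QuasiCompact X.hom ∧ QuasiSeparated X.hom

theorem IsQcqs.of_iso {X Y : Over (Spec (.of k))} (e : X ≅ Y) (h : IsQcqs k X) : IsQcqs k Y := by
  obtain ⟨h1, h2⟩ := h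
  have : IsIso e.inv.left := inferInstanceAs (IsIso ((Over.forget _).map e.inv))
  rw [IsQcqs, ← Over.w e.inv]
  exact ⟨inferInstance, inferInstance⟩

instance : (IsQcqs k).IsClosedUnderLimitsOfShape (Discrete PEmpty.{1}) where
  limitsOfShape_le X := by
    rintro ⟨p⟩
    refine IsQcqs.of_iso k (X := 𝟙_ _) ?_ ⟨?_, ?_⟩
    · exact isTerminalTensorUnit.uniqueUpToIso
        ((isLimitChangeEmptyCone _ p.isLimit _ (Iso.refl _)))
    · exact inferInstanceAs (QuasiCompact (𝟙 _))
    · exact inferInstanceAs (QuasiSeparated (𝟙 _))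

instance : (IsQcqs k).IsClosedUnderLimitsOfShape (Discrete WalkingPair) where
  limitsOfShape_le X := by
    rintro ⟨p⟩
    obtain ⟨h1, h2⟩ := p.prop_diag_obj ⟨.left⟩
    obtain ⟨h3, h4⟩ := p.prop_diag_obj ⟨.right⟩
    refine IsQcqs.of_iso k (X := p.diag.obj ⟨.left⟩ ⊗ p.diag.obj ⟨.right⟩) ?_ ⟨?_, ?_⟩
    · exact (tensorProductIsBinaryProduct _ _).conePointUniqueUpToIso
        ((IsLimit.postcomposeHomEquiv (diagramIsoPair p.diag) _).symm p.isLimit)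
    · rw [Over.tensorObj_hom]; infer_instance
    · rw [Over.tensorObj_hom]; infer_instance

/-- Künneth: `𝒪(A × B) = 𝒪(A) ⊗ 𝒪(B)` for quasi-compact quasi-separated schemes over a field. -/
theorem affinization_isPullback (A B : Over (Spec (.of k))) (hA : IsQcqs k A) (hB : IsQcqs k B) :
    IsPullback ((affinization k).map (fst A B)).left ((affinization k).map (snd A B)).left
      ((affinization k).obj A).hom ((affinization k).obj B).hom := by
  obtain ⟨_, _⟩ := hA
  obtain ⟨_, _⟩ := hB
  have : Subsingleton (Spec (CommRingCat.of k)) := inferInstanceAs (Subsingleton (PrimeSpectrum k))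
  have : Flat B.hom := inferInstance
  have : CompactSpace A.left := QuasiCompact.compactSpace_of_compactSpace A.hom
  have : CompactSpace B.left := QuasiCompact.compactSpace_of_compactSpace B.hom
  have : QuasiSeparatedSpace A.left := quasiSeparatedSpace_of_quasiSeparated A.hom
  have : QuasiSeparatedSpace B.left := quasiSeparatedSpace_of_quasiSeparated B.hom
  have hflat : (A.hom.appLE ⊤ ⊤ le_top).hom.Flat := by
    have h1 : ((Scheme.ΓSpecIso (.of k)).inv ≫ A.hom.appLE ⊤ ⊤ le_top).hom.Flat := by
      algebraize [((Scheme.ΓSpecIso (.of k)).inv ≫ A.hom.appLE ⊤ ⊤ le_top).hom]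
      exact @Module.Flat.of_free k _ _ _ _ (@Module.Free.of_divisionRing k _ _ _ _)
    have h2 : (Scheme.ΓSpecIso (.of k)).hom.hom.Flat :=
      .of_bijective (ConcreteCategory.bijective_of_isIso _)
    have := h2.comp h1
    rwa [← CommRingCat.hom_comp, Iso.hom_inv_id_assoc] at this
  have H := (isIso_pushoutSection_iff (.of_hasPullback A.hom B.hom) (US := ⊤) (UT := ⊤) (UX := ⊤)
    (UY := ⊤) le_top le_top (by simp)).mp
    (isIso_pushoutSection_of_isCompact_of_flat_right_of_ringHomFlat _ _ _ _ (isAffineOpen_top _)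
      isCompact_univ isQuasiSeparated_univ isCompact_univ isQuasiSeparated_univ hflat)
  have H1 : IsPushout A.hom.appTop B.hom.appTop (fst A B).left.appTop (snd A B).left.appTop := by
    have e {X Y : Scheme.{u}} (f : X ⟶ Y) : f.appLE ⊤ ⊤ le_top = f.appTop :=
      f.app_eq_appLE.symm
    rw [e, e, e, e] at H
    exact H
  have H2 : IsPushout ((Scheme.ΓSpecIso (.of k)).inv ≫ A.hom.appTop)
      ((Scheme.ΓSpecIso (.of k)).inv ≫ B.hom.appTop)
      (fst A B).left.appTop (snd A B).left.appTop :=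
    .of_iso H1 (Scheme.ΓSpecIso (.of k)) (.refl _) (.refl _) (.refl _) (by simp) (by simp)
      (by simp) (by simp)
  exact isPullback_SpecMap_of_isPushout _ _ _ _ H2

instance : PreservesFiniteProducts ((IsQcqs k).ι ⋙ affinization k) := by
  let F := (IsQcqs k).ι ⋙ affinization k
  have (A B : (IsQcqs k).FullSubcategory) : IsIso (CartesianMonoidalCategory.prodComparison F A B) := by
    have h := affinization_isPullback k A.1 B.1 A.2 B.2
    have : IsIso ((Over.forget _).map (CartesianMonoidalCategory.prodComparison F A B)) :=
      inferInstanceAs (IsIso h.isoPullback.hom)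
    exact isIso_of_reflects_iso _ (Over.forget _)
  have : IsIso (CartesianMonoidalCategory.terminalComparison F) := by
    have : IsIso ((Over.forget _).map (CartesianMonoidalCategory.terminalComparison F)) :=
      have h : IsIso (Spec.map ((Scheme.ΓSpecIso (.of k)).inv ≫
          Scheme.Hom.appTop (𝟙 (Spec (CommRingCat.of k))))) := by
        rw [Scheme.Hom.id_appTop]; infer_instance
      h
    exact isIso_of_reflects_iso _ (Over.forget _)
  have := preservesLimitsOfShape_discrete_walkingPair_of_isIso_prodComparison F
  have := preservesLimit_empty_of_isIso_terminalComparison F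
  have := Limits.preservesLimitsOfShape_pempty_of_preservesTerminal F
  exact .of_preserves_binary_and_terminal _

instance : ((IsQcqs k).ι ⋙ affinization k).Monoidal := .ofChosenFiniteProducts _

variable {k}
instance (G : Over (Spec (.of k))) [GrpObj G] [h1 : QuasiCompact G.hom]
    [h2 : QuasiSeparated G.hom] :
    GrpObj (⟨G, h1, h2⟩ : (IsQcqs k).FullSubcategory) where
  one := ObjectProperty.homMk η[G]
  mul := ObjectProperty.homMk μ[G]
  inv := ObjectProperty.homMk ι[G]
  one_mul := by ext1; exact MonObj.one_mul G
  mul_one := by ext1; exact MonObj.mul_one G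
  mul_assoc := by ext1; exact MonObj.mul_assoc G
  left_inv := by ext1; exact GrpObj.left_inv G
  right_inv := by ext1; exact GrpObj.right_inv G

/-- The group structure on `G^aff = Spec 𝒪(G)`, induced from that of `G`: affinization preserves
finite products of quasi-compact quasi-separated schemes over a field. -/
instance (G : Over (Spec (.of k))) [GrpObj G] [h1 : QuasiCompact G.hom]
    [h2 : QuasiSeparated G.hom] :
    GrpObj ((affinization k).obj G) :=
  inferInstanceAs (GrpObj (((IsQcqs k).ι ⋙ affinization k).obj ⟨G, h1, h2⟩))

end Affinization

section Rep
open TensorProduct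

variable {k : Type u} [Field k]

/-- The `k`-algebra `𝒪(X)` of global functions. -/
abbrev coordRing (X : Over (Spec (.of k))) : Type u := ((algΓ (.of k)).obj X).unop

/-- The pullback of functions `f^* : 𝒪(Y) → 𝒪(X)`. -/
abbrev comorphism {X Y : Over (Spec (.of k))} (f : X ⟶ Y) : coordRing Y →ₐ[k] coordRing X :=
  ((algΓ (.of k)).map f).unop.hom

/-- An `A`-module structure on a `k`-vector space `V`, of arbitrary dimension, given by a coaction
`v ↦ ∑ vᵢ ⊗ aᵢ`, i.e. `g · v = ∑ aᵢ(g) vᵢ`. The two axioms express `1 · v = v` and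
`(g h) · v = g · (h · v)`, the latter as an identity in `V ⊗ 𝒪(A × A)`. -/
structure Rep (A : Over (Spec (.of k))) [GrpObj A] (V : Type u) [AddCommGroup V] [Module k V] where
  coact : V →ₗ[k] V ⊗[k] coordRing A
  coact_one (v : V) : (comorphism η[A]).toLinearMap.lTensor V (coact v) = v ⊗ₜ[k] 1
  coact_mul (v : V) : (comorphism μ[A]).toLinearMap.lTensor V (coact v) =
    (Algebra.TensorProduct.productMap (comorphism (fst A A))
      (comorphism (snd A A))).toLinearMap.lTensor V
        (TensorProduct.assoc k V (coordRing A) (coordRing A)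
          (coact.rTensor (coordRing A) (coact v)))

/-- `W` is an `A`-submodule: the coaction maps `W` into `W ⊗ 𝒪(A)`. -/
def Rep.IsStable {A : Over (Spec (.of k))} [GrpObj A] {V : Type u} [AddCommGroup V] [Module k V]
    (ρ : Rep A V) (W : Submodule k V) : Prop :=
  ∀ w ∈ W, ρ.coact w ∈ LinearMap.range (W.subtype.rTensor (coordRing A))

/-- Every `A`-module is semi-simple, i.e. each of its submodules has a complementary submodule. -/
def IsLinearlyReductive (A : Over (Spec (.of k))) [GrpObj A] : Prop :=
  ∀ (V : Type u) [AddCommGroup V] [Module k V] (ρ : Rep A V) (W : Submodule k V),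
    ρ.IsStable W → ∃ W' : Submodule k V, ρ.IsStable W' ∧ IsCompl W W'

end Rep

section Points
variable {k : Type u} [Field k] {K : Type u} [Field K] [Algebra k K]
  {G H M : Over (Spec (.of k))} [GrpObj G] [GrpObj H]

instance [IsSeparated H.hom] : IsSeparated (baseChange K H).hom :=
  inferInstanceAs (IsSeparated (pullback.snd H.hom (algOver k K).hom))

/-- The homomorphism `G_K ⟶ H_K` corresponding to a point `f ∈ M(K)`, where `M` represents
`Hom_gp(G, H)`. -/
def homOfPoint (α : (homGp G H).RepresentableBy M) (f : algOver k K ⟶ M) :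
    baseChange K G ⟶ baseChange K H :=
  HomPoints.toHom (α.homEquiv f)

instance (α : (homGp G H).RepresentableBy M) (f : algOver k K ⟶ M) :
    IsMonHom (homOfPoint α f) :=
  HomPoints.isMonHom_toHom (α.homEquiv f)
end Points

end HomScheme

end

/-!
Since `H` is smooth, the sources of `γ` and of the `γ_f` are smooth, so smoothness of these
morphisms is a question of lifting tangent vectors at points with values in a field `K`. Conjugation
by `H` reduces it to tangent vectors at the unit of `H`. A tangent vector to `M` at `f` is a
homomorphism over the dual numbers `K[ε]` lifting `f`, and dividing it by `f` gives a cocycle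
`φ : G_K → Lie(H_K)`; the deformations of `f` obtained by conjugating with points of `H(K[ε])` over
the unit correspond to the coboundaries. Thus each of the three conditions says that every first
order deformation of every `f` is infinitesimally conjugate to `f`.

If `G^aff` is linearly reductive, morphisms `G_K → Lie(H_K)` are elements of `Lie(H_K) ⊗ O(G)`, a
cocycle defines an extension of the trivial representation by `Lie(H_K)`, and a splitting of this
extension exhibits the cocycle as a coboundary.
-/

noncomputable section
namespace HomScheme

section DerivationAlong
variable {k A B N : Type*} [CommRing k] [CommRing A] [Algebra k A] [CommRing B] [Algebra k B]
  [AddCommGroup N] [Module k N] [Module B N]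

/-- `δ` is a `k`-derivation of `A` with values in `N`, regarded as an `A`-module through `ε`. Unlike
for `Derivation`, this `A`-module structure on `N` need not be an instance. -/
def IsDerivationAlong (ε : A →ₐ[k] B) (δ : A →ₗ[k] N) : Prop :=
  ∀ a b, δ (a * b) = ε a • δ b + ε b • δ a

namespace IsDerivationAlong
variable {ε : A →ₐ[k] B} {δ : A →ₗ[k] N}

theorem map_one (h : IsDerivationAlong ε δ) : δ 1 = 0 := by
  simpa using h 1 1

variable [Module Bᵐᵒᵖ N] [IsCentralScalar B N] [IsScalarTower k B N] [IsScalarTower k Bᵐᵒᵖ N]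

/-- The homomorphism `ε + δ` to the square-zero extension `B ⊕ N` given by a derivation `δ`
along `ε`. -/
def toAlgHom (h : IsDerivationAlong ε δ) : A →ₐ[k] TrivSqZeroExt B N :=
  .ofLinearMap ((TrivSqZeroExt.inlAlgHom k B N).toLinearMap ∘ₗ ε.toLinearMap +
    (TrivSqZeroExt.inrHom B N).restrictScalars k ∘ₗ δ) (by simp [h.map_one])
    fun a b => TrivSqZeroExt.ext (by simp) (by simp [h a b])

@[simp]
theorem fst_toAlgHom (h : IsDerivationAlong ε δ) (a : A) : (h.toAlgHom a).fst = ε a := by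
  simp [toAlgHom]

@[simp]
theorem snd_toAlgHom (h : IsDerivationAlong ε δ) (a : A) : (h.toAlgHom a).snd = δ a := by
  simp [toAlgHom]

end IsDerivationAlong
end DerivationAlong

section Jacobian
open TensorProduct KaehlerDifferential IsLocalRing
universe v w

theorem formallySmooth_of_leftInverse_mapBaseChange {R : Type u} {S : Type v} {T : Type w}
    [CommRing R] [CommRing S] [CommRing T] [Algebra R S] [Algebra S T] [Algebra R T]
    [IsScalarTower R S T] [Algebra.FormallySmooth R T] (l : Ω[T⁄R] →ₗ[T] T ⊗[S] Ω[S⁄R])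
    (hl : l ∘ₗ mapBaseChange R S T = LinearMap.id) : Algebra.FormallySmooth S T := by
  have hinj : Function.Injective (mapBaseChange R S T) :=
    Function.LeftInverse.injective (g := l) (LinearMap.congr_fun hl)
  refine ⟨?_, subsingleton_of_forall_eq 0 fun a => ?_⟩
  · have hsplit := (exact_mapBaseChange_map R S T).split_tfae hinj
      (KaehlerDifferential.map_surjective R S T)
    obtain ⟨r, hr⟩ := (hsplit.out 1 0 :).mp ⟨l, hl⟩
    exact Module.Projective.of_split _ _ hr
  · have hδ : mapBaseChange R S T (Algebra.H1Cotangent.δ R S T a) = 0 :=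
      (Algebra.H1Cotangent.exact_δ_mapBaseChange R S T).apply_apply_eq_zero a
    obtain ⟨c, rfl⟩ :=
      (Algebra.H1Cotangent.exact_map_δ R S T a).mp (hinj (hδ.trans (map_zero _).symm))
    rw [Subsingleton.elim c 0, map_zero]

variable {R S T : Type*} [CommRing R] [CommRing S] [CommRing T] [IsLocalRing T]
  [Algebra R S] [Algebra S T] [Algebra R T] [IsScalarTower R S T]

theorem lTensor_mapBaseChange_injective_of_exists_derivation
    (h : ∀ d : Derivation R S (ResidueField T),
      ∃ d' : Derivation R T (ResidueField T), ∀ s, d' (algebraMap S T s) = d s) :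
    Function.Injective ((mapBaseChange R S T).lTensor (ResidueField T)) := by
  let f : ResidueField T ⊗[T] (T ⊗[S] Ω[S⁄R]) →ₗ[ResidueField T] ResidueField T ⊗[T] Ω[T⁄R] :=
    (mapBaseChange R S T).baseChange (ResidueField T)
  change Function.Injective f
  rw [← LinearMap.dualMap_surjective_iff]
  intro φ
  let d : Derivation R S (ResidueField T) := (φ.restrictScalars S ∘ₗ
    (TensorProduct.mk T (ResidueField T) (T ⊗[S] Ω[S⁄R]) 1).restrictScalars S ∘ₗ
    TensorProduct.mk S T Ω[S⁄R] 1).compDer (D R S)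
  obtain ⟨d', hd'⟩ := h d
  refine ⟨AlgebraTensorModule.lift
    ((LinearMap.ringLmapEquivSelf (ResidueField T) (ResidueField T) _).symm
      d'.liftKaehlerDifferential), ?_⟩
  apply AlgebraTensorModule.curry_injective
  ext1
  apply AlgebraTensorModule.curry_injective
  ext1
  apply Derivation.liftKaehlerDifferential_unique
  ext s
  simp [f, d, hd' s]

theorem formallySmooth_of_exists_derivation [Algebra.FormallySmooth R T]
    [Algebra.EssFiniteType R T] [Algebra.EssFiniteType R S]
    (h : ∀ d : Derivation R S (ResidueField T),
      ∃ d' : Derivation R T (ResidueField T), ∀ s, d' (algebraMap S T s) = d s) :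
    Algebra.FormallySmooth S T := by
  have : Module.Free T Ω[T⁄R] := Module.free_of_flat_of_isLocalRing
  obtain ⟨l, hl⟩ := (split_injective_iff_lTensor_residueField_injective
    (mapBaseChange R S T)).mpr (lTensor_mapBaseChange_injective_of_exists_derivation h)
  exact formallySmooth_of_leftInverse_mapBaseChange l hl

theorem formallySmooth_of_exists_algHom_trivSqZeroExt [Algebra.FormallySmooth R T]
    [Algebra.EssFiniteType R T] [Algebra.EssFiniteType R S]
    (h : ∀ φ : S →ₐ[R] TrivSqZeroExt (ResidueField T) (ResidueField T),
      (∀ s, (φ s).fst = algebraMap S (ResidueField T) s) →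
      ∃ ψ : T →ₐ[R] TrivSqZeroExt (ResidueField T) (ResidueField T),
        (∀ t, (ψ t).fst = algebraMap T (ResidueField T) t) ∧ ∀ s, ψ (algebraMap S T s) = φ s) :
    Algebra.FormallySmooth S T := by
  refine formallySmooth_of_exists_derivation (R := R) fun d => ?_
  have hd : IsDerivationAlong (IsScalarTower.toAlgHom R S (ResidueField T)) d.toLinearMap :=
    fun a b => by simp [Algebra.smul_def]
  obtain ⟨ψ, hψ, hψS⟩ := h hd.toAlgHom hd.fst_toAlgHom
  let δ : T →ₗ[R] ResidueField T :=
    (TrivSqZeroExt.sndHom (ResidueField T) (ResidueField T)).restrictScalars R ∘ₗ ψ.toLinearMap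
  refine ⟨.mk' δ fun a b => ?_, fun s => ?_⟩
  · simp [δ, hψ, Algebra.smul_def, mul_comm (ψ a).snd]
  · simp [δ, hψS]

theorem exists_ringHom_trivSqZeroExt_of_formallySmooth {S T B N : Type*} [CommRing S] [CommRing T]
    [Algebra S T] [Algebra.FormallySmooth S T] [CommRing B] [AddCommGroup N] [Module B N]
    [Module Bᵐᵒᵖ N] [IsCentralScalar B N] (a : T →+* B) (φ : S →+* TrivSqZeroExt B N)
    (h : ∀ s, (φ s).fst = a (algebraMap S T s)) :
    ∃ ψ : T →+* TrivSqZeroExt B N, (∀ t, (ψ t).fst = a t) ∧ ∀ s, ψ (algebraMap S T s) = φ s := by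
  algebraize [φ, a.comp (algebraMap S T)]
  let q : TrivSqZeroExt B N →ₐ[S] B :=
    { (TrivSqZeroExt.fstHom B B N).toRingHom with commutes' := h }
  let a' : T →ₐ[S] B := { a with commutes' := fun _ => rfl }
  have hq : Function.Surjective q := fun r => ⟨TrivSqZeroExt.inl r, rfl⟩
  have hq' : IsNilpotent (RingHom.ker (q : TrivSqZeroExt B N →+* B)) :=
    ⟨2, TrivSqZeroExt.kerIdeal_sq B N⟩
  exact ⟨(Algebra.FormallySmooth.liftOfSurjective a' q hq hq').toRingHom,
    Algebra.FormallySmooth.liftOfSurjective_apply a' q hq hq',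
    (Algebra.FormallySmooth.liftOfSurjective a' q hq hq').commutes⟩

end Jacobian

section TangentVectors

/-- The closed point `Spec K ⟶ Spec K[ε]`. -/
abbrev dualZero (K : Type u) [Field K] : Spec (.of K) ⟶ Spec (.of (TrivSqZeroExt K K)) :=
  Spec.map (CommRingCat.ofHom (TrivSqZeroExt.fstHom K K K).toRingHom)

/-- The structure morphism `Spec K[ε] ⟶ Spec K`. -/
abbrev dualProj (K : Type u) [Field K] : Spec (.of (TrivSqZeroExt K K)) ⟶ Spec (.of K) :=
  Spec.map (CommRingCat.ofHom (algebraMap K (TrivSqZeroExt K K)))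

variable {X Y S : Scheme.{u}}

theorem exists_specMap_comp_fromSpecStalk_eq {R : CommRingCat.{u}} [IsLocalRing R]
    (z : Spec R ⟶ X) {x : X} (hx : z (IsLocalRing.closedPoint R) = x) :
    ∃ ψ : X.presheaf.stalk x ⟶ R, IsLocalHom ψ.hom ∧ Spec.map ψ ≫ X.fromSpecStalk x = z := by
  subst hx
  exact ⟨_, inferInstance, Scheme.Spec_stalkClosedPointTo_fromSpecStalk z⟩

theorem specMap_comp_fromSpecStalk_injective {R : CommRingCat.{u}} {x : X} :
    Function.Injective fun a : X.presheaf.stalk x ⟶ R => Spec.map a ≫ X.fromSpecStalk x :=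
  fun _ _ h => Spec.map_injective ((cancel_mono _).mp h)

theorem apply_closedPoint_of_specMap_comp_eq {R R' : CommRingCat.{u}} [IsLocalRing R]
    [IsLocalRing R'] (i : R ⟶ R') [IsLocalHom i.hom] (z : Spec R ⟶ X) {x : X}
    (a : X.presheaf.stalk x ⟶ R') [IsLocalHom a.hom]
    (h : Spec.map i ≫ z = Spec.map a ≫ X.fromSpecStalk x) :
    z (IsLocalRing.closedPoint R) = x := by
  have hz : z (Spec.map i (IsLocalRing.closedPoint R')) =
      X.fromSpecStalk x (Spec.map a (IsLocalRing.closedPoint R')) :=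
    congr($h (IsLocalRing.closedPoint R'))
  have hi : Spec.map i (IsLocalRing.closedPoint R') = IsLocalRing.closedPoint R := Spec_closedPoint
  have ha : Spec.map a (IsLocalRing.closedPoint R') = IsLocalRing.closedPoint _ := Spec_closedPoint
  exact (congr(z $hi).symm.trans hz).trans
    (congr(X.fromSpecStalk x $ha).trans Scheme.fromSpecStalk_closedPoint)

theorem exists_specMap_comp_fromSpecStalk_eq_of_dualZero {K : Type u} [Field K] {x : X}
    (z : Spec (.of (TrivSqZeroExt K K)) ⟶ X) (a : X.presheaf.stalk x ⟶ .of K) [IsLocalHom a.hom]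
    (h : dualZero K ≫ z = Spec.map a ≫ X.fromSpecStalk x) :
    ∃ ψ : X.presheaf.stalk x ⟶ .of (TrivSqZeroExt K K),
      ψ ≫ CommRingCat.ofHom (TrivSqZeroExt.fstHom K K K).toRingHom = a ∧
      Spec.map ψ ≫ X.fromSpecStalk x = z := by
  have : IsLocalHom (CommRingCat.ofHom (TrivSqZeroExt.fstHom K K K).toRingHom).hom :=
    ⟨fun _ h => TrivSqZeroExt.isUnit_iff_isUnit_fst.mpr h⟩
  have : IsLocalRing (CommRingCat.of (TrivSqZeroExt K K)) :=
    inferInstanceAs (IsLocalRing (DualNumber K))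
  obtain ⟨ψ, -, hψ⟩ := exists_specMap_comp_fromSpecStalk_eq z
    (apply_closedPoint_of_specMap_comp_eq _ z a h)
  refine ⟨ψ, specMap_comp_fromSpecStalk_injective ?_, hψ⟩
  simp only [Spec.map_comp, Category.assoc, hψ, h]

theorem exists_tangent_lift_of_smooth (f : X ⟶ Y) [Smooth f] (K : Type u) [Field K]
    (x : Spec (.of K) ⟶ X) (y : Spec (.of (TrivSqZeroExt K K)) ⟶ Y)
    (h : dualZero K ≫ y = x ≫ f) :
    ∃ z : Spec (.of (TrivSqZeroExt K K)) ⟶ X, dualZero K ≫ z = x ∧ z ≫ f = y := by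
  obtain ⟨p, a, hloc, rfl⟩ : ∃ (p : X) (a : X.presheaf.stalk p ⟶ .of K), IsLocalHom a.hom ∧
    Spec.map a ≫ X.fromSpecStalk p = x := ⟨_, exists_specMap_comp_fromSpecStalk_eq x rfl⟩
  have : IsLocalHom (f.stalkMap p ≫ a).hom := RingHom.isLocalHom_comp a.hom (f.stalkMap p).hom
  obtain ⟨b, hab, rfl⟩ := exists_specMap_comp_fromSpecStalk_eq_of_dualZero y (f.stalkMap p ≫ a) (by
    rw [h, Spec.map_comp, Category.assoc, Category.assoc, Scheme.SpecMap_stalkMap_fromSpecStalk])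
  have hs : (f.stalkMap p).hom.FormallySmooth :=
    Scheme.Hom.mem_smoothLocus.mp (f.smoothLocus_eq_top.ge (Set.mem_univ p))
  algebraize [(f.stalkMap p).hom]
  obtain ⟨c, hca, hcb⟩ := exists_ringHom_trivSqZeroExt_of_formallySmooth a.hom b.hom
    (fun s => congr($hab s))
  refine ⟨Spec.map (CommRingCat.ofHom c) ≫ X.fromSpecStalk p, ?_, ?_⟩
  · rw [← Spec.map_comp_assoc]
    congr 2
    ext r
    exact hca r
  · rw [Category.assoc, ← Scheme.SpecMap_stalkMap_fromSpecStalk, ← Spec.map_comp_assoc]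
    congr 2
    exact CommRingCat.hom_ext (RingHom.ext hcb)

theorem exists_stalk_lift_of_tangent_lift (f : X ⟶ Y) {x : X} {K : Type u} [Field K]
    (a : X.presheaf.stalk x ⟶ .of K) [IsLocalHom a.hom]
    (φ : Y.presheaf.stalk (f x) ⟶ .of (TrivSqZeroExt K K)) (z : Spec (.of (TrivSqZeroExt K K)) ⟶ X)
    (hza : dualZero K ≫ z = Spec.map a ≫ X.fromSpecStalk x)
    (hzφ : z ≫ f = Spec.map φ ≫ Y.fromSpecStalk (f x)) :
    ∃ ψ : X.presheaf.stalk x ⟶ .of (TrivSqZeroExt K K),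
      ψ ≫ CommRingCat.ofHom (TrivSqZeroExt.fstHom K K K).toRingHom = a ∧ f.stalkMap x ≫ ψ = φ := by
  obtain ⟨ψ, hψa, rfl⟩ := exists_specMap_comp_fromSpecStalk_eq_of_dualZero z a hza
  refine ⟨ψ, hψa, specMap_comp_fromSpecStalk_injective ?_⟩
  simp only [Spec.map_comp, Category.assoc, Scheme.SpecMap_stalkMap_fromSpecStalk, ← hzφ]

/-- The relative Jacobian criterion, in terms of vectors tangent to the fibres over `S`. -/
theorem smooth_of_exists_tangent_lift (f : X ⟶ Y) (p : Y ⟶ S) [LocallyOfFinitePresentation f]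
    [Smooth (f ≫ p)] [LocallyOfFiniteType p]
    (h : ∀ (K : Type u) [Field K] (x : Spec (.of K) ⟶ X)
      (y : Spec (.of (TrivSqZeroExt K K)) ⟶ Y), dualZero K ≫ y = x ≫ f →
      y ≫ p = dualProj K ≫ x ≫ f ≫ p →
      ∃ z : Spec (.of (TrivSqZeroExt K K)) ⟶ X, dualZero K ≫ z = x ∧ z ≫ f = y) :
    Smooth f := by
  rw [← Scheme.Hom.smoothLocus_eq_top_iff, ← top_le_iff]
  rintro x -
  rw [Scheme.Hom.mem_smoothLocus]
  have hcomp : ((f ≫ p).stalkMap x).hom = (f.stalkMap x).hom.comp (p.stalkMap (f x)).hom :=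
    congr(($(Scheme.Hom.stalkMap_comp f p x)).hom)
  have hs : ((f.stalkMap x).hom.comp (p.stalkMap (f x)).hom).FormallySmooth :=
    hcomp ▸ Scheme.Hom.mem_smoothLocus.mp ((f ≫ p).smoothLocus_eq_top.ge (Set.mem_univ x))
  have hfp : ((f.stalkMap x).hom.comp (p.stalkMap (f x)).hom).EssFiniteType :=
    hcomp ▸ LocallyOfFiniteType.stalkMap (f ≫ p) x
  have hp : (p.stalkMap (f x)).hom.EssFiniteType := LocallyOfFiniteType.stalkMap p (f x)
  algebraize [(p.stalkMap (f x)).hom, (f.stalkMap x).hom,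
    (f.stalkMap x).hom.comp (p.stalkMap (f x)).hom]
  refine formallySmooth_of_exists_algHom_trivSqZeroExt (R := S.presheaf.stalk (p (f x)))
    fun φ hφ => ?_
  let K := IsLocalRing.ResidueField (X.presheaf.stalk x)
  let r : X.presheaf.stalk x ⟶ .of K :=
    CommRingCat.ofHom (IsLocalRing.residue (X.presheaf.stalk x))
  have hr : IsLocalHom r.hom := inferInstanceAs (IsLocalHom (IsLocalRing.residue _))
  let φ' : Y.presheaf.stalk (f x) ⟶ .of (TrivSqZeroExt K K) := CommRingCat.ofHom φ.toRingHom
  have hφr : φ' ≫ CommRingCat.ofHom (TrivSqZeroExt.fstHom K K K).toRingHom = f.stalkMap x ≫ r :=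
    CommRingCat.hom_ext (RingHom.ext hφ)
  have hφp : p.stalkMap (f x) ≫ φ' = p.stalkMap (f x) ≫ f.stalkMap x ≫ r ≫
      CommRingCat.ofHom (algebraMap K (TrivSqZeroExt K K)) :=
    CommRingCat.hom_ext (RingHom.ext φ.commutes)
  obtain ⟨z, hz, hzf⟩ := h K (Spec.map r ≫ X.fromSpecStalk x)
    (Spec.map φ' ≫ Y.fromSpecStalk (f x))
    (by rw [← Spec.map_comp_assoc, hφr, Spec.map_comp, Category.assoc, Category.assoc,
      Scheme.SpecMap_stalkMap_fromSpecStalk])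
    (by
      simp only [Category.assoc]
      rw [← Scheme.SpecMap_stalkMap_fromSpecStalk, ← Spec.map_comp_assoc, hφp,
        ← Scheme.SpecMap_stalkMap_fromSpecStalk_assoc, ← Scheme.SpecMap_stalkMap_fromSpecStalk]
      simp only [Spec.map_comp, Category.assoc])
  obtain ⟨ψ, hψr, hψφ⟩ := exists_stalk_lift_of_tangent_lift f r φ' z hz hzf
  have hψS (s : Y.presheaf.stalk (f x)) : ψ.hom (f.stalkMap x s) = φ s := congr($hψφ s)
  exact ⟨⟨ψ.hom, fun a => (hψS _).trans (φ.commutes a)⟩, fun t => congr($hψr t), hψS⟩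

end TangentVectors

section ConjAction
variable {S : Scheme.{u}} {G H M : Over S} [GrpObj G] [GrpObj H] {T T' T'' : Over S}

namespace HomPoints

theorem pullback_id (f : HomPoints G H T) : f.pullback (𝟙 T) = f :=
  Subtype.ext (by simp [pullback])

theorem pullback_pullback (u : T' ⟶ T) (v : T'' ⟶ T') (f : HomPoints G H T) :
    (f.pullback u).pullback v = f.pullback (v ≫ u) :=
  Subtype.ext (by simp [pullback])

theorem pullback_conj (u : T' ⟶ T) (h : T ⟶ H) (f : HomPoints G H T) :
    (f.conj h).pullback u = (f.pullback u).conj (u ≫ h) :=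
  Subtype.ext (by simp [pullback, conj, comp_mul, GrpObj.comp_inv])

theorem conj_conj (h h' : T ⟶ H) (f : HomPoints G H T) : (f.conj h').conj h = f.conj (h * h') :=
  Subtype.ext (by simp only [conj, comp_mul]; group)

theorem conj_one (f : HomPoints G H T) : f.conj 1 = f :=
  Subtype.ext (by simp [conj, comp_one])

end HomPoints

/-- The bijection `M(T) = Hom_gp(G, H)(T)`. -/
def pointEquiv (α : (homGp G H).RepresentableBy M) : (T ⟶ M) ≃ HomPoints G H T :=
  α.homEquiv

theorem pointEquiv_comp (α : (homGp G H).RepresentableBy M) (u : T' ⟶ T) (m : T ⟶ M) :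
    pointEquiv α (u ≫ m) = (pointEquiv α m).pullback u :=
  α.homEquiv_comp u m

/-- The orbit map `H × T ⟶ M × T`, `(h, t) ↦ (h m(t) h⁻¹, t)`, of a point `m ∈ M(T)`. -/
def orbitGraph (α : (homGp G H).RepresentableBy M) (m : T ⟶ M) : H ⊗ T ⟶ M ⊗ T :=
  lift ((pointEquiv α).symm ((pointEquiv α (snd H T ≫ m)).conj (fst H T))) (snd H T)

theorem conjGraph_eq_orbitGraph (α : (homGp G H).RepresentableBy M) :
    conjGraph α = orbitGraph α (𝟙 M) := by
  rw [orbitGraph, Category.comp_id]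
  rfl

theorem lift_orbitGraph (α : (homGp G H).RepresentableBy M) (m : T ⟶ M) (h : T' ⟶ H)
    (t : T' ⟶ T) :
    lift h t ≫ orbitGraph α m = lift ((pointEquiv α).symm ((pointEquiv α (t ≫ m)).conj h)) t := by
  apply CartesianMonoidalCategory.hom_ext
  · rw [orbitGraph, Category.assoc, lift_fst, lift_fst]
    apply (pointEquiv α).injective
    rw [pointEquiv_comp]
    simp [HomPoints.pullback_conj, ← pointEquiv_comp]
  · simp [orbitGraph]

@[simp]
theorem orbitGraph_snd (α : (homGp G H).RepresentableBy M) (m : T ⟶ M) :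
    orbitGraph α m ≫ snd M T = snd H T :=
  lift_snd _ _

theorem isPullback_whiskerLeft {C : Type*} [Category C] [CartesianMonoidalCategory C] (X : C)
    {Y Z : C} (g : Y ⟶ Z) : IsPullback (X ◁ g) (snd X Y) (snd X Z) g :=
  ⟨⟨whiskerLeft_snd X g⟩, ⟨PullbackCone.IsLimit.mk _
    (fun s => lift (s.fst ≫ fst X Z) s.snd)
    (fun s => CartesianMonoidalCategory.hom_ext _ _ (by simp) (by simpa using s.condition.symm))
    (fun s => by simp)
    (fun s n h₁ h₂ => CartesianMonoidalCategory.hom_ext _ _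
      (by simpa using congr($h₁ ≫ fst X Z)) (by simpa using h₂))⟩⟩

theorem isPullback_orbitGraph (α : (homGp G H).RepresentableBy M) (m : T ⟶ M) (u : T' ⟶ T) :
    IsPullback (H ◁ u) (orbitGraph α (u ≫ m)) (orbitGraph α m) (M ◁ u) := by
  have hH := isPullback_whiskerLeft H u
  rw [← orbitGraph_snd α m, ← orbitGraph_snd α (u ≫ m)] at hH
  refine hH.of_bot ?_ (isPullback_whiskerLeft M u)
  have hu : H ◁ u = lift (fst H T') (snd H T' ≫ u) := by
    apply CartesianMonoidalCategory.hom_ext <;> simp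
  rw [hu, lift_orbitGraph]
  apply CartesianMonoidalCategory.hom_ext <;> simp [orbitGraph]

theorem smooth_orbitGraph_of_smooth_conjGraph (α : (homGp G H).RepresentableBy M)
    [Smooth (conjGraph α).left] (m : T ⟶ M) : Smooth (orbitGraph α m).left := by
  have h := (isPullback_orbitGraph α (𝟙 M) m).map (Over.forget S)
  rw [Category.comp_id, ← conjGraph_eq_orbitGraph] at h
  exact MorphismProperty.of_isPullback h ‹Smooth (conjGraph α).left›

end ConjAction

section Rigidity
variable {k : Type u} [Field k] {K : Type u} [Field K] [Algebra k K]

variable (k K) in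
/-- The closed point of `Spec K[ε]`, over a subfield `k` of `K`. -/
abbrev dualZeroOver : algOver k K ⟶ algOver k (TrivSqZeroExt K K) :=
  algOverMap (TrivSqZeroExt.fstHom k K K)

variable (k K) in
/-- The projection `Spec K[ε] ⟶ Spec K`, over a subfield `k` of `K`. -/
abbrev dualProjOver : algOver k (TrivSqZeroExt K K) ⟶ algOver k K :=
  algOverMap (TrivSqZeroExt.inlAlgHom k K K)

variable (k K) in
theorem dualZeroOver_dualProjOver : dualZeroOver k K ≫ dualProjOver k K = 𝟙 _ := by
  rw [algOverMap_comp, ← algOverMap_id]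
  congr 1

theorem dualZeroOver_dualProjOver_assoc {X : Over (Spec (.of k))} (x : algOver k K ⟶ X) :
    dualZeroOver k K ≫ dualProjOver k K ≫ x = x := by
  rw [← Category.assoc, dualZeroOver_dualProjOver, Category.id_comp]

theorem exists_over_tangent_lift_of_smooth {X Y : Over (Spec (.of k))} (f : X ⟶ Y) [Smooth f.left]
    (x : algOver k K ⟶ X) (y : algOver k (TrivSqZeroExt K K) ⟶ Y)
    (h : dualZeroOver k K ≫ y = x ≫ f) : ∃ z, dualZeroOver k K ≫ z = x ∧ z ≫ f = y := by
  obtain ⟨z, hz, hzf⟩ := exists_tangent_lift_of_smooth f.left K x.left y.left congr(($h).left)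
  exact ⟨Over.homMk z (by rw [← Over.w f, reassoc_of% hzf, Over.w]),
    Over.OverMorphism.ext hz, Over.OverMorphism.ext hzf⟩

theorem smooth_of_exists_over_tangent_lift {X Y Z : Over (Spec (.of k))} (f : X ⟶ Y) (p : Y ⟶ Z)
    [LocallyOfFinitePresentation f.left] [Smooth (f ≫ p).left] [LocallyOfFiniteType p.left]
    (h : ∀ (K : Type u) [Field K] [Algebra k K] (x : algOver k K ⟶ X)
      (y : algOver k (TrivSqZeroExt K K) ⟶ Y), dualZeroOver k K ≫ y = x ≫ f →
      y ≫ p = dualProjOver k K ≫ x ≫ f ≫ p → ∃ z, dualZeroOver k K ≫ z = x ∧ z ≫ f = y) :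
    Smooth f.left := by
  have : Smooth (f.left ≫ p.left) := ‹Smooth (f ≫ p).left›
  refine smooth_of_exists_tangent_lift f.left p.left fun K _ x y hxy hy => ?_
  obtain ⟨φ, hφ⟩ := Spec.map_surjective (x ≫ X.hom)
  let : Algebra k K := φ.hom.toAlgebra
  let x' : algOver k K ⟶ X := Over.homMk x hφ.symm
  have hdual : (dualProjOver k K).left = dualProj K := rfl
  let y' : algOver k (TrivSqZeroExt K K) ⟶ Y := Over.homMk y (by
    rw [← Over.w p, reassoc_of% hy, Over.w, Over.w, ← hφ, ← hdual]
    exact Over.w (dualProjOver k K))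
  obtain ⟨z, hz, hzf⟩ := h K x' y' (Over.OverMorphism.ext hxy) (Over.OverMorphism.ext hy)
  exact ⟨z.left, congr(($hz).left), congr(($hzf).left)⟩

variable {G H M : Over (Spec (.of k))} [GrpObj G] [GrpObj H]

/-- The constant first-order deformation `G_{K[ε]} ⟶ H_{K[ε]}` of a homomorphism `G_K ⟶ H_K`. -/
abbrev HomPoints.constDeformation (f : HomPoints G H (algOver k K)) :
    HomPoints G H (algOver k (TrivSqZeroExt K K)) :=
  f.pullback (dualProjOver k K)

theorem HomPoints.constDeformation_pullback_dualZeroOver (f : HomPoints G H (algOver k K)) :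
    f.constDeformation.pullback (dualZeroOver k K) = f := by
  rw [pullback_pullback, dualZeroOver_dualProjOver, pullback_id]

/-- The homomorphism `f : G_K ⟶ H_K` is infinitesimally rigid if all its first-order deformations
`f' : G_{K[ε]} ⟶ H_{K[ε]}` are conjugate to the constant deformation, by points of `H(K[ε])` that
reduce to `1`, i.e. by elements of `Lie(H_K)`. -/
def IsInfinitesimallyRigid (f : HomPoints G H (algOver k K)) : Prop :=
  ∀ f' : HomPoints G H (algOver k (TrivSqZeroExt K K)), f'.pullback (dualZeroOver k K) = f →
    ∃ x : algOver k (TrivSqZeroExt K K) ⟶ H, dualZeroOver k K ≫ x = 1 ∧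
      f.constDeformation.conj x = f'

/-- Conjugating the first component of `y`, a deformation of `h m h⁻¹`, back by the constant
extension of `h` turns it into a deformation of `m`. -/
theorem exists_tangent_lift_conjGraph (α : (homGp G H).RepresentableBy M)
    (hα : ∀ m : algOver k K ⟶ M, IsInfinitesimallyRigid (pointEquiv α m))
    (x : algOver k K ⟶ H ⊗ M) (y : algOver k (TrivSqZeroExt K K) ⟶ M ⊗ M)
    (hxy : dualZeroOver k K ≫ y = x ≫ conjGraph α)
    (hy : y ≫ snd M M = dualProjOver k K ≫ x ≫ snd H M) :
    ∃ z, dualZeroOver k K ≫ z = x ∧ z ≫ conjGraph α = y := by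
  obtain ⟨h, m, rfl⟩ : ∃ h m, x = lift h m := ⟨x ≫ fst _ _, x ≫ snd _ _, by simp⟩
  rw [conjGraph_eq_orbitGraph, lift_orbitGraph, Category.comp_id] at hxy
  rw [lift_snd] at hy
  have hy_fst : (pointEquiv α (y ≫ fst M M)).pullback (dualZeroOver k K) =
      (pointEquiv α m).conj h := by
    rw [← pointEquiv_comp, reassoc_of% hxy, lift_fst, Equiv.apply_symm_apply]
  let h' := dualProjOver k K ≫ h
  have hh' : dualZeroOver k K ≫ h' = h := dualZeroOver_dualProjOver_assoc h
  obtain ⟨t, ht, htm⟩ := hα m ((pointEquiv α (y ≫ fst M M)).conj h'⁻¹) (by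
    rw [HomPoints.pullback_conj, hy_fst, HomPoints.conj_conj, GrpObj.comp_inv, hh',
      inv_mul_cancel, HomPoints.conj_one])
  refine ⟨lift (h' * t) (dualProjOver k K ≫ m), ?_, ?_⟩
  · rw [comp_lift, comp_mul, ht, hh', _root_.mul_one, dualZeroOver_dualProjOver_assoc]
  · rw [conjGraph_eq_orbitGraph, lift_orbitGraph, Category.comp_id, ← HomPoints.conj_conj,
      pointEquiv_comp, htm, HomPoints.conj_conj, mul_inv_cancel, HomPoints.conj_one,
      Equiv.symm_apply_apply, ← hy]
    simp

theorem smooth_conjGraph_of_isInfinitesimallyRigid [Smooth H.hom] [LocallyOfFiniteType M.hom]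
    (α : (homGp G H).RepresentableBy M)
    (hα : ∀ (K : Type u) [Field K] [Algebra k K] (m : algOver k K ⟶ M),
      IsInfinitesimallyRigid (pointEquiv α m)) :
    Smooth (conjGraph α).left := by
  have hsnd : conjGraph α ≫ snd M M = snd H M := lift_snd _ _
  have hM : LocallyOfFiniteType (snd M M).left :=
    inferInstanceAs (LocallyOfFiniteType (pullback.snd M.hom M.hom))
  have hH : Smooth (conjGraph α ≫ snd M M).left := by
    rw [hsnd]
    exact inferInstanceAs (Smooth (pullback.snd H.hom M.hom))
  have hMM : LocallyOfFiniteType (M ⊗ M).hom := by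
    rw [← Over.w (snd M M)]
    infer_instance
  have : IsLocallyNoetherian (M ⊗ M).left := LocallyOfFiniteType.isLocallyNoetherian (M ⊗ M).hom
  have : Smooth ((conjGraph α).left ≫ (snd M M).left) := hH
  have : LocallyOfFinitePresentation (conjGraph α).left :=
    LocallyOfFinitePresentation.iff_locallyOfFiniteType.mpr
      (locallyOfFiniteType_of_comp _ (snd M M).left)
  refine smooth_of_exists_over_tangent_lift (conjGraph α) (snd M M) fun K _ _ x y hxy hy => ?_
  rw [hsnd] at hy
  exact exists_tangent_lift_conjGraph α (hα K) x y hxy hy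

theorem isInfinitesimallyRigid_of_smooth_orbitMap (α : (homGp G H).RepresentableBy M)
    (m : algOver k K ⟶ M) [Smooth (orbitMap α m).left] :
    IsInfinitesimallyRigid (pointEquiv α m) := by
  intro f' hf'
  have : Smooth (orbitGraph α m).left := ‹Smooth (orbitMap α m).left›
  have hm : dualZeroOver k K ≫ (pointEquiv α).symm f' = m := by
    apply (pointEquiv α).injective
    rw [pointEquiv_comp, Equiv.apply_symm_apply, hf']
  obtain ⟨z, hz, hzm⟩ := exists_over_tangent_lift_of_smooth (orbitGraph α m) (lift 1 (𝟙 _))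
    (lift ((pointEquiv α).symm f') (dualProjOver k K)) (by
      rw [lift_orbitGraph, HomPoints.conj_one, Category.id_comp, Equiv.symm_apply_apply, comp_lift,
        hm, dualZeroOver_dualProjOver])
  obtain ⟨t, s, rfl⟩ : ∃ t s, z = lift t s := ⟨z ≫ fst _ _, z ≫ snd _ _, by simp⟩
  rw [lift_orbitGraph] at hzm
  obtain rfl : s = dualProjOver k K := by simpa using congr($hzm ≫ snd _ _)
  have ht : (pointEquiv α).symm ((pointEquiv α (dualProjOver k K ≫ m)).conj t) =
      (pointEquiv α).symm f' := by
    simpa using congr($hzm ≫ fst _ _)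
  refine ⟨t, by simpa using congr($hz ≫ fst _ _), ?_⟩
  rw [HomPoints.constDeformation, ← pointEquiv_comp]
  exact (pointEquiv α).symm.injective ht

end Rigidity

section Transport
variable {k : Type u} [Field k] {K : Type u} [Field K] [Algebra k K]

variable (k) in
/-- A `K`-scheme, viewed as a `k`-scheme. -/
abbrev restrictBase (T : Over (Spec (.of K))) : Over (Spec (.of k)) :=
  (Over.map (Spec.map (CommRingCat.ofHom (algebraMap k K)))).obj T

variable (k) in
/-- A morphism of `K`-schemes, viewed as a morphism of `k`-schemes. -/
abbrev restrictBaseMap {T T' : Over (Spec (.of K))} (u : T ⟶ T') :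
    restrictBase k T ⟶ restrictBase k T' :=
  (Over.map (Spec.map (CommRingCat.ofHom (algebraMap k K)))).map u

variable (K) in
/-- The morphism `u_K : X_K ⟶ Y_K`. -/
abbrev baseChangeMap {X Y : Over (Spec (.of k))} (u : X ⟶ Y) : baseChange K X ⟶ baseChange K Y :=
  (Over.pullback (Spec.map (CommRingCat.ofHom (algebraMap k K)))).map u

variable {H X Y : Over (Spec (.of k))} [GrpObj H] {T T' : Over (Spec (.of K))}

/-- `Hom_K(T, H_K) = Hom_k(T, H)`, as groups. -/
def descend : (T ⟶ baseChange K H) ≃* (restrictBase k T ⟶ H) where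
  __ := ((Over.mapPullbackAdj (Spec.map (CommRingCat.ofHom (algebraMap k K)))).homEquiv T H).symm
  map_mul' u v := by
    let F := Over.pullback (Spec.map (CommRingCat.ofHom (algebraMap k K)))
    let e {Y : Over (Spec (.of k))} :=
      ((Over.mapPullbackAdj (Spec.map (CommRingCat.ofHom (algebraMap k K)))).homEquiv T Y).symm
    have he {Y Z : Over (Spec (.of k))} (a : T ⟶ F.obj Y) (g : Y ⟶ Z) :
        e (a ≫ F.map g) = e a ≫ g :=
      (Over.mapPullbackAdj _).homEquiv_naturality_right_symm a g
    change e (u * v) = e u * e v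
    rw [Hom.mul_def, Functor.obj.μ_def, ← Category.assoc, he, Hom.mul_def]
    congr 1
    apply CartesianMonoidalCategory.hom_ext
    · rw [← he, Category.assoc, Functor.Monoidal.μ_fst, lift_fst, lift_fst]
    · rw [← he, Category.assoc, Functor.Monoidal.μ_snd, lift_snd, lift_snd]

theorem descend_left (u : T ⟶ baseChange K H) :
    (descend u).left = u.left ≫ pullback.fst H.hom (algOver k K).hom := by
  change (((Over.mapPullbackAdj (Spec.map (CommRingCat.ofHom (algebraMap k K)))).homEquiv
    T H).symm u).left = _
  rw [Adjunction.homEquiv_counit]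
  simp

theorem descend_comp (a : T' ⟶ T) (u : T ⟶ baseChange K H) :
    descend (a ≫ u) = restrictBaseMap k a ≫ descend u := by
  ext1
  simp [descend_left]

/-- The group isomorphism `Hom_k(X, H) ≃ Hom_K(T, H_K)` given by an identification of the
`K`-scheme `T` with `X` as `k`-schemes. -/
def transport (θ : restrictBase k T ≅ X) : (X ⟶ H) ≃* (T ⟶ baseChange K H) :=
  MulEquiv.trans { θ.symm.homFromEquiv with map_mul' := fun _ _ => comp_mul _ _ _ } descend.symm

theorem descend_transport (θ : restrictBase k T ≅ X) (a : X ⟶ H) :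
    descend (transport θ a) = θ.hom ≫ a :=
  descend.apply_symm_apply _

theorem comp_transport (θ : restrictBase k T ≅ X) (θ' : restrictBase k T' ≅ Y) (u : T' ⟶ T)
    (v : Y ⟶ X) (h : restrictBaseMap k u ≫ θ.hom = θ'.hom ≫ v) (a : X ⟶ H) :
    u ≫ transport θ a = transport θ' (v ≫ a) := by
  apply descend.injective
  rw [descend_comp, descend_transport, descend_transport, reassoc_of% h]

variable (k) in
/-- `Spec A`, as a scheme over `K` and over `k`. -/
def algOverIso (A : Type u) [CommRing A] [Algebra K A] [Algebra k A] [IsScalarTower k K A] :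
    restrictBase k (algOver K A) ≅ algOver k A :=
  Over.isoMk (Iso.refl _) (by
    simp only [Over.mk_left, Over.mk_hom, Over.map_obj_hom, Iso.refl_hom]
    rw [← Spec.map_comp, ← CommRingCat.ofHom_comp, ← IsScalarTower.algebraMap_eq]
    exact Category.id_comp _)

variable (K) in
/-- `X_K` is `X × Spec K` as a `k`-scheme. -/
def baseChangeIso (X : Over (Spec (.of k))) :
    restrictBase k (baseChange K X) ≅ X ⊗ algOver k K :=
  Over.isoMk (Iso.refl _) ((Category.id_comp _).trans pullback.condition)

theorem transport_baseChangeIso (a : X ⊗ algOver k K ⟶ H) :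
    transport (baseChangeIso K X) a = toBaseChange a := by
  apply descend.injective
  rw [descend_transport]
  ext1
  rw [descend_left, toBaseChange_left_fst]
  exact Category.id_comp _

theorem isPullback_left_fst_snd {S : Scheme.{u}} (Y Z : Over S) :
    IsPullback (fst Y Z).left (snd Y Z).left Y.hom Z.hom :=
  IsPullback.of_hasPullback Y.hom Z.hom

section Product
variable (X) (A : Type u) [CommRing A] [Algebra K A] [Algebra k A] [IsScalarTower k K A]

/-- The morphism `X_K × Spec A ⟶ X × Spec A` of `k`-schemes. -/
def baseChangeProdHom :
    restrictBase k (baseChange K X ⊗ algOver K A) ⟶ X ⊗ algOver k A :=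
  lift (restrictBaseMap k (fst _ _) ≫ (baseChangeIso K X).hom ≫ fst _ _)
    (restrictBaseMap k (snd _ _) ≫ (algOverIso k A).hom)

instance : IsIso (baseChangeProdHom X A (K := K)) := by
  have hA : (algOver K A).hom ≫ (algOver k K).hom = (algOver k A).hom :=
    (Over.w (algOverIso k (K := K) A).hom).symm.trans (Category.id_comp _)
  have hpaste := (isPullback_left_fst_snd (baseChange K X) (algOver K A)).paste_horiz
    (isPullback_left_fst_snd X (algOver k K))
  rw [hA] at hpaste
  have hX := isPullback_left_fst_snd X (algOver k A)
  have hleft : (baseChangeProdHom X A (K := K)).left = (hpaste.isoIsPullback _ _ hX).hom := by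
    apply hX.hom_ext
    · rw [IsPullback.isoIsPullback_hom_fst, ← Over.comp_left, baseChangeProdHom, lift_fst]
      exact congr(_ ≫ $(Category.id_comp _))
    · rw [← Over.comp_left, baseChangeProdHom, lift_snd]
      exact (Category.comp_id _).trans (IsPullback.isoIsPullback_hom_snd _ _ hpaste hX).symm
  have : IsIso ((Over.forget _).map (baseChangeProdHom X A (K := K))) := by
    change IsIso (baseChangeProdHom X A (K := K)).left
    rw [hleft]
    infer_instance
  exact isIso_of_reflects_iso _ (Over.forget _)

/-- `X_K × Spec A` is `X × Spec A` as a `k`-scheme. -/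
def baseChangeProdIso :
    restrictBase k (baseChange K X ⊗ algOver K A) ≅ X ⊗ algOver k A :=
  asIso (baseChangeProdHom X A)

theorem baseChangeProdIso_hom_fst : (baseChangeProdIso X A (K := K)).hom ≫ fst _ _ =
    restrictBaseMap k (fst _ _) ≫ (baseChangeIso K X).hom ≫ fst _ _ :=
  lift_fst _ _

theorem baseChangeProdIso_hom_snd : (baseChangeProdIso X A (K := K)).hom ≫ snd _ _ =
    restrictBaseMap k (snd _ _) ≫ (algOverIso k A).hom :=
  lift_snd _ _

variable {X}

theorem whiskerRight_transport (u : Y ⟶ X) (a : X ⊗ algOver k A ⟶ H) :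
    baseChangeMap K u ▷ algOver K A ≫ transport (baseChangeProdIso X A) a =
      transport (baseChangeProdIso Y A) (u ▷ _ ≫ a) := by
  apply comp_transport
  apply CartesianMonoidalCategory.hom_ext
  · rw [Category.assoc, baseChangeProdIso_hom_fst, Category.assoc, whiskerRight_fst,
      ← Category.assoc, ← Category.assoc, ← Category.assoc, baseChangeProdIso_hom_fst,
      ← Functor.map_comp, whiskerRight_fst, Functor.map_comp]
    simp only [Category.assoc]
    congr 1
    ext1
    exact pullback.lift_fst _ _ _
  · rw [Category.assoc, baseChangeProdIso_hom_snd, Category.assoc, whiskerRight_snd,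
      baseChangeProdIso_hom_snd, ← Category.assoc, ← Functor.map_comp, whiskerRight_snd]

variable {A} {B : Type u} [CommRing B] [Algebra K B] [Algebra k B] [IsScalarTower k K B]

theorem algOverMap_transport (φ : A →ₐ[K] B) (a : algOver k A ⟶ H) :
    algOverMap φ ≫ transport (algOverIso k A) a =
      transport (algOverIso k B) (algOverMap (φ.restrictScalars k) ≫ a) := by
  apply comp_transport
  ext1
  exact (Category.comp_id _).trans (Category.id_comp _).symm

theorem whiskerLeft_algOverMap_transport (φ : A →ₐ[K] B) (a : X ⊗ algOver k A ⟶ H) :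
    baseChange K X ◁ algOverMap φ ≫ transport (baseChangeProdIso X A) a =
      transport (baseChangeProdIso X B) (X ◁ algOverMap (φ.restrictScalars k) ≫ a) := by
  apply comp_transport
  apply CartesianMonoidalCategory.hom_ext
  · rw [Category.assoc, baseChangeProdIso_hom_fst, Category.assoc, whiskerLeft_fst,
      ← Category.assoc, ← Functor.map_comp, baseChangeProdIso_hom_fst, whiskerLeft_fst]
  · rw [Category.assoc, baseChangeProdIso_hom_snd, Category.assoc, whiskerLeft_snd,
      ← Category.assoc, ← Category.assoc, ← Functor.map_comp, baseChangeProdIso_hom_snd,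
      whiskerLeft_snd, Functor.map_comp, Category.assoc, Category.assoc]
    congr 1

theorem snd_transport (a : algOver k A ⟶ H) :
    snd (baseChange K X) (algOver K A) ≫ transport (algOverIso k A) a =
      transport (baseChangeProdIso X A) (snd _ _ ≫ a) :=
  comp_transport _ _ _ _ (baseChangeProdIso_hom_snd X A).symm a

theorem fst_toBaseChange (a : X ⊗ algOver k K ⟶ H) :
    fst (baseChange K X) (algOver K A) ≫ toBaseChange a =
      transport (baseChangeProdIso X A)
        (X ◁ algOverMap (IsScalarTower.toAlgHom k K A) ≫ a) := by
  rw [← transport_baseChangeIso]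
  apply comp_transport
  apply CartesianMonoidalCategory.hom_ext
  · rw [Category.assoc, Category.assoc, whiskerLeft_fst, baseChangeProdIso_hom_fst]
  · rw [Category.assoc, Category.assoc, whiskerLeft_snd, ← Category.assoc _ (snd _ _),
      baseChangeProdIso_hom_snd]
    ext1
    have h : (fst (baseChange K X) (algOver K A)).left ≫ (snd X (algOver k K)).left =
      (snd (baseChange K X) (algOver K A)).left ≫ (algOver K A).hom := pullback.condition
    refine (congr(_ ≫ $(Category.id_comp _))).trans (h.trans ?_)
    exact (congr($(Category.comp_id _) ≫ _)).symm

end Product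

end Transport

section Cocycles
variable {k : Type u} [Field k] {K : Type u} [Field K] [Algebra k K]

theorem HomPoints.fst_toHom {G H : Over (Spec (.of k))} [GrpObj G] [GrpObj H]
    (f : HomPoints G H (algOver k K)) :
    fst (baseChange K G) (SpecD K K) ≫ f.toHom =
      transport (baseChangeProdIso G (TrivSqZeroExt K K)) f.constDeformation.1 :=
  fst_toBaseChange (A := TrivSqZeroExt K K) f.1

namespace Lie

section
variable {H T T' T'' : Over (Spec (.of K))} [GrpObj H] [IsSeparated H.hom]

theorem pullback_id (x : Lie H T) : pullback (𝟙 T) x = x := by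
  ext1
  simp [val_pullback]

theorem pullback_injective (t : T' ⟶ T) [IsIso t] :
    Function.Injective (pullback (H := H) t) := by
  refine Function.LeftInverse.injective (g := pullback (inv t)) fun x => ?_
  rw [pullback_pullback, IsIso.inv_hom_id, pullback_id]

end

variable {H X : Over (Spec (.of k))} [GrpObj H]

/-- The morphism `X_K ⟶ Lie(H_K)` given by a morphism `a : X × Spec K[ε] ⟶ H` of `k`-schemes that
is trivial at `ε = 0`. -/
def ofDual (a : X ⊗ algOver k (TrivSqZeroExt K K) ⟶ H) (ha : X ◁ dualZeroOver k K ≫ a = 1) :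
    Lie (baseChange K H) (baseChange K X) :=
  mk (transport (baseChangeProdIso X (TrivSqZeroExt K K)) a) <| by
    rw [whiskerLeft_algOverMap_transport]
    exact EmbeddingLike.map_eq_one_iff.mpr ha

theorem exists_ofDual_eq (φ : Lie (baseChange K H) (baseChange K X)) :
    ∃ a ha, ofDual a ha = φ := by
  obtain ⟨a, ha⟩ := (transport (H := H) (baseChangeProdIso X (TrivSqZeroExt K K))).surjective φ.val
  have hφ := φ.zero_val
  rw [← ha, whiskerLeft_algOverMap_transport] at hφ
  exact ⟨a, EmbeddingLike.map_eq_one_iff.mp hφ, Lie.ext ha⟩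

theorem algOverMap_transport_eq_one_iff (b : algOver k (TrivSqZeroExt K K) ⟶ H) :
    algOverMap (TrivSqZeroExt.fstHom K K K) ≫ transport (algOverIso k (TrivSqZeroExt K K)) b = 1 ↔
      dualZeroOver k K ≫ b = 1 := by
  rw [algOverMap_transport]
  exact EmbeddingLike.map_eq_one_iff

/-- The element of `Lie(H_K)` given by a `k`-morphism `b : Spec K[ε] ⟶ H` that is trivial at
`ε = 0`. -/
def ofDualPoint (b : algOver k (TrivSqZeroExt K K) ⟶ H) (hb : dualZeroOver k K ≫ b = 1) :
    Lie (baseChange K H) (𝟙_ (Over (Spec (.of K)))) :=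
  mk (snd _ _ ≫ transport (algOverIso k (TrivSqZeroExt K K)) b) <| by
    rw [whiskerLeft_snd_assoc, (algOverMap_transport_eq_one_iff b).mpr hb, comp_one]

theorem exists_ofDualPoint_eq (y : Lie (baseChange K H) (𝟙_ (Over (Spec (.of K))))) :
    ∃ b hb, ofDualPoint b hb = y := by
  obtain ⟨b, hb⟩ := (transport (H := H) (algOverIso k (K := K) (TrivSqZeroExt K K))).surjective
    ((λ_ _).inv ≫ y.val)
  have hy : snd _ _ ≫ transport (algOverIso k (TrivSqZeroExt K K)) b = y.val := by
    rw [hb, ← leftUnitor_hom, Iso.hom_inv_id_assoc]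
  have hy0 := y.zero_val
  rw [← hy, whiskerLeft_snd_assoc, ← leftUnitor_hom] at hy0
  have hb0 := congr((λ_ _).inv ≫ $hy0)
  rw [Iso.inv_hom_id_assoc, comp_one] at hb0
  exact ⟨b, (algOverMap_transport_eq_one_iff b).mp hb0, Lie.ext hy⟩

end Lie

variable {G H : Over (Spec (.of k))} [GrpObj G] [GrpObj H] [IsSeparated H.hom]

/-- The cocycle condition, tested on `(G × G)_K` instead of `G_K × G_K`. -/
theorem mem_Z1_iff_baseChangeMap (f : baseChange K G ⟶ baseChange K H)
    (φ : Lie (baseChange K H) (baseChange K G)) :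
    φ ∈ Z1 f ↔ Lie.pullback (baseChangeMap K μ[G]) φ =
      Lie.pullback (baseChangeMap K (fst G G)) φ +
        Lie.Ad (baseChangeMap K (fst G G) ≫ f) (Lie.pullback (baseChangeMap K (snd G G)) φ) := by
  let F := Over.pullback (Spec.map (CommRingCat.ofHom (algebraMap k K)))
  have hfst : Functor.OplaxMonoidal.δ F G G ≫ fst _ _ = F.map (fst G G) :=
    Functor.OplaxMonoidal.δ_fst F G G
  have hsnd : Functor.OplaxMonoidal.δ F G G ≫ snd _ _ = F.map (snd G G) :=
    Functor.OplaxMonoidal.δ_snd F G G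
  have hmul : Functor.OplaxMonoidal.δ F G G ≫ μ[F.obj G] = F.map μ[G] := by
    rw [Functor.obj.μ_def, Functor.Monoidal.δ_μ_assoc]
  rw [mem_Z1, ← (Lie.pullback_injective (Functor.OplaxMonoidal.δ F G G)).eq_iff, map_add,
    Lie.pullback_Ad, Lie.pullback_pullback, Lie.pullback_pullback, Lie.pullback_pullback,
    hmul, ← Category.assoc, hfst, hsnd]

theorem ofDual_mem_Z1_iff (f : HomPoints G H (algOver k K))
    (a : G ⊗ algOver k (TrivSqZeroExt K K) ⟶ H) (ha : G ◁ dualZeroOver k K ≫ a = 1) :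
    Lie.ofDual a ha ∈ Z1 f.toHom ↔ μ[G] ▷ _ ≫ a = (fst G G ▷ _ ≫ a) *
      ((fst G G ▷ _ ≫ f.constDeformation.1) * (snd G G ▷ _ ≫ a) *
        (fst G G ▷ _ ≫ f.constDeformation.1)⁻¹) := by
  have hfst : fst (baseChange K (G ⊗ G)) (SpecD K K) ≫ baseChangeMap K (fst G G) ≫ f.toHom =
      transport (baseChangeProdIso (G ⊗ G) (TrivSqZeroExt K K))
        (fst G G ▷ _ ≫ f.constDeformation.1) := by
    rw [← whiskerRight_transport, ← f.fst_toHom, whiskerRight_fst_assoc]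
  rw [mem_Z1_iff_baseChangeMap, ← (transport (H := H)
    (baseChangeProdIso (K := K) (G ⊗ G) (TrivSqZeroExt K K))).injective.eq_iff, map_mul, map_mul,
    map_mul, map_inv, ← hfst, ← whiskerRight_transport, ← whiskerRight_transport,
    ← whiskerRight_transport]
  exact ⟨fun h => congr(($h).val), fun h => Lie.ext h⟩

theorem ofDual_mem_Z1_iff_mul_constDeformation (f : HomPoints G H (algOver k K))
    (a : G ⊗ algOver k (TrivSqZeroExt K K) ⟶ H) (ha : G ◁ dualZeroOver k K ≫ a = 1) :
    Lie.ofDual a ha ∈ Z1 f.toHom ↔ μ[G] ▷ _ ≫ (a * f.constDeformation.1) =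
      (fst G G ▷ _ ≫ (a * f.constDeformation.1)) * (snd G G ▷ _ ≫ (a * f.constDeformation.1)) := by
  rw [ofDual_mem_Z1_iff, comp_mul, comp_mul, comp_mul, f.constDeformation.2]
  constructor
  · intro h
    rw [h]
    group
  · intro h
    rw [← mul_left_inj, h]
    group

theorem d0_ofDualPoint_eq_ofDual_iff (f : HomPoints G H (algOver k K))
    (b : algOver k (TrivSqZeroExt K K) ⟶ H) (hb : dualZeroOver k K ≫ b = 1)
    (a : G ⊗ algOver k (TrivSqZeroExt K K) ⟶ H) (ha : G ◁ dualZeroOver k K ≫ a = 1) :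
    d0 f.toHom (Lie.ofDualPoint b hb) = Lie.ofDual a ha ↔
      (f.constDeformation.conj b⁻¹).1 = a * f.constDeformation.1 := by
  let e := transport (H := H) (baseChangeProdIso (K := K) G (TrivSqZeroExt K K))
  let y := Lie.pullback (toUnit (baseChange K G)) (Lie.ofDualPoint b hb)
  have hy : y.val = e (snd _ _ ≫ b) := by
    rw [Lie.val_pullback]
    refine (whiskerRight_snd_assoc _ _ _).trans ?_
    exact snd_transport b
  have hd0 : (d0 f.toHom (Lie.ofDualPoint b hb)).val =
      e ((snd _ _ ≫ b)⁻¹ * (f.constDeformation.1 * (snd _ _ ≫ b) * f.constDeformation.1⁻¹)) := by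
    rw [d0_apply, sub_eq_neg_add, Lie.val_add, Lie.val_Ad, f.fst_toHom]
    change y.val⁻¹ * (_ * y.val * _) = _
    rw [hy, map_mul, map_mul, map_mul, map_inv, map_inv]
  have hconj : (f.constDeformation.conj b⁻¹).1 =
      (snd _ _ ≫ b)⁻¹ * f.constDeformation.1 * (snd _ _ ≫ b) := by
    simp only [HomPoints.conj, GrpObj.comp_inv, inv_inv]
  rw [hconj, ← mul_inv_eq_iff_eq_mul, _root_.mul_assoc, _root_.mul_assoc,
    ← _root_.mul_assoc _ _ _⁻¹]
  exact ⟨fun h => e.injective (hd0.symm.trans congr(($h).val)),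
    fun h => Lie.ext (hd0.trans congr(e $h))⟩

theorem subsingleton_H1_iff_Z1_le_B1 {G H : Over (Spec (.of K))} [GrpObj G] [GrpObj H]
    [IsSeparated H.hom] (f : G ⟶ H) [IsMonHom f] : Subsingleton (H1 f) ↔ Z1 f ≤ B1 f := by
  rw [Submodule.Quotient.subsingleton_iff, Submodule.submoduleOf_eq_top]

/-- The deformations of `f` are the products `a f` of `f` with a cocycle `a`. Such a deformation is
conjugate to `f` exactly when `a` is a coboundary. -/
theorem subsingleton_H1_iff_isInfinitesimallyRigid (f : HomPoints G H (algOver k K)) :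
    Subsingleton (H1 f.toHom) ↔ IsInfinitesimallyRigid f := by
  have hf : G ◁ dualZeroOver k K ≫ f.constDeformation.1 = f.1 :=
    congr(($f.constDeformation_pullback_dualZeroOver).1)
  rw [subsingleton_H1_iff_Z1_le_B1]
  constructor
  · intro h f' hf'
    have ha : G ◁ dualZeroOver k K ≫ (f'.1 * f.constDeformation.1⁻¹) = 1 := by
      have hf'0 : G ◁ dualZeroOver k K ≫ f'.1 = f.1 := congr(($hf').1)
      rw [comp_mul, GrpObj.comp_inv, hf, hf'0, mul_inv_cancel]
    have hZ : Lie.ofDual _ ha ∈ Z1 f.toHom := by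
      rw [ofDual_mem_Z1_iff_mul_constDeformation, inv_mul_cancel_right]
      exact f'.2
    obtain ⟨y, hy⟩ := h hZ
    obtain ⟨b, hb, rfl⟩ := y.exists_ofDualPoint_eq
    rw [d0_ofDualPoint_eq_ofDual_iff, inv_mul_cancel_right] at hy
    exact ⟨b⁻¹, by rw [GrpObj.comp_inv, hb, inv_one], Subtype.ext hy⟩
  · intro h φ hφ
    obtain ⟨a, ha, rfl⟩ := φ.exists_ofDual_eq
    obtain ⟨x, hx, hxa⟩ := h ⟨_, (ofDual_mem_Z1_iff_mul_constDeformation f a ha).mp hφ⟩ <| by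
      refine Subtype.ext ?_
      change G ◁ dualZeroOver k K ≫ (a * f.constDeformation.1) = f.1
      rw [comp_mul, ha, _root_.one_mul, hf]
    refine ⟨Lie.ofDualPoint x⁻¹ (by rw [GrpObj.comp_inv, hx, inv_one]), ?_⟩
    rw [d0_ofDualPoint_eq_ofDual_iff, inv_inv]
    exact congr(($hxa).1)

end Cocycles

section CoordRing

open TensorProduct

variable {K : Type u} [Field K] {X Y Z : Over (Spec (.of K))}

theorem comorphism_id : comorphism (𝟙 X) = AlgHom.id K _ := by
  simp [comorphism]

theorem comorphism_comp (f : X ⟶ Y) (g : Y ⟶ Z) :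
    comorphism (f ≫ g) = (comorphism f).comp (comorphism g) := by
  simp [comorphism]

theorem comorphism_comp_apply (f : X ⟶ Y) (g : Y ⟶ Z) (a : coordRing Z) :
    comorphism (f ≫ g) a = comorphism f (comorphism g a) := by
  rw [comorphism_comp]
  rfl

variable {R S : Type u} [CommRing R] [Algebra K R] [CommRing S] [Algebra K S]

/-- Morphisms from `X` to the affine scheme `Spec R` are homomorphisms `R → 𝒪(X)`. -/
def specEquiv : (X ⟶ algOver K R) ≃ (R →ₐ[K] coordRing X) :=
  ((algΓAlgSpecAdjunction (.of K)).homEquiv X (op (CommAlgCat.of K R))).symm.trans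
    { toFun a := a.unop.hom
      invFun a := (CommAlgCat.ofHom a).op
      left_inv _ := rfl
      right_inv _ := rfl }

theorem specEquiv_comp (f : Y ⟶ X) (g : X ⟶ algOver K R) :
    specEquiv (f ≫ g) = (comorphism f).comp (specEquiv g) :=
  congr(($((algΓAlgSpecAdjunction (.of K)).homEquiv_naturality_left_symm
    (Y := op (CommAlgCat.of K R)) f g)).unop.hom)

theorem specEquiv_algOverMap (g : X ⟶ algOver K R) (φ : S →ₐ[K] R) :
    specEquiv (g ≫ algOverMap φ) = (specEquiv g).comp φ :=
  congr(($((algΓAlgSpecAdjunction (.of K)).homEquiv_naturality_right_symm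
    (Y := op (CommAlgCat.of K R)) g (CommAlgCat.ofHom φ).op)).unop.hom)

variable (K R) in
/-- The canonical map from `R` to the functions on `Spec R`. -/
def specFun : R →ₐ[K] coordRing (algOver K R) := specEquiv (𝟙 _)

theorem specEquiv_eq_comp_specFun (g : X ⟶ algOver K R) :
    specEquiv g = (comorphism g).comp (specFun K R) := by
  rw [specFun, ← specEquiv_comp, Category.comp_id]

theorem comorphism_algOverMap (φ : S →ₐ[K] R) (a : S) :
    comorphism (algOverMap φ) (specFun K S a) = specFun K R (φ a) := by
  have h : (comorphism (algOverMap φ)).comp (specFun K S) = (specFun K R).comp φ := by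
    rw [← specEquiv_eq_comp_specFun, ← Category.id_comp (algOverMap φ), specEquiv_algOverMap,
      specFun]
  exact congr($h a)

theorem bijective_specFun : Function.Bijective (specFun K R) := by
  have : (algSpec (.of K)).Full := algSpec.fullyFaithful.full
  have : (algSpec (.of K)).Faithful := algSpec.fullyFaithful.faithful
  have : IsIso (algΓAlgSpecAdjunction (.of K)).counit :=
    (algΓAlgSpecAdjunction (.of K)).counit_isIso_of_R_fully_faithful
  have h : specFun K R = ((algΓAlgSpecAdjunction (.of K)).counit.app
      (op (CommAlgCat.of K R))).unop.hom := by
    rw [← Adjunction.homEquiv_symm_id]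
    rfl
  rw [h]
  exact ConcreteCategory.bijective_of_isIso
    ((algΓAlgSpecAdjunction (.of K)).counit.app (op (CommAlgCat.of K R))).unop

theorem isQcqs_tensor (hX : IsQcqs K X) (hY : IsQcqs K Y) : IsQcqs K (X ⊗ Y) := by
  obtain ⟨_, _⟩ := hX
  obtain ⟨_, _⟩ := hY
  rw [IsQcqs, Over.tensorObj_hom]
  exact ⟨inferInstance, inferInstance⟩

theorem isQcqs_algOver : IsQcqs K (algOver K R) :=
  ⟨inferInstanceAs (QuasiCompact (Spec.map (CommRingCat.ofHom (algebraMap K R)))),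
    inferInstanceAs (QuasiSeparated (Spec.map (CommRingCat.ofHom (algebraMap K R))))⟩

variable (X Y) in
/-- The Künneth map `𝒪(X) ⊗ 𝒪(Y) → 𝒪(X × Y)`. -/
abbrev kunneth : coordRing X ⊗[K] coordRing Y →ₐ[K] coordRing (X ⊗ Y) :=
  Algebra.TensorProduct.productMap (comorphism (fst X Y)) (comorphism (snd X Y))

theorem bijective_kunneth (hX : IsQcqs K X) (hY : IsQcqs K Y) :
    Function.Bijective (kunneth X Y) := by
  have h : IsPullback (Spec.map (CommRingCat.ofHom (comorphism (fst X Y)).toRingHom))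
      (Spec.map (CommRingCat.ofHom (comorphism (snd X Y)).toRingHom))
      (Spec.map (CommRingCat.ofHom (algebraMap K (coordRing X))))
      (Spec.map (CommRingCat.ofHom (algebraMap K (coordRing Y)))) :=
    affinization_isPullback K X Y hX hY
  have h' := isPullback_SpecMap_of_isPushout _ _ _ _
    (CommRingCat.isPushout_tensorProduct K (coordRing X) (coordRing Y))
  have e : Spec.map (CommRingCat.ofHom (kunneth X Y).toRingHom) =
      (h.isoIsPullback _ _ h').hom := by
    apply h'.hom_ext
    · rw [IsPullback.isoIsPullback_hom_fst, ← Spec.map_comp]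
      congr 1
      ext a
      simp [kunneth]
    · rw [IsPullback.isoIsPullback_hom_snd, ← Spec.map_comp]
      congr 1
      ext a
      simp [kunneth]
  have : IsIso (Spec.map (CommRingCat.ofHom (kunneth X Y).toRingHom)) := by
    rw [e]
    infer_instance
  exact isIso_SpecMap_iff.mp this

variable (X R) in
/-- The map `𝒪(X) ⊗ R → 𝒪(X × Spec R)`. -/
def kunnethSpec : coordRing X ⊗[K] R →ₐ[K] coordRing (X ⊗ algOver K R) :=
  Algebra.TensorProduct.productMap (comorphism (fst X (algOver K R)))
    ((comorphism (snd X (algOver K R))).comp (specFun K R))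

theorem kunnethSpec_tmul (a : coordRing X) (r : R) : kunnethSpec X R (a ⊗ₜ r) =
    comorphism (fst X (algOver K R)) a * comorphism (snd X (algOver K R)) (specFun K R r) := by
  simp [kunnethSpec]

theorem bijective_kunnethSpec (hX : IsQcqs K X) : Function.Bijective (kunnethSpec X R) := by
  have h : kunnethSpec X R = (kunneth X (algOver K R)).comp
      (Algebra.TensorProduct.congr AlgEquiv.refl
        (AlgEquiv.ofBijective (specFun K R) bijective_specFun)).toAlgHom := by
    ext a <;> simp [kunnethSpec, kunneth]
  rw [h]
  exact (bijective_kunneth hX isQcqs_algOver).comp (AlgEquiv.bijective _)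

end CoordRing

section Extension

open TensorProduct

variable {k : Type u} [Field k] {X Y A : Over (Spec (.of k))}
  {V W : Type u} [AddCommGroup V] [Module k V] [AddCommGroup W] [Module k W]

variable (X Y V) in
/-- The map `(V ⊗ 𝒪(X)) ⊗ 𝒪(Y) → V ⊗ 𝒪(X × Y)`. -/
def lTensorKunneth : (V ⊗[k] coordRing X) ⊗[k] coordRing Y →ₗ[k] V ⊗[k] coordRing (X ⊗ Y) :=
  (kunneth X Y).toLinearMap.lTensor V ∘ₗ
    (TensorProduct.assoc k V (coordRing X) (coordRing Y)).toLinearMap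

theorem lTensorKunneth_tmul (y : V ⊗[k] coordRing X) (b : coordRing Y) :
    lTensorKunneth X Y V (y ⊗ₜ b) = (LinearMap.mulLeft k (comorphism (snd X Y) b)).lTensor V
      ((comorphism (fst X Y)).toLinearMap.lTensor V y) := by
  induction y with
  | zero => simp
  | add x y hx hy => rw [TensorProduct.add_tmul, map_add, map_add, map_add, hx, hy]
  | tmul v a => simp [lTensorKunneth, mul_comm]

theorem lTensorKunneth_tmul_one (y : V ⊗[k] coordRing X) :
    lTensorKunneth X Y V (y ⊗ₜ 1) = (comorphism (fst X Y)).toLinearMap.lTensor V y := by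
  rw [lTensorKunneth_tmul, map_one, LinearMap.mulLeft_one, LinearMap.lTensor_id, LinearMap.id_apply]

theorem lTensorKunneth_rTensor (l : V →ₗ[k] W) (y : (V ⊗[k] coordRing X) ⊗[k] coordRing Y) :
    lTensorKunneth X Y W ((l.rTensor _).rTensor _ y) = l.rTensor _ (lTensorKunneth X Y V y) := by
  have h : lTensorKunneth X Y W ∘ₗ (l.rTensor _).rTensor _ =
      l.rTensor _ ∘ₗ lTensorKunneth X Y V := by
    ext v a b
    simp [lTensorKunneth]
  exact congr($h y)

theorem lTensor_rTensor_comm {B C : Type u} [AddCommGroup B] [Module k B] [AddCommGroup C]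
    [Module k C] (l : V →ₗ[k] W) (m : B →ₗ[k] C) (y : V ⊗[k] B) :
    m.lTensor W (l.rTensor B y) = l.rTensor C (m.lTensor V y) := by
  rw [← LinearMap.comp_apply, ← LinearMap.comp_apply, LinearMap.lTensor_comp_rTensor,
    LinearMap.rTensor_comp_lTensor]

/-- The coaction on the extension of the trivial module `k` by `V` given by a cocycle `z`: it
extends the coaction `ρ` of `V` and maps `(0, 1)` to `z + (0, 1) ⊗ 1`. -/
def extensionCoact (ρ : V →ₗ[k] V ⊗[k] coordRing A) (z : V ⊗[k] coordRing A) :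
    V × k →ₗ[k] (V × k) ⊗[k] coordRing A :=
  (LinearMap.inl k V k).rTensor (coordRing A) ∘ₗ
      LinearMap.coprod ρ (LinearMap.toSpanSingleton k _ z) +
    (TensorProduct.mk k (V × k) (coordRing A)).flip 1 ∘ₗ LinearMap.inr k V k ∘ₗ LinearMap.snd k V k

theorem extensionCoact_apply (ρ : V →ₗ[k] V ⊗[k] coordRing A) (z : V ⊗[k] coordRing A) (v : V)
    (c : k) : extensionCoact ρ z (v, c) =
      (LinearMap.inl k V k).rTensor _ (ρ v + c • z) + (0, c) ⊗ₜ 1 := by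
  simp [extensionCoact]

theorem extensionCoact_comp_inl (ρ : V →ₗ[k] V ⊗[k] coordRing A) (z : V ⊗[k] coordRing A) :
    extensionCoact ρ z ∘ₗ LinearMap.inl k V k = (LinearMap.inl k V k).rTensor _ ∘ₗ ρ := by
  ext v
  change extensionCoact ρ z (v, 0) = _
  rw [extensionCoact_apply, Prod.mk_zero_zero, TensorProduct.zero_tmul, zero_smul, add_zero,
    add_zero, LinearMap.comp_apply]

theorem lTensorKunneth_extensionCoact_inl (ρ : V →ₗ[k] V ⊗[k] coordRing A)
    (z : V ⊗[k] coordRing A) (y : V ⊗[k] coordRing Y) :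
    lTensorKunneth A Y (V × k)
        ((extensionCoact ρ z).rTensor _ ((LinearMap.inl k V k).rTensor _ y)) =
      (LinearMap.inl k V k).rTensor _ (lTensorKunneth A Y V (ρ.rTensor _ y)) := by
  rw [← lTensorKunneth_rTensor, ← LinearMap.rTensor_comp_apply, extensionCoact_comp_inl,
    LinearMap.rTensor_comp_apply]

theorem exists_neg_mem_of_isCompl_range_inl {W : Submodule k (V × k)}
    (hW : IsCompl (LinearMap.range (LinearMap.inl k V k)) W) : ∃ v : V, (-v, 1) ∈ W := by
  obtain ⟨_, ⟨v, rfl⟩, w, hw, hvw⟩ := Submodule.mem_sup.mp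
    (hW.sup_eq_top.ge (Submodule.mem_top (x := ((0 : V), (1 : k)))))
  have hw' : w = (-v, 1) := by
    rw [eq_sub_of_add_eq' hvw]
    simp
  exact ⟨v, hw' ▸ hw⟩

namespace Rep

variable [GrpObj A]

/-- `z ∈ V ⊗ 𝒪(A)` is a cocycle: as a function of `a ∈ A` with values in `V` it satisfies
`z(1) = 0` and `z(a b) = z(a) + a z(b)`. -/
structure IsCocycle (ρ : Rep A V) (z : V ⊗[k] coordRing A) : Prop where
  one : (comorphism η[A]).toLinearMap.lTensor V z = 0
  mul : (comorphism μ[A]).toLinearMap.lTensor V z =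
    (comorphism (fst A A)).toLinearMap.lTensor V z +
      lTensorKunneth A A V (ρ.coact.rTensor (coordRing A) z)

variable {ρ : Rep A V} {z : V ⊗[k] coordRing A}

/-- The extension of the trivial module `k` by `V` given by a cocycle `z`. -/
def IsCocycle.extension (hz : ρ.IsCocycle z) : Rep A (V × k) where
  coact := extensionCoact ρ.coact z
  coact_one := by
    rintro ⟨v, c⟩
    have e := ρ.coact_one v
    simp only [extensionCoact_apply, map_add, map_smul, lTensor_rTensor_comm, hz.one, e]
    simp [← TensorProduct.add_tmul]
  coact_mul := by
    rintro ⟨v, c⟩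
    change _ = lTensorKunneth A A (V × k) ((extensionCoact ρ.coact z).rTensor (coordRing A)
      (extensionCoact ρ.coact z (v, c)))
    have e : (comorphism μ[A]).toLinearMap.lTensor V (ρ.coact v) =
      lTensorKunneth A A V (ρ.coact.rTensor _ (ρ.coact v)) := ρ.coact_mul v
    rw [extensionCoact_apply]
    simp only [map_add, lTensorKunneth_extensionCoact_inl, LinearMap.rTensor_tmul,
      extensionCoact_apply, TensorProduct.add_tmul, lTensorKunneth_tmul_one, lTensor_rTensor_comm,
      e, map_smul, hz.mul, LinearMap.lTensor_tmul, AlgHom.toLinearMap_apply, map_one, map_zero,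
      zero_add, ← TensorProduct.smul_tmul']
    module

theorem IsCocycle.isStable_range_inl (hz : ρ.IsCocycle z) :
    hz.extension.IsStable (LinearMap.range (LinearMap.inl k V k)) := by
  rintro _ ⟨v, rfl⟩
  refine ⟨(LinearMap.inl k V k).rangeRestrict.rTensor _ (ρ.coact v), ?_⟩
  rw [← LinearMap.rTensor_comp_apply, LinearMap.rangeRestrict,
    LinearMap.subtype_comp_codRestrict]
  exact congr($(extensionCoact_comp_inl ρ.coact z) v).symm

theorem IsCocycle.eq_sub_of_isStable (hz : ρ.IsCocycle z) {W : Submodule k (V × k)}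
    (hst : hz.extension.IsStable W) (hW : IsCompl (LinearMap.range (LinearMap.inl k V k)) W)
    {v : V} (hv : (-v, 1) ∈ W) : z = ρ.coact v - v ⊗ₜ 1 := by
  have hE : hz.extension.coact (-v, 1) =
      (LinearMap.inl k V k).rTensor _ (z - ρ.coact v) + (0, 1) ⊗ₜ 1 := by
    change extensionCoact ρ.coact z (-v, 1) = _
    rw [extensionCoact_apply, map_neg, one_smul, neg_add_eq_sub]
  have hinj : Function.Injective (LinearMap.snd k V k ∘ₗ W.subtype) := by
    rw [← LinearMap.domRestrict, LinearMap.injective_domRestrict_iff, LinearMap.ker_snd]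
    exact hW.symm.disjoint
  obtain ⟨y, hy⟩ := hst _ hv
  have hy' : y = (⟨(-v, 1), hv⟩ : W) ⊗ₜ 1 := by
    apply Module.Flat.rTensor_preserves_injective_linearMap (M := coordRing A) _ hinj
    rw [LinearMap.rTensor_comp_apply, hy, hE, map_add, ← LinearMap.rTensor_comp_apply,
      LinearMap.snd_comp_inl]
    simp
  have hfst := congr((LinearMap.fst k V k).rTensor _ $hy)
  rw [hy', LinearMap.rTensor_tmul, hE, map_add, ← LinearMap.rTensor_comp_apply,
    LinearMap.fst_comp_inl] at hfst
  simp only [LinearMap.rTensor_tmul, LinearMap.rTensor_id, LinearMap.id_apply,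
    Submodule.subtype_apply, LinearMap.fst_apply, TensorProduct.zero_tmul, add_zero,
    TensorProduct.neg_tmul] at hfst
  rw [sub_eq_add_neg, hfst, add_sub_cancel]

theorem IsCocycle.exists_eq_sub_of_isLinearlyReductive (hz : ρ.IsCocycle z)
    (hA : IsLinearlyReductive A) : ∃ v, z = ρ.coact v - v ⊗ₜ 1 := by
  obtain ⟨W, hst, hW⟩ := hA _ hz.extension _ hz.isStable_range_inl
  obtain ⟨v, hv⟩ := exists_neg_mem_of_isCompl_range_inl hW
  exact ⟨v, hz.eq_sub_of_isStable hst hW hv⟩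

end Rep

end Extension

section DualNumbers

open TensorProduct

variable {K : Type u} [Field K] {T T' : Over (Spec (.of K))}

theorem hom_algOver_ext {R : Type u} [CommRing R] [Algebra K R] {f g : T ⟶ algOver K R}
    (h : ∀ r, comorphism f (specFun K R r) = comorphism g (specFun K R r)) : f = g := by
  apply specEquiv.injective
  rw [specEquiv_eq_comp_specFun, specEquiv_eq_comp_specFun]
  exact AlgHom.ext h

theorem hom_SpecD_ext {V : Type u} [AddCommGroup V] [Module K V] [Module Kᵐᵒᵖ V]
    [IsCentralScalar K V] {f g : T ⟶ SpecD K V}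
    (h : ∀ v, comorphism f (specFun K (TrivSqZeroExt K V) (TrivSqZeroExt.inr v)) =
      comorphism g (specFun K (TrivSqZeroExt K V) (TrivSqZeroExt.inr v))) : f = g := by
  apply specEquiv.injective
  rw [specEquiv_eq_comp_specFun, specEquiv_eq_comp_specFun]
  exact TrivSqZeroExt.algHom_ext h

theorem comorphism_specEquiv_symm {R : Type u} [CommRing R] [Algebra K R]
    (φ : R →ₐ[K] coordRing T) (r : R) : comorphism (specEquiv.symm φ) (specFun K R r) = φ r := by
  have h := specEquiv_eq_comp_specFun (specEquiv.symm φ)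
  rw [Equiv.apply_symm_apply] at h
  exact congr($h r).symm

theorem specFun_self (c : K) : specFun K K c = algebraMap K _ c := (specFun K K).commutes c

theorem comorphism_fst_algOver_injective :
    Function.Injective (comorphism (fst T (algOver K K))) := by
  let s : T ⟶ T ⊗ algOver K K := lift (𝟙 T) (specEquiv.symm (Algebra.ofId K _))
  have hs (a : coordRing T) : comorphism s (comorphism (fst T (algOver K K)) a) = a := by
    rw [← comorphism_comp_apply, lift_fst, comorphism_id, AlgHom.id_apply]
  exact Function.LeftInverse.injective hs

variable (T) in
/-- The function `ε` on `T × Spec K[ε]`. -/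
def eps : coordRing (T ⊗ SpecD K K) :=
  comorphism (snd T (SpecD K K)) (specFun K (TrivSqZeroExt K K) (TrivSqZeroExt.inr 1))

theorem eps_mul_eps : eps T * eps T = 0 := by
  rw [eps, ← map_mul, ← map_mul, TrivSqZeroExt.inr_mul_inr, map_zero, map_zero]

theorem comorphism_whiskerRight_eps (t : T' ⟶ T) :
    comorphism (t ▷ SpecD K K) (eps T) = eps T' := by
  rw [eps, ← comorphism_comp_apply, whiskerRight_snd, eps]

theorem comorphism_whiskerLeft_zero_eps :
    comorphism (T ◁ SpecD.zero K K) (eps T) = 0 := by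
  rw [eps, ← comorphism_comp_apply, whiskerLeft_snd, comorphism_comp_apply, comorphism_algOverMap]
  simp

variable (T) in
/-- The map `(a, b) ↦ a + b ε` from pairs of functions on `T` to functions on `T × Spec K[ε]`. -/
def dualExpansion : coordRing T × coordRing T →ₗ[K] coordRing (T ⊗ SpecD K K) :=
  (comorphism (fst T (SpecD K K))).toLinearMap.coprod
    (LinearMap.mulRight K (eps T) ∘ₗ (comorphism (fst T (SpecD K K))).toLinearMap)

theorem dualExpansion_apply (p : coordRing T × coordRing T) :
    dualExpansion T p =
      comorphism (fst T (SpecD K K)) p.1 + comorphism (fst T (SpecD K K)) p.2 * eps T := by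
  simp [dualExpansion]

theorem bijective_dualExpansion (hT : IsQcqs K T) : Function.Bijective (dualExpansion T) := by
  let mk := TensorProduct.mk K (coordRing T) (TrivSqZeroExt K K)
  let r := (TensorProduct.rid K (coordRing T)).toLinearMap
  let e : (coordRing T × coordRing T) ≃ₗ[K] coordRing T ⊗[K] TrivSqZeroExt K K := .ofLinearMap
    ((mk.flip 1).coprod (mk.flip (TrivSqZeroExt.inr 1)))
    ((r ∘ₗ (TrivSqZeroExt.fstHom K K K).toLinearMap.lTensor _).prod
      (r ∘ₗ (TrivSqZeroExt.sndHom K K).lTensor _))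
    (by
      refine TensorProduct.ext' fun a s => ?_
      have hs : s.fst • (1 : TrivSqZeroExt K K) + s.snd • TrivSqZeroExt.inr 1 = s := by
        ext <;> simp
      rw [LinearMap.id_apply]
      nth_rw 2 [← hs]
      simp [mk, r, TensorProduct.tmul_add, TensorProduct.smul_tmul'])
    (by ext <;> simp [mk, r])
  have h : dualExpansion T = (kunnethSpec T (TrivSqZeroExt K K)).toLinearMap ∘ₗ e.toLinearMap := by
    ext a <;> simp [e, mk, dualExpansion, kunnethSpec_tmul, eps]
  rw [h]
  exact (bijective_kunnethSpec hT).comp e.bijective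

theorem comorphism_mul_eps_injective (hT : IsQcqs K T) :
    Function.Injective fun a => comorphism (fst T (SpecD K K)) a * eps T := by
  intro a b h
  have h' : dualExpansion T (0, a) = dualExpansion T (0, b) := by
    simpa only [dualExpansion_apply, map_zero, zero_add] using h
  exact congr(($((bijective_dualExpansion hT).1 h')).2)

end DualNumbers

section Stretch

variable {K : Type u} [Field K] {T T' H : Over (Spec (.of K))}
  {V W : Type u} [AddCommGroup V] [Module K V] [Module Kᵐᵒᵖ V] [IsCentralScalar K V]
  [AddCommGroup W] [Module K W] [Module Kᵐᵒᵖ W] [IsCentralScalar K W]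

theorem whiskerLeft_map_comp_map {U : Type u} [AddCommGroup U] [Module K U] [Module Kᵐᵒᵖ U]
    [IsCentralScalar K U] (l : V →ₗ[K] W) (m : W →ₗ[K] U) (x : T ⊗ SpecD K V ⟶ H) :
    T ◁ SpecD.map m ≫ T ◁ SpecD.map l ≫ x = T ◁ SpecD.map (m ∘ₗ l) ≫ x := by
  rw [← whiskerLeft_comp_assoc, algOverMap_comp, SpecD.map, TrivSqZeroExt.map_comp_map]

theorem hom_SpecD_prod_ext [IsSeparated H.hom] {x y : T ⊗ SpecD K (V × W) ⟶ H}
    (h1 : T ◁ SpecD.map (LinearMap.fst K V W) ≫ x = T ◁ SpecD.map (LinearMap.fst K V W) ≫ y)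
    (h2 : T ◁ SpecD.map (LinearMap.snd K V W) ≫ x = T ◁ SpecD.map (LinearMap.snd K V W) ≫ y) :
    x = y := by
  let φ : TrivSqZeroExt K (V × W) →ₐ[K] TrivSqZeroExt K V × TrivSqZeroExt K W :=
    (TrivSqZeroExt.map (LinearMap.fst K V W)).prod (TrivSqZeroExt.map (LinearMap.snd K V W))
  have hφ : Function.Injective φ := by
    intro a b h
    have hV := congr(($h).1)
    have hW := congr(($h).2)
    have h0 : a.fst = b.fst := by simpa [φ] using congr(($hV).fst)
    have hV' : a.snd.1 = b.snd.1 := by simpa [φ] using congr(($hV).snd)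
    have hW' : a.snd.2 = b.snd.2 := by simpa [φ] using congr(($hW).snd)
    exact TrivSqZeroExt.ext h0 (Prod.ext hV' hW')
  apply algOver_injective_ext K φ hφ
  apply algOver_prod_ext
  · rw [← whiskerLeft_comp_assoc, ← whiskerLeft_comp_assoc, algOverMap_comp]
    exact h1
  · rw [← whiskerLeft_comp_assoc, ← whiskerLeft_comp_assoc, algOverMap_comp]
    exact h2

/-- The homomorphism `D(V) → 𝒪(T × Spec K[ε])` mapping `v` to `l(v)ε`. -/
def stretchAlg (l : V →ₗ[K] coordRing T) :
    TrivSqZeroExt K V →ₐ[K] coordRing (T ⊗ SpecD K K) :=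
  TrivSqZeroExt.liftEquivOfComm ⟨LinearMap.mulRight K (eps T) ∘ₗ
    (comorphism (fst T (SpecD K K))).toLinearMap ∘ₗ l, fun v w => by
      simp only [LinearMap.comp_apply, LinearMap.mulRight_apply]
      rw [_root_.mul_mul_mul_comm, eps_mul_eps, mul_zero]⟩

theorem stretchAlg_inr (l : V →ₗ[K] coordRing T) (v : V) :
    stretchAlg l (TrivSqZeroExt.inr v) = comorphism (fst T (SpecD K K)) (l v) * eps T := by
  change algebraMap K _ 0 + _ * eps T = _
  rw [map_zero, zero_add]
  rfl

/-- The morphism `T × Spec K[ε] ⟶ T × Spec D(V)` over `T` mapping a function `v` in `V` to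
`l(v)ε`. -/
def stretch (l : V →ₗ[K] coordRing T) : T ⊗ SpecD K K ⟶ T ⊗ SpecD K V :=
  lift (fst _ _) (specEquiv.symm (stretchAlg l))

@[simp]
theorem stretch_fst (l : V →ₗ[K] coordRing T) : stretch l ≫ fst _ _ = fst _ _ := lift_fst _ _

theorem stretch_fst_assoc (l : V →ₗ[K] coordRing T) (h : T ⟶ H) :
    stretch l ≫ fst _ _ ≫ h = fst _ _ ≫ h := by
  rw [← Category.assoc, stretch_fst]

theorem comorphism_stretch_snd (l : V →ₗ[K] coordRing T) (v : V) :
    comorphism (stretch l ≫ snd _ _) (specFun K (TrivSqZeroExt K V) (TrivSqZeroExt.inr v)) =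
      comorphism (fst T (SpecD K K)) (l v) * eps T := by
  rw [stretch, lift_snd, comorphism_specEquiv_symm, stretchAlg_inr]

theorem comorphism_stretch_eps (l : K →ₗ[K] coordRing T) :
    comorphism (stretch l) (eps T) = comorphism (fst T (SpecD K K)) (l 1) * eps T := by
  nth_rw 1 [eps]
  rw [← comorphism_comp_apply, comorphism_stretch_snd]

theorem eq_stretch {g : T ⊗ SpecD K K ⟶ T ⊗ SpecD K V} {l : V →ₗ[K] coordRing T}
    (h1 : g ≫ fst _ _ = fst _ _)
    (h2 : ∀ v, comorphism (g ≫ snd _ _) (specFun K (TrivSqZeroExt K V) (TrivSqZeroExt.inr v)) =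
      comorphism (fst T (SpecD K K)) (l v) * eps T) : g = stretch l := by
  apply CartesianMonoidalCategory.hom_ext
  · rw [h1, stretch_fst]
  · exact hom_SpecD_ext fun v => (h2 v).trans (comorphism_stretch_snd l v).symm

theorem stretch_comp_whiskerLeft_map (l : V →ₗ[K] coordRing T) (m : W →ₗ[K] V) :
    stretch l ≫ T ◁ SpecD.map m = stretch (l ∘ₗ m) := by
  apply eq_stretch
  · simp
  · intro w
    rw [Category.assoc, whiskerLeft_snd, ← Category.assoc, comorphism_comp_apply,
      comorphism_algOverMap, TrivSqZeroExt.map_inr, comorphism_stretch_snd]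
    rfl

theorem stretch_comp_stretch (l : K →ₗ[K] coordRing T) (m : V →ₗ[K] coordRing T) :
    stretch l ≫ stretch m = stretch (LinearMap.mulLeft K (l 1) ∘ₗ m) := by
  apply eq_stretch
  · simp
  · intro w
    rw [Category.assoc, comorphism_comp_apply, comorphism_stretch_snd, map_mul,
      comorphism_stretch_eps, ← comorphism_comp_apply, stretch_fst, LinearMap.comp_apply,
      LinearMap.mulLeft_apply, map_mul]
    ring

theorem whiskerRight_comp_stretch (t : T' ⟶ T) (l : V →ₗ[K] coordRing T) :
    t ▷ SpecD K K ≫ stretch l =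
      stretch ((comorphism t).toLinearMap ∘ₗ l) ≫ t ▷ SpecD K V := by
  apply CartesianMonoidalCategory.hom_ext
  · simp [stretch_fst_assoc]
  · apply hom_SpecD_ext
    intro v
    rw [Category.assoc, Category.assoc, whiskerRight_snd, comorphism_stretch_snd,
      comorphism_comp_apply, comorphism_stretch_snd, map_mul, comorphism_whiskerRight_eps,
      ← comorphism_comp_apply, whiskerRight_fst, comorphism_comp_apply]
    rfl

theorem whiskerLeft_zero_comp_stretch (l : V →ₗ[K] coordRing T) :
    T ◁ SpecD.zero K K ≫ stretch l = T ◁ SpecD.zero K V := by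
  apply CartesianMonoidalCategory.hom_ext
  · simp
  · apply hom_SpecD_ext
    intro v
    rw [Category.assoc, comorphism_comp_apply, comorphism_stretch_snd, map_mul,
      comorphism_whiskerLeft_zero_eps, mul_zero, whiskerLeft_snd, comorphism_comp_apply,
      comorphism_algOverMap]
    simp

theorem stretch_algebraMap (c : K) :
    stretch (LinearMap.toSpanSingleton K (coordRing T) (algebraMap K _ c)) =
      T ◁ SpecD.map (c • LinearMap.id) := by
  symm
  apply eq_stretch
  · simp
  · intro v
    have e : TrivSqZeroExt.inr ((c • LinearMap.id : K →ₗ[K] K) v) =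
        (v * c) • (TrivSqZeroExt.inr 1 : TrivSqZeroExt K K) := by
      ext <;> simp [mul_comm]
    rw [whiskerLeft_snd, comorphism_comp_apply, comorphism_algOverMap, TrivSqZeroExt.map_inr,
      eps, LinearMap.toSpanSingleton_apply, e, map_smul, map_smul, Algebra.smul_def v, ← map_mul,
      AlgHom.commutes, ← Algebra.smul_def]

variable [GrpObj H]

theorem whiskerLeft_map_comp_eq_one {x : T ⊗ SpecD K V ⟶ H} (hx : T ◁ SpecD.zero K V ≫ x = 1)
    {m : V →ₗ[K] W} (hm : m = 0) : T ◁ SpecD.map m ≫ x = 1 := by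
  have h : TrivSqZeroExt.map m =
      (TrivSqZeroExt.inlAlgHom K K W).comp (TrivSqZeroExt.fstHom K K V) := by
    subst hm; ext <;> simp
  rw [SpecD.map, h, ← algOverMap_comp, whiskerLeft_comp_assoc, hx, comp_one]

variable [IsSeparated H.hom]

theorem stretch_add {x : T ⊗ SpecD K V ⟶ H} (hx : T ◁ SpecD.zero K V ≫ x = 1)
    (l m : V →ₗ[K] coordRing T) :
    stretch (l + m) ≫ x = (stretch l ≫ x) * (stretch m ≫ x) := by
  have key : T ◁ SpecD.map (LinearMap.inl K V V + LinearMap.inr K V V) ≫ x =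
      (T ◁ SpecD.map (LinearMap.inl K V V) ≫ x) *
        (T ◁ SpecD.map (LinearMap.inr K V V) ≫ x) := by
    apply hom_SpecD_prod_ext
    · simp only [comp_mul, whiskerLeft_map_comp_map, LinearMap.comp_add]
      rw [whiskerLeft_map_comp_eq_one hx (LinearMap.fst_comp_inr ..), LinearMap.fst_comp_inr,
        add_zero, _root_.mul_one]
    · simp only [comp_mul, whiskerLeft_map_comp_map, LinearMap.comp_add]
      rw [whiskerLeft_map_comp_eq_one hx (LinearMap.snd_comp_inl ..), LinearMap.snd_comp_inl,
        zero_add, _root_.one_mul]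
  have := congr(stretch (LinearMap.coprod l m) ≫ $key)
  rw [comp_mul] at this
  simp only [← Category.assoc, stretch_comp_whiskerLeft_map, LinearMap.comp_add,
    LinearMap.coprod_inl, LinearMap.coprod_inr] at this
  exact this

namespace Lie

/-- The restriction of a morphism `x : T × Spec D(V) ⟶ H` that is trivial on `T` along `stretch l`,
as a point of the Lie algebra. -/
def ofStretch (x : T ⊗ SpecD K V ⟶ H) (hx : T ◁ SpecD.zero K V ≫ x = 1) :
    (V →ₗ[K] coordRing T) →+ Lie H T :=
  AddMonoidHom.mk' (fun l => mk (stretch l ≫ x) (by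
    rw [← Category.assoc, whiskerLeft_zero_comp_stretch, hx])) fun l m => by
      ext1
      exact stretch_add hx l m

theorem val_ofStretch (x : T ⊗ SpecD K V ⟶ H) (hx : T ◁ SpecD.zero K V ≫ x = 1)
    (l : V →ₗ[K] coordRing T) : (ofStretch x hx l).val = stretch l ≫ x := rfl

/-- Multiplication of a `T`-point of `Lie(H)` by a function on `T`. -/
def fmul : coordRing T →ₗ[K] Lie H T →ₗ[K] Lie H T :=
  LinearMap.mk₂ K (fun a x => ofStretch x.val x.zero_val (LinearMap.toSpanSingleton K _ a))
    (fun a b x => by rw [← map_add]; congr 1; ext; simp)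
    (fun c a x => by
      ext1
      rw [val_smul, val_ofStretch, val_ofStretch, ← stretch_algebraMap,
        ← Category.assoc, stretch_comp_stretch]
      congr 2
      ext
      simp [Algebra.smul_def])
    (fun a x y => by ext1; exact comp_mul _ _ _)
    (fun c a x => by
      ext1
      refine (Category.assoc _ _ _).symm.trans ?_
      rw [val_smul, val_ofStretch, stretch_comp_whiskerLeft_map, ← stretch_algebraMap,
        ← Category.assoc, stretch_comp_stretch]
      congr 2
      ext
      simp [Algebra.smul_def])

theorem val_fmul (a : coordRing T) (x : Lie H T) :
    (fmul a x).val = stretch (LinearMap.toSpanSingleton K _ a) ≫ x.val := rfl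

theorem fmul_ofStretch (x : T ⊗ SpecD K V ⟶ H) (hx : T ◁ SpecD.zero K V ≫ x = 1)
    (a : coordRing T) (l : V →ₗ[K] coordRing T) :
    fmul a (ofStretch x hx l) = ofStretch x hx (LinearMap.mulLeft K a ∘ₗ l) := by
  ext1
  rw [val_fmul, val_ofStretch, val_ofStretch, ← Category.assoc, stretch_comp_stretch]
  simp

theorem fmul_mul (a b : coordRing T) (x : Lie H T) : fmul (a * b) x = fmul a (fmul b x) := by
  ext1
  rw [val_fmul, val_fmul, val_fmul, ← Category.assoc, stretch_comp_stretch]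
  congr 2
  ext
  simp

theorem fmul_algebraMap (c : K) (x : Lie H T) : fmul (algebraMap K _ c) x = c • x := by
  ext1
  rw [val_fmul, stretch_algebraMap, val_smul]

theorem pullback_fmul (t : T' ⟶ T) (a : coordRing T) (x : Lie H T) :
    pullback t (fmul a x) = fmul (comorphism t a) (pullback t x) := by
  ext1
  rw [val_pullback, val_fmul, val_fmul, val_pullback, ← Category.assoc, whiskerRight_comp_stretch,
    Category.assoc]
  congr 2
  ext
  simp

theorem Ad_fmul (h : T ⟶ H) (a : coordRing T) (x : Lie H T) :
    Ad h (fmul a x) = fmul a (Ad h x) := by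
  ext1
  rw [val_Ad, val_fmul, val_fmul, val_Ad, comp_mul, comp_mul, GrpObj.comp_inv]
  simp only [stretch_fst_assoc]

end Lie
end Stretch

section UniversalDerivation

open TensorProduct KaehlerDifferential

variable {K R N : Type u} [Field K] [CommRing R] [Algebra K R] [AddCommGroup N] [Module K N]

/-- `δ` is the universal derivation at the `K`-point `ε` of `Spec R`; its target is then the
cotangent space at `ε`. -/
structure IsUniversalDerivationAt (ε : R →ₐ[K] K) (δ : R →ₗ[K] N) : Prop where
  isDerivationAlong : IsDerivationAlong ε δ
  surjective : Function.Surjective δ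
  exists_eq_comp {M : Type u} [AddCommGroup M] [Module K M] {E : R →ₗ[K] M} :
    IsDerivationAlong ε E → ∃ L : N →ₗ[K] M, E = L ∘ₗ δ

theorem IsUniversalDerivationAt.congr {N' : Type u} [AddCommGroup N'] [Module K N']
    {ε : R →ₐ[K] K} {δ : R →ₗ[K] N} (h : IsUniversalDerivationAt ε δ) (e : N ≃ₗ[K] N') :
    IsUniversalDerivationAt ε (e.toLinearMap ∘ₗ δ) where
  isDerivationAlong a b := by simp [h.isDerivationAlong a b]
  surjective := e.surjective.comp h.surjective
  exists_eq_comp hE := by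
    obtain ⟨L, rfl⟩ := h.exists_eq_comp hE
    exact ⟨L ∘ₗ e.symm.toLinearMap, by ext; simp⟩

section KaehlerDifferential

variable [Algebra R K] [IsScalarTower K R K]

variable (K R) in
/-- The derivation `a ↦ 1 ⊗ da` of `R` with values in the fibre `K ⊗ Ω` of the Kähler
differentials. -/
def fibreD : R →ₗ[K] K ⊗[R] Ω[R⁄K] :=
  (TensorProduct.mk R K Ω[R⁄K] 1).restrictScalars K ∘ₗ (D K R).toLinearMap

theorem fibreD_surjective : Function.Surjective (fibreD K R) := by
  rw [← LinearMap.range_eq_top, eq_top_iff]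
  rintro x -
  induction x with
  | zero => exact zero_mem _
  | add x y hx hy => exact add_mem hx hy
  | tmul c ω =>
    have hω : ω ∈ Submodule.span R (Set.range (D K R)) := by
      rw [span_range_derivation]
      trivial
    induction hω using Submodule.span_induction generalizing c with
    | mem _ h =>
      obtain ⟨a, rfl⟩ := h
      refine ⟨c • a, ?_⟩
      simp [fibreD, TensorProduct.smul_tmul']
    | zero => simp
    | add x y _ _ hx hy => rw [TensorProduct.tmul_add]; exact add_mem (hx c) (hy c)
    | smul a x _ hx => rw [← TensorProduct.smul_tmul]; exact hx (a • c)

theorem isUniversalDerivationAt_fibreD :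
    IsUniversalDerivationAt (IsScalarTower.toAlgHom K R K) (fibreD K R) where
  isDerivationAlong a b := by
    simp [fibreD, TensorProduct.tmul_add, TensorProduct.smul_tmul']
  surjective := fibreD_surjective
  exists_eq_comp {M} _ _ E hE := by
    let : Module R M := Module.compHom M (algebraMap R K)
    have : IsScalarTower R K M := .of_algebraMap_smul fun _ _ => rfl
    have : IsScalarTower K R M := ⟨fun c a x =>
      congr($(map_smul (IsScalarTower.toAlgHom K R K) c a) • x).trans (mul_smul ..)⟩
    let E' : Derivation K R M := Derivation.mk' E hE
    refine ⟨LinearMap.liftBaseChange K E'.liftKaehlerDifferential, LinearMap.ext fun a => ?_⟩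
    have ha : E'.liftKaehlerDifferential (D K R a) = E a :=
      E'.liftKaehlerDifferential_comp_D a
    simp [fibreD, ha]

end KaehlerDifferential

theorem exists_isUniversalDerivationAt [Algebra.FiniteType K R] (ε : R →ₐ[K] K) :
    ∃ (n : ℕ) (δ : R →ₗ[K] (Fin n → K)), IsUniversalDerivationAt ε δ := by
  let : Algebra R K := ε.toAlgebra
  have : IsScalarTower K R K := .of_algebraMap_eq' ε.comp_algebraMap.symm
  exact ⟨_, _, isUniversalDerivationAt_fibreD.congr
    (Module.finBasis K (K ⊗[R] Ω[R⁄K])).equivFun⟩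

end UniversalDerivation

section Neighbourhood

variable {K : Type u} [Field K] {H T : Over (Spec (.of K))}

theorem exists_comp_eq_of_range_subset {U Z : Over (Spec (.of K))} (j : U ⟶ H)
    [IsOpenImmersion j.left] (x : Z ⟶ H) (h : Set.range x.left ⊆ Set.range j.left) :
    ∃ x' : Z ⟶ U, x' ≫ j = x := by
  refine ⟨Over.homMk (IsOpenImmersion.lift j.left x.left h) ?_, ?_⟩
  · rw [← Over.w j, IsOpenImmersion.lift_fac_assoc, Over.w]
  · exact Over.OverMorphism.ext (IsOpenImmersion.lift_fac _ _ _)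

theorem exists_comp_eq_of_surjective {U Z Z₀ : Over (Spec (.of K))} (j : U ⟶ H)
    [IsOpenImmersion j.left] (i : Z₀ ⟶ Z) [Surjective i.left] (x : Z ⟶ H) (x₀ : Z₀ ⟶ U)
    (h : i ≫ x = x₀ ≫ j) : ∃ x' : Z ⟶ U, x' ≫ j = x := by
  apply exists_comp_eq_of_range_subset
  rintro _ ⟨q, rfl⟩
  obtain ⟨q, rfl⟩ := i.left.surjective q
  exact ⟨x₀.left q, congr(($h).left q).symm⟩

theorem exists_algOverMap_eq {R : Type u} [CommRing R] [Algebra K R]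
    (e : algOver K K ⟶ algOver K R) : ∃ ε : R →ₐ[K] K, algOverMap ε = e := by
  let i := AlgEquiv.ofBijective (specFun K K) bijective_specFun
  refine ⟨i.symm.toAlgHom.comp (specEquiv e), hom_algOver_ext fun r => ?_⟩
  rw [comorphism_algOverMap, AlgHom.comp_apply, specEquiv_eq_comp_specFun]
  exact i.apply_symm_apply _

theorem exists_affine_neighbourhood_of_point [LocallyOfFiniteType H.hom] (e : algOver K K ⟶ H) :
    ∃ (R : Type u) (_ : CommRing R) (_ : Algebra K R) (_ : Algebra.FiniteType K R)
      (j : algOver K R ⟶ H) (ε : R →ₐ[K] K), IsOpenImmersion j.left ∧ algOverMap ε ≫ j = e := by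
  obtain ⟨p⟩ : Nonempty (algOver K K).left := inferInstanceAs (Nonempty (PrimeSpectrum K))
  have : Subsingleton (algOver K K).left := inferInstanceAs (Subsingleton (PrimeSpectrum K))
  obtain ⟨U, hU, hpU, -⟩ := exists_isAffineOpen_mem_and_subset (X := H.left)
    (x := e.left p) (U := ⊤) trivial
  let φ : CommRingCat.of K ⟶ Γ(H.left, U) := Spec.preimage (hU.fromSpec ≫ H.hom)
  have hφ : Spec.map φ = hU.fromSpec ≫ H.hom := Spec.map_preimage _
  let : Algebra K Γ(H.left, U) := φ.hom.toAlgebra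
  have hft : Algebra.FiniteType K Γ(H.left, U) := by
    have : LocallyOfFiniteType (Spec.map φ) := by rw [hφ]; infer_instance
    exact (HasRingHomProperty.Spec_iff (P := @LocallyOfFiniteType)).mp this
  let j : algOver K Γ(H.left, U) ⟶ H := Over.homMk hU.fromSpec hφ.symm
  have hj : IsOpenImmersion j.left := inferInstanceAs (IsOpenImmersion hU.fromSpec)
  have hr : Set.range e.left ⊆ Set.range j.left := by
    rintro _ ⟨q, rfl⟩
    rw [Subsingleton.elim q p]
    exact hU.range_fromSpec.symm ▸ hpU
  obtain ⟨e', rfl⟩ := exists_comp_eq_of_range_subset j e hr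
  obtain ⟨ε, rfl⟩ := exists_algOverMap_eq e'
  exact ⟨_, _, _, hft, j, ε, hj, rfl⟩

instance surjective_SpecD_zero (V : Type u) [AddCommGroup V] [Module K V] [Module Kᵐᵒᵖ V]
    [IsCentralScalar K V] : Surjective (SpecD.zero K V).left := by
  refine ⟨Set.range_eq_univ.mp ?_⟩
  let φ := (TrivSqZeroExt.fstHom K K V).toRingHom
  have hφ : Function.Surjective φ := fun c => ⟨.inl c, rfl⟩
  refine (range_comap_of_surjective _ φ hφ).trans (PrimeSpectrum.zeroLocus_eq_univ_iff _ |>.mpr ?_)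
  intro a (ha : a.fst = 0)
  exact ⟨2, by rw [pow_two]; ext <;> simp [ha]⟩

instance surjective_whiskerLeft_zero : Surjective (T ◁ SpecD.zero K K).left :=
  MorphismProperty.of_isPullback
    ((isPullback_whiskerLeft T (SpecD.zero K K)).flip.map (Over.forget _))
    (surjective_SpecD_zero K)

end Neighbourhood

section CotangentSpace

variable {K : Type u} [Field K] {R : Type u} [CommRing R] [Algebra K R]
  {H T T' : Over (Spec (.of K))} [GrpObj H] {j : algOver K R ⟶ H} {ε : R →ₐ[K] K}

theorem isDerivationAlong_of_forall_eq_add_mul_eps (hT : IsQcqs K T)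
    {y : R →ₐ[K] coordRing (T ⊗ SpecD K K)} {E : R →ₗ[K] coordRing T}
    (hy : ∀ r, y r = algebraMap K _ (ε r) + comorphism (fst T (SpecD K K)) (E r) * eps T) :
    IsDerivationAlong ε E := by
  intro a b
  apply comorphism_mul_eps_injective hT
  have hab := hy (a * b)
  rw [map_mul, hy a, hy b, map_mul, map_mul] at hab
  simp only [map_add, Algebra.smul_def, map_mul, AlgHom.commutes]
  linear_combination -hab +
    comorphism (fst T (SpecD K K)) (E a) * comorphism (fst T (SpecD K K)) (E b) *
      eps_mul_eps (T := T)

theorem exists_eq_add_mul_eps (hT : IsQcqs K T) {x : T ⊗ SpecD K K ⟶ algOver K R}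
    (hx : T ◁ SpecD.zero K K ≫ x = snd T (algOver K K) ≫ algOverMap ε) :
    ∃ E : R →ₗ[K] coordRing T, ∀ r, comorphism x (specFun K R r) =
      algebraMap K _ (ε r) + comorphism (fst T (SpecD K K)) (E r) * eps T := by
  let y : R →ₐ[K] coordRing (T ⊗ SpecD K K) := (comorphism x).comp (specFun K R)
  let e := LinearEquiv.ofBijective (dualExpansion T) (bijective_dualExpansion hT)
  let p : R →ₗ[K] coordRing T × coordRing T := e.symm.toLinearMap ∘ₗ y.toLinearMap
  have hp (r : R) : y r = comorphism (fst T (SpecD K K)) (p r).1 +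
      comorphism (fst T (SpecD K K)) (p r).2 * eps T := by
    rw [← dualExpansion_apply]
    exact (e.apply_symm_apply (y r)).symm
  have hconst (r : R) : (p r).1 = algebraMap K _ (ε r) := by
    apply comorphism_fst_algOver_injective
    calc comorphism (fst T (algOver K K)) (p r).1
      _ = comorphism (T ◁ SpecD.zero K K) (y r) := by
        rw [hp, map_add, map_mul, comorphism_whiskerLeft_zero_eps, mul_zero, add_zero,
          ← comorphism_comp_apply, whiskerLeft_fst]
      _ = comorphism (T ◁ SpecD.zero K K ≫ x) (specFun K R r) :=
        (comorphism_comp_apply _ _ _).symm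
      _ = comorphism (fst T (algOver K K)) (algebraMap K _ (ε r)) := by
        rw [hx, comorphism_comp_apply, comorphism_algOverMap, specFun_self, AlgHom.commutes,
          AlgHom.commutes]
  refine ⟨LinearMap.snd K _ _ ∘ₗ p, fun r => (hp r).trans ?_⟩
  rw [hconst, AlgHom.commutes]
  rfl

variable {N : Type u} [AddCommGroup N] [Module K N] [Module Kᵐᵒᵖ N] [IsCentralScalar K N]
  {δ : R →ₗ[K] N} (hδ : IsDerivationAlong ε δ)

theorem whiskerLeft_zero_comp_snd_comp_toAlgHom (hε : algOverMap ε ≫ j = 1) :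
    T ◁ SpecD.zero K N ≫ snd T (SpecD K N) ≫ algOverMap hδ.toAlgHom ≫ j = 1 := by
  have h : (TrivSqZeroExt.fstHom K K N).comp hδ.toAlgHom = ε :=
    AlgHom.ext hδ.fst_toAlgHom
  rw [whiskerLeft_snd_assoc, ← Category.assoc (SpecD.zero K N), algOverMap_comp, h, hε, comp_one]

theorem comorphism_stretch_toAlgHom (l : N →ₗ[K] coordRing T) (r : R) :
    comorphism (stretch l ≫ snd T (SpecD K N) ≫ algOverMap hδ.toAlgHom) (specFun K R r) =
      algebraMap K _ (ε r) + comorphism (fst T (SpecD K K)) (l (δ r)) * eps T := by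
  have hr : hδ.toAlgHom r = algebraMap K _ (ε r) + TrivSqZeroExt.inr (δ r) := by
    ext <;> simp [TrivSqZeroExt.algebraMap_eq_inl]
  rw [← Category.assoc, comorphism_comp_apply, comorphism_algOverMap, hr, map_add, map_add,
    comorphism_stretch_snd, AlgHom.commutes, AlgHom.commutes]

namespace Lie

variable [IsSeparated H.hom]

/-- The `T`-point of `Lie(H)` given by a linear map from the cotangent space of `H` at the
identity, here represented by the target of a derivation `δ`, to `𝒪(T)`. -/
def ofCotangent (hε : algOverMap ε ≫ j = 1) (T : Over (Spec (.of K))) :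
    (N →ₗ[K] coordRing T) →+ Lie H T :=
  ofStretch (snd T (SpecD K N) ≫ algOverMap hδ.toAlgHom ≫ j)
    (whiskerLeft_zero_comp_snd_comp_toAlgHom hδ hε)

variable (hε : algOverMap ε ≫ j = 1)

theorem val_ofCotangent (l : N →ₗ[K] coordRing T) : (ofCotangent hδ hε T l).val =
    (stretch l ≫ snd T (SpecD K N) ≫ algOverMap hδ.toAlgHom) ≫ j := by
  rw [ofCotangent, val_ofStretch, Category.assoc, Category.assoc]

theorem pullback_ofCotangent (t : T' ⟶ T) (l : N →ₗ[K] coordRing T) :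
    pullback t (ofCotangent hδ hε T l) =
      ofCotangent hδ hε T' ((comorphism t).toLinearMap ∘ₗ l) := by
  ext1
  simp only [val_pullback, val_ofCotangent, Category.assoc]
  rw [← Category.assoc, whiskerRight_comp_stretch, Category.assoc, whiskerRight_snd_assoc]

variable [IsOpenImmersion j.left] {hδ}

theorem ofCotangent_injective (hs : Function.Surjective δ) (hT : IsQcqs K T) :
    Function.Injective (ofCotangent hδ hε T) := by
  intro l m h
  have : Mono j := Over.mono_of_mono_left j
  have hlm : (stretch l ≫ snd T (SpecD K N) ≫ algOverMap hδ.toAlgHom) =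
      stretch m ≫ snd T (SpecD K N) ≫ algOverMap hδ.toAlgHom := by
    rw [← cancel_mono j, ← val_ofCotangent hδ hε, ← val_ofCotangent hδ hε, h]
  ext x
  obtain ⟨r, rfl⟩ := hs x
  apply comorphism_mul_eps_injective hT
  have hr := congr(comorphism $hlm (specFun K R r))
  rw [comorphism_stretch_toAlgHom, comorphism_stretch_toAlgHom] at hr
  exact add_left_cancel hr

theorem ofCotangent_surjective (hδ : IsUniversalDerivationAt ε δ) (hT : IsQcqs K T) :
    Function.Surjective (ofCotangent hδ.isDerivationAlong hε T) := by
  intro x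
  have : Mono j := Over.mono_of_mono_left j
  have hx1 : T ◁ SpecD.zero K K ≫ x.val = (snd T (algOver K K) ≫ algOverMap ε) ≫ j := by
    rw [x.zero_val, Category.assoc, hε, comp_one]
  obtain ⟨x', hx'⟩ := exists_comp_eq_of_surjective j (T ◁ SpecD.zero K K) x.val _ hx1
  have hx0 : T ◁ SpecD.zero K K ≫ x' = snd T (algOver K K) ≫ algOverMap ε := by
    rw [← cancel_mono j, Category.assoc, hx', hx1]
  obtain ⟨E, hE⟩ := exists_eq_add_mul_eps hT hx0
  obtain ⟨l, rfl⟩ := hδ.exists_eq_comp (isDerivationAlong_of_forall_eq_add_mul_eps hT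
    (y := (comorphism x').comp (specFun K R)) hE)
  refine ⟨l, ?_⟩
  have hl : stretch l ≫ snd T (SpecD K N) ≫ algOverMap hδ.isDerivationAlong.toAlgHom = x' :=
    hom_algOver_ext fun r => (comorphism_stretch_toAlgHom _ l r).trans (hE r).symm
  ext1
  rw [val_ofCotangent, hl, hx']

theorem bijective_ofCotangent (hδ : IsUniversalDerivationAt ε δ) (hT : IsQcqs K T) :
    Function.Bijective (ofCotangent hδ.isDerivationAlong hε T) :=
  ⟨ofCotangent_injective hε hδ.surjective hT, ofCotangent_surjective hε hδ hT⟩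

end Lie

end CotangentSpace

section Tensor

open TensorProduct

variable {K : Type u} [Field K] {H T : Over (Spec (.of K))} [GrpObj H] [IsSeparated H.hom]

theorem bijective_comorphism_of_isIso {X Y : Over (Spec (.of K))} (f : X ⟶ Y) [IsIso f] :
    Function.Bijective (comorphism f) := by
  refine Function.bijective_iff_has_inverse.mpr ⟨comorphism (inv f), fun a => ?_, fun a => ?_⟩
  · rw [← comorphism_comp_apply, IsIso.inv_hom_id, comorphism_id, AlgHom.id_apply]
  · rw [← comorphism_comp_apply, IsIso.hom_inv_id, comorphism_id, AlgHom.id_apply]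

variable (K) in
theorem bijective_algebraMap_coordRing_unit :
    Function.Bijective (Algebra.linearMap K (coordRing (𝟙_ (Over (Spec (.of K)))))) := by
  have e : algOver K K ≅ 𝟙_ (Over (Spec (.of K))) :=
    Over.isoMk (Iso.refl _) ((Category.id_comp _).trans (Spec.map_id _).symm)
  convert (bijective_comorphism_of_isIso e.inv).comp (bijective_specFun (K := K) (R := K)) using 1
  ext c
  rw [Function.comp_apply, specFun_self, AlgHom.commutes, Algebra.linearMap_apply]

theorem isQcqs_unit : IsQcqs K (𝟙_ (Over (Spec (.of K)))) :=
  ⟨inferInstanceAs (QuasiCompact (𝟙 _)), inferInstanceAs (QuasiSeparated (𝟙 _))⟩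

namespace Lie

variable (H T) in
/-- The multiplication map `Lie(H) ⊗ 𝒪(T) → Lie(H)(T)`. -/
def ofTensor : Lie H (𝟙_ (Over (Spec (.of K)))) ⊗[K] coordRing T →ₗ[K] Lie H T :=
  TensorProduct.lift (fmul.flip ∘ₗ pullback (toUnit T))

theorem ofTensor_tmul (v : Lie H (𝟙_ (Over (Spec (.of K))))) (a : coordRing T) :
    ofTensor H T (v ⊗ₜ a) = fmul a (pullback (toUnit T) v) := rfl

variable {R : Type u} [CommRing R] [Algebra K R] {j : algOver K R ⟶ H} {ε : R →ₐ[K] K}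
  {N : Type u} [AddCommGroup N] [Module K N] [Module Kᵐᵒᵖ N] [IsCentralScalar K N]
  {δ : R →ₗ[K] N}

/-- The map from the dual of the cotangent space of `H` at the identity, represented by the
target of a derivation `δ`, to `Lie(H)`. -/
def ofDualCotangent (hδ : IsDerivationAlong ε δ) (hε : algOverMap ε ≫ j = 1) :
    Module.Dual K N →ₗ[K] Lie H (𝟙_ (Over (Spec (.of K)))) where
  toFun l := ofCotangent hδ hε _ (Algebra.linearMap K _ ∘ₗ l)
  map_add' l m := by rw [LinearMap.comp_add, map_add]
  map_smul' c l := by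
    rw [RingHom.id_apply, ← fmul_algebraMap, ofCotangent, fmul_ofStretch]
    congr 1
    ext x
    exact map_mul (algebraMap K _) c (l x)

theorem ofDualCotangent_apply (hδ : IsDerivationAlong ε δ) (hε : algOverMap ε ≫ j = 1)
    (l : Module.Dual K N) :
    ofDualCotangent hδ hε l = ofCotangent hδ hε _ (Algebra.linearMap K _ ∘ₗ l) := rfl

theorem bijective_ofDualCotangent [IsOpenImmersion j.left] (hδ : IsUniversalDerivationAt ε δ)
    (hε : algOverMap ε ≫ j = 1) :
    Function.Bijective (ofDualCotangent hδ.isDerivationAlong hε) := by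
  let b := LinearEquiv.ofBijective _ (bijective_algebraMap_coordRing_unit K)
  exact (bijective_ofCotangent hε hδ isQcqs_unit).comp (b.congrRight (M := N)).bijective

theorem ofTensor_rTensor_ofDualCotangent (hδ : IsDerivationAlong ε δ)
    (hε : algOverMap ε ≫ j = 1) (z : Module.Dual K N ⊗[K] coordRing T) :
    ofTensor H T ((ofDualCotangent hδ hε).rTensor _ z) =
      ofCotangent hδ hε T (dualTensorHom K N _ z) := by
  induction z with
  | zero => simp only [map_zero]
  | add x y hx hy => simp only [map_add, hx, hy]
  | tmul l a =>
    rw [LinearMap.rTensor_tmul, ofDualCotangent_apply, ofTensor_tmul, pullback_ofCotangent,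
      ofCotangent, fmul_ofStretch]
    congr 1
    ext x
    calc a * comorphism (toUnit T) (algebraMap K _ (l x))
      _ = l x • a := by rw [AlgHom.commutes, Algebra.smul_def, mul_comm]
      _ = dualTensorHom K N _ (l ⊗ₜ a) x := rfl

theorem bijective_ofTensor [LocallyOfFiniteType H.hom] (hT : IsQcqs K T) :
    Function.Bijective (ofTensor H T) := by
  obtain ⟨R, _, _, _, j, ε, _, hε⟩ :=
    exists_affine_neighbourhood_of_point (H := H) (1 : algOver K K ⟶ H)
  obtain ⟨n, δ, hδ⟩ := exists_isUniversalDerivationAt ε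
  let e := (LinearEquiv.ofBijective _ (bijective_ofDualCotangent hδ hε)).rTensor (coordRing T)
  have he : ofTensor H T ∘ e = ofCotangent hδ.isDerivationAlong hε T ∘
      dualTensorHomEquiv K (Fin n → K) (coordRing T) :=
    funext (ofTensor_rTensor_ofDualCotangent hδ.isDerivationAlong hε)
  refine (Function.Bijective.of_comp_iff _ e.bijective).mp ?_
  rw [he]
  exact (bijective_ofCotangent hε hδ hT).comp (LinearEquiv.bijective _)

end Lie

end Tensor

section BaseChange

open TensorProduct

variable {k : Type u} [Field k] {K : Type u} [Field K] [Algebra k K] {X Y : Over (Spec (.of k))}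

variable (K X) in
/-- The pullback of functions along the projection `X_K ⟶ X`. -/
def baseChangeFun : coordRing X →+* coordRing (baseChange K X) :=
  (pullback.fst X.hom (algOver k K).hom).appTop.hom

theorem baseChangeFun_eq (a : coordRing X) :
    baseChangeFun K X a = comorphism (fst X (algOver k K)) a := rfl

theorem algebraMap_baseChange (c : K) :
    algebraMap K (coordRing (baseChange K X)) c =
      comorphism (snd X (algOver k K)) (specFun k K c) := rfl

theorem baseChangeFun_algebraMap (c : k) : baseChangeFun K X (algebraMap k _ c) =
    algebraMap K (coordRing (baseChange K X)) (algebraMap k K c) := by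
  rw [algebraMap_baseChange, baseChangeFun_eq, AlgHom.commutes, AlgHom.commutes, AlgHom.commutes]

theorem comorphism_baseChangeMap (t : Y ⟶ X) (a : coordRing X) :
    comorphism (baseChangeMap K t) (baseChangeFun K X a) = baseChangeFun K Y (comorphism t a) := by
  have h : (baseChangeMap K t).left ≫ pullback.fst X.hom (algOver k K).hom =
      pullback.fst Y.hom (algOver k K).hom ≫ t.left :=
    pullback.lift_fst _ _ _
  have hTop := congr(Scheme.Hom.appTop $h)
  rw [Scheme.Hom.comp_appTop, Scheme.Hom.comp_appTop] at hTop
  exact congr(($hTop).hom a)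

theorem isQcqs_baseChange (hX : IsQcqs k X) : IsQcqs K (baseChange K X) := by
  obtain ⟨_, _⟩ := hX
  exact ⟨inferInstanceAs (QuasiCompact (pullback.snd X.hom (algOver k K).hom)),
    inferInstanceAs (QuasiSeparated (pullback.snd X.hom (algOver k K).hom))⟩

/-- The functions on `X_K` as a vector space over `k`. -/
local instance : Module k (coordRing (baseChange K X)) := Module.compHom _ (algebraMap k K)

local instance : IsScalarTower k K (coordRing (baseChange K X)) :=
  ⟨fun a b x => by rw [Algebra.smul_def a b, mul_smul]; rfl⟩

variable (K X) in
/-- The multiplication map `K ⊗ 𝒪(X) → 𝒪(X_K)`. -/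
def tensorBaseChangeFun : K ⊗[k] coordRing X →ₗ[K] coordRing (baseChange K X) :=
  LinearMap.liftBaseChange K
    { toFun := baseChangeFun K X
      map_add' := map_add _
      map_smul' c a := by
        rw [Algebra.smul_def, map_mul, baseChangeFun_algebraMap, ← Algebra.smul_def]
        rfl }

theorem tensorBaseChangeFun_tmul (c : K) (a : coordRing X) :
    tensorBaseChangeFun K X (c ⊗ₜ a) = c • baseChangeFun K X a :=
  LinearMap.liftBaseChange_tmul ..

theorem bijective_tensorBaseChangeFun (hX : IsQcqs k X) :
    Function.Bijective (tensorBaseChangeFun K X) := by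
  have h (z) : tensorBaseChangeFun K X z =
      kunnethSpec X K (TensorProduct.comm k K (coordRing X) z) := by
    induction z with
    | zero => rw [map_zero, map_zero, map_zero]; rfl
    | add x y hx hy => rw [map_add, map_add, map_add, hx, hy]; rfl
    | tmul c a =>
      rw [tensorBaseChangeFun_tmul, TensorProduct.comm_tmul, kunnethSpec_tmul, mul_comm,
        Algebra.smul_def]
      rfl
  have hbij := (bijective_kunnethSpec (R := K) hX).comp
    (TensorProduct.comm k K (coordRing X)).bijective
  rwa [← (funext h : ⇑(tensorBaseChangeFun K X) =
    kunnethSpec X K ∘ TensorProduct.comm k K (coordRing X))] at hbij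

variable {H : Over (Spec (.of k))} [GrpObj H] [IsSeparated H.hom]

namespace Lie

instance moduleBase (T : Over (Spec (.of K))) : Module k (Lie (baseChange K H) T) :=
  Module.compHom _ (algebraMap k K)

instance isScalarTower (T : Over (Spec (.of K))) : IsScalarTower k K (Lie (baseChange K H) T) :=
  ⟨fun a b x => by rw [Algebra.smul_def a b, mul_smul]; rfl⟩

end Lie

variable (K H) in
/-- The Lie algebra of `H_K`. -/
abbrev lieAlg : Type u := Lie (baseChange K H) (𝟙_ (Over (Spec (.of K))))

namespace Lie

variable (K H X) in
/-- The multiplication map `Lie(H_K) ⊗ₖ 𝒪(X) → Lie(H_K)(X_K)`. -/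
def ofTensorBase : lieAlg K H ⊗[k] coordRing X →ₗ[k] Lie (baseChange K H) (baseChange K X) :=
  TensorProduct.lift (LinearMap.mk₂ k
    (fun v a => fmul (baseChangeFun K X a) (pullback (toUnit (baseChange K X)) v))
    (fun v w a => by rw [map_add, map_add])
    (fun c v a => by
      rw [← algebraMap_smul K c v, map_smul, map_smul, algebraMap_smul])
    (fun v a b => by rw [map_add, map_add]; rfl)
    (fun c v a => by
      rw [Algebra.smul_def, map_mul, baseChangeFun_algebraMap, fmul_mul, fmul_algebraMap,
        algebraMap_smul]))

theorem ofTensorBase_tmul (v : lieAlg K H) (a : coordRing X) :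
    ofTensorBase K X H (v ⊗ₜ a) =
      fmul (baseChangeFun K X a) (pullback (toUnit (baseChange K X)) v) := rfl

theorem ofTensorBase_tmul_one (v : lieAlg K H) :
    ofTensorBase K X H (v ⊗ₜ 1) = pullback (toUnit (baseChange K X)) v := by
  rw [ofTensorBase_tmul, map_one, ← map_one (algebraMap K _), fmul_algebraMap, one_smul]

theorem ofTensorBase_lTensor_mulLeft (c : coordRing X) (z : lieAlg K H ⊗[k] coordRing X) :
    ofTensorBase K X H ((LinearMap.mulLeft k c).lTensor _ z) =
      fmul (baseChangeFun K X c) (ofTensorBase K X H z) := by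
  induction z with
  | zero => simp only [map_zero]
  | add x y hx hy => simp only [map_add, hx, hy]
  | tmul v a =>
    rw [LinearMap.lTensor_tmul, LinearMap.mulLeft_apply, ofTensorBase_tmul, ofTensorBase_tmul,
      map_mul, fmul_mul]

theorem pullback_ofTensorBase (t : Y ⟶ X) (z : lieAlg K H ⊗[k] coordRing X) :
    pullback (baseChangeMap K t) (ofTensorBase K X H z) =
      ofTensorBase K Y H ((comorphism t).toLinearMap.lTensor _ z) := by
  induction z with
  | zero => simp only [map_zero]
  | add x y hx hy => simp only [map_add, hx, hy]
  | tmul v a =>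
    rw [LinearMap.lTensor_tmul, ofTensorBase_tmul, ofTensorBase_tmul, pullback_fmul,
      comorphism_baseChangeMap, pullback_pullback, comp_toUnit]
    rfl

theorem bijective_ofTensorBase [LocallyOfFiniteType H.hom] (hX : IsQcqs k X) :
    Function.Bijective (ofTensorBase K X H) := by
  have : LocallyOfFiniteType (baseChange K H).hom :=
    inferInstanceAs (LocallyOfFiniteType (pullback.snd H.hom (algOver k K).hom))
  let e := LinearEquiv.ofBijective _ (bijective_tensorBaseChangeFun (K := K) hX)
  let i := AlgebraTensorModule.cancelBaseChange k K K (lieAlg K H) (coordRing X)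
  have h : ofTensorBase K X H ∘ i =
      ofTensor (baseChange K H) (baseChange K X) ∘ e.lTensor (lieAlg K H) := by
    funext z
    induction z with
    | zero => simp only [Function.comp_apply, map_zero]
    | add x y hx hy => simp_all only [Function.comp_apply, map_add]
    | tmul v y =>
      induction y with
      | zero => simp only [Function.comp_apply, TensorProduct.tmul_zero, map_zero]
      | add x y hx hy => simp_all only [Function.comp_apply, TensorProduct.tmul_add, map_add]
      | tmul c a =>
        rw [Function.comp_apply, Function.comp_apply, AlgebraTensorModule.cancelBaseChange_tmul,
          ofTensorBase_tmul, LinearEquiv.lTensor_tmul, LinearEquiv.ofBijective_apply,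
          tensorBaseChangeFun_tmul, ofTensor_tmul, map_smul, map_smul, map_smul]
        rfl
  refine (Function.Bijective.of_comp_iff _ i.bijective).mp ?_
  rw [h]
  exact (bijective_ofTensor (isQcqs_baseChange hX)).comp (e.lTensor _).bijective

end Lie

end BaseChange

section AffinizationUnit

variable {k : Type u} [Field k]

/-- The canonical morphism `X ⟶ Spec 𝒪(X)`. -/
def toAffinization (X : Over (Spec (.of k))) : X ⟶ (affinization k).obj X :=
  (algΓAlgSpecAdjunction (.of k)).unit.app X

theorem toAffinization_naturality {X Y : Over (Spec (.of k))} (f : X ⟶ Y) :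
    toAffinization X ≫ (affinization k).map f = f ≫ toAffinization Y :=
  ((algΓAlgSpecAdjunction (.of k)).unit.naturality f).symm

theorem bijective_comorphism_toAffinization (X : Over (Spec (.of k))) :
    Function.Bijective (comorphism (toAffinization X)) := by
  have h : comorphism (toAffinization X) ∘ specFun k (coordRing X) = id :=
    funext fun a =>
      congr(($((algΓAlgSpecAdjunction (.of k)).left_triangle_components X)).unop.hom a)
  have hbij : Function.Bijective (comorphism (toAffinization X) ∘ specFun k (coordRing X)) := by
    rw [h]
    exact Function.bijective_id
  exact (Function.Bijective.of_comp_iff _ bijective_specFun).mp hbij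

variable (G : Over (Spec (.of k))) [hqc : QuasiCompact G.hom] [hqs : QuasiSeparated G.hom]

theorem toAffinization_tensor :
    letI F := (IsQcqs k).ι ⋙ affinization k
    letI G' : (IsQcqs k).FullSubcategory := ⟨G, hqc, hqs⟩
    toAffinization (G ⊗ G) ≫ Functor.OplaxMonoidal.δ F G' G' =
      toAffinization G ⊗ₘ toAffinization G := by
  let F := (IsQcqs k).ι ⋙ affinization k
  let G' : (IsQcqs k).FullSubcategory := ⟨G, hqc, hqs⟩
  apply CartesianMonoidalCategory.hom_ext
  · have hδ : Functor.OplaxMonoidal.δ F G' G' ≫ fst _ _ = F.map (fst G' G') :=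
      Functor.OplaxMonoidal.δ_fst F G' G'
    refine (Category.assoc _ _ _).trans (Eq.trans congr(_ ≫ $hδ) ?_)
    exact (toAffinization_naturality (fst G G)).trans (tensorHom_fst _ _).symm
  · have hδ : Functor.OplaxMonoidal.δ F G' G' ≫ snd _ _ = F.map (snd G' G') :=
      Functor.OplaxMonoidal.δ_snd F G' G'
    refine (Category.assoc _ _ _).trans (Eq.trans congr(_ ≫ $hδ) ?_)
    exact (toAffinization_naturality (snd G G)).trans (tensorHom_snd _ _).symm

theorem bijective_comorphism_toAffinization_tensor :
    Function.Bijective (comorphism (toAffinization G ⊗ₘ toAffinization G)) := by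
  let F := (IsQcqs k).ι ⋙ affinization k
  let G' : (IsQcqs k).FullSubcategory := ⟨G, hqc, hqs⟩
  rw [← toAffinization_tensor, comorphism_comp]
  exact (bijective_comorphism_toAffinization (G ⊗ G)).comp
    (bijective_comorphism_of_isIso (Functor.OplaxMonoidal.δ F G' G'))

instance isMonHom_toAffinization [GrpObj G] : IsMonHom (toAffinization G) where
  one_hom := by
    let F := (IsQcqs k).ι ⋙ affinization k
    let G' : (IsQcqs k).FullSubcategory := ⟨G, hqc, hqs⟩
    have hη : η[F.obj G'] = Functor.LaxMonoidal.ε F ≫ F.map η[G'] := Functor.obj.η_def _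
    have hε : toAffinization (𝟙_ (Over (Spec (.of k)))) = Functor.LaxMonoidal.ε F := by
      have := (Functor.Monoidal.εIso F).isIso_inv
      rw [← cancel_mono (Functor.Monoidal.εIso F).inv]
      exact toUnit_unique _ _
    refine Eq.trans ?_ hη.symm
    rw [← hε]
    exact (toAffinization_naturality η[G]).symm
  mul_hom := by
    let F := (IsQcqs k).ι ⋙ affinization k
    let G' : (IsQcqs k).FullSubcategory := ⟨G, hqc, hqs⟩
    have hμ : μ[F.obj G'] = Functor.LaxMonoidal.μ F G' G' ≫ F.map μ[G'] := Functor.obj.μ_def _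
    have hδ : Functor.OplaxMonoidal.δ F G' G' ≫ μ[F.obj G'] = F.map μ[G'] := by
      rw [hμ, Functor.Monoidal.δ_μ_assoc]
    rw [← toAffinization_tensor]
    refine Eq.trans ?_ (Category.assoc _ _ _).symm
    refine Eq.trans ?_ congr(toAffinization (G ⊗ G) ≫ $hδ).symm
    exact (toAffinization_naturality μ[G]).symm

end AffinizationUnit

section Transfer

open TensorProduct

variable {k : Type u} [Field k] {A B : Over (Spec (.of k))}
  {V : Type u} [AddCommGroup V] [Module k V]

theorem lTensor_comorphism_tensorHom_lTensorKunneth (t : B ⟶ A)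
    (y : (V ⊗[k] coordRing A) ⊗[k] coordRing A) :
    (comorphism (t ⊗ₘ t)).toLinearMap.lTensor V (lTensorKunneth A A V y) =
      lTensorKunneth B B V (TensorProduct.map ((comorphism t).toLinearMap.lTensor V)
        (comorphism t).toLinearMap y) := by
  have h : (comorphism (t ⊗ₘ t)).toLinearMap.lTensor V ∘ₗ lTensorKunneth A A V =
      lTensorKunneth B B V ∘ₗ TensorProduct.map ((comorphism t).toLinearMap.lTensor V)
        (comorphism t).toLinearMap := by
    ext v a b
    simp [lTensorKunneth, kunneth, ← comorphism_comp_apply]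
  exact congr($h y)

variable [GrpObj A] [GrpObj B]

/-- A linear map `σ : V → V ⊗ 𝒪(A)` which a homomorphism `t : B ⟶ A` pulls back to a coaction of
`B` is itself a coaction, provided that `𝒪(A × A) → 𝒪(B × B)` is injective. -/
def Rep.descend (ρ : Rep B V) (t : B ⟶ A) [IsMonHom t]
    (ht : Function.Injective (comorphism (t ⊗ₘ t))) (σ : V →ₗ[k] V ⊗[k] coordRing A)
    (hσ : (comorphism t).toLinearMap.lTensor V ∘ₗ σ = ρ.coact) : Rep A V where
  coact := σ
  coact_one v := by
    rw [← ρ.coact_one v, ← IsMonHom.one_hom t, comorphism_comp, AlgHom.comp_toLinearMap,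
      LinearMap.lTensor_comp_apply, ← hσ, LinearMap.comp_apply]
  coact_mul v := by
    apply Module.Flat.lTensor_preserves_injective_linearMap (M := V)
      (comorphism (t ⊗ₘ t)).toLinearMap ht
    have hmap : TensorProduct.map ((comorphism t).toLinearMap.lTensor V)
        (comorphism t).toLinearMap ∘ₗ σ.rTensor _ =
        ρ.coact.rTensor _ ∘ₗ (comorphism t).toLinearMap.lTensor V := by
      rw [LinearMap.map_comp_rTensor, hσ, LinearMap.rTensor_comp_lTensor]
    calc (comorphism (t ⊗ₘ t)).toLinearMap.lTensor V ((comorphism μ[A]).toLinearMap.lTensor V (σ v))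
      _ = (comorphism μ[B]).toLinearMap.lTensor V (ρ.coact v) := by
        rw [← LinearMap.lTensor_comp_apply, ← AlgHom.comp_toLinearMap, ← comorphism_comp,
          ← IsMonHom.mul_hom t, comorphism_comp, AlgHom.comp_toLinearMap,
          LinearMap.lTensor_comp_apply, ← hσ, LinearMap.comp_apply]
      _ = lTensorKunneth B B V (ρ.coact.rTensor _ (ρ.coact v)) := ρ.coact_mul v
      _ = lTensorKunneth B B V (TensorProduct.map ((comorphism t).toLinearMap.lTensor V)
          (comorphism t).toLinearMap (σ.rTensor _ (σ v))) := by
        rw [← LinearMap.comp_apply (TensorProduct.map _ _), hmap, ← hσ]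
        rfl
      _ = _ := (lTensor_comorphism_tensorHom_lTensorKunneth t _).symm

theorem IsLinearlyReductive.of_bijective_comorphism (hA : IsLinearlyReductive A) (t : B ⟶ A)
    [IsMonHom t] (ht : Function.Bijective (comorphism t))
    (htt : Function.Injective (comorphism (t ⊗ₘ t))) : IsLinearlyReductive B := by
  intro V _ _ ρ W hW
  let e : coordRing A ≃ₗ[k] coordRing B := LinearEquiv.ofBijective (comorphism t).toLinearMap ht
  let σ : Rep A V := ρ.descend t htt ((e.lTensor V).symm ∘ₗ ρ.coact)
    (LinearMap.ext fun v => (e.lTensor V).apply_symm_apply (ρ.coact v))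
  have hρσ (v : V) : ρ.coact v = e.toLinearMap.lTensor V (σ.coact v) :=
    ((e.lTensor V).apply_symm_apply (ρ.coact v)).symm
  have hstable (W : Submodule k V) : σ.IsStable W ↔ ρ.IsStable W := by
    refine forall₂_congr fun w _ => ⟨?_, ?_⟩
    · rintro ⟨y, hy⟩
      exact ⟨e.toLinearMap.lTensor W y, by rw [← lTensor_rTensor_comm, hy, hρσ]⟩
    · rintro ⟨y, hy⟩
      refine ⟨e.symm.toLinearMap.lTensor W y, ?_⟩
      rw [← lTensor_rTensor_comm, hy]
      rfl
  obtain ⟨W', hW', hc⟩ := hA V σ W ((hstable W).mpr hW)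
  exact ⟨W', (hstable W').mp hW', hc⟩

theorem isLinearlyReductive_of_affinization (G : Over (Spec (.of k))) [GrpObj G]
    [QuasiCompact G.hom] [QuasiSeparated G.hom]
    (h : IsLinearlyReductive ((affinization k).obj G)) : IsLinearlyReductive G :=
  h.of_bijective_comorphism (toAffinization G) (bijective_comorphism_toAffinization G)
    (bijective_comorphism_toAffinization_tensor G).1

end Transfer

section LinearlyReductive

open TensorProduct

variable {k : Type u} [Field k] {K : Type u} [Field K] [Algebra k K]
  {G H : Over (Spec (.of k))} [GrpObj H]

theorem Lie.Ad_one {L T : Over (Spec (.of K))} [GrpObj L] [IsSeparated L.hom] (x : Lie L T) :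
    Lie.Ad 1 x = x := by
  ext1
  rw [Lie.val_Ad, comp_one, _root_.one_mul, inv_one, _root_.mul_one]

section Hom

variable [GrpObj G] (f : baseChange K G ⟶ baseChange K H) [IsMonHom f]

theorem baseChangeMap_one_comp : baseChangeMap K η[G] ≫ f = 1 := by
  let F := Over.pullback (Spec.map (CommRingCat.ofHom (algebraMap k K)))
  have hη : η[F.obj G] = Functor.LaxMonoidal.ε F ≫ F.map η[G] := Functor.obj.η_def _
  rw [← cancel_epi (Functor.Monoidal.εIso F).hom]
  calc Functor.LaxMonoidal.ε F ≫ F.map η[G] ≫ f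
    _ = η[F.obj H] := by
      rw [← Category.assoc, ← hη]
      exact IsMonHom.one_hom f
    _ = (Functor.Monoidal.εIso F).hom ≫ 1 := by
      rw [comp_one, Hom.one_def, toUnit_unique (toUnit _) (𝟙 _), Category.id_comp]

theorem baseChangeMap_mul_comp : baseChangeMap K μ[G] ≫ f =
    (baseChangeMap K (fst G G) ≫ f) * (baseChangeMap K (snd G G) ≫ f) := by
  let F := Over.pullback (Spec.map (CommRingCat.ofHom (algebraMap k K)))
  have hfst : Functor.OplaxMonoidal.δ F G G ≫ fst _ _ = F.map (fst G G) :=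
    Functor.OplaxMonoidal.δ_fst F G G
  have hsnd : Functor.OplaxMonoidal.δ F G G ≫ snd _ _ = F.map (snd G G) :=
    Functor.OplaxMonoidal.δ_snd F G G
  have hmul : Functor.OplaxMonoidal.δ F G G ≫ μ[F.obj G] = F.map μ[G] := by
    rw [Functor.obj.μ_def, Functor.Monoidal.δ_μ_assoc]
  have hf : μ[F.obj G] ≫ f = (fst _ _ ≫ f) * (snd _ _ ≫ f) := by
    rw [IsMonHom.mul_hom, Hom.mul_def]
    congr 1
  rw [baseChangeMap, baseChangeMap, baseChangeMap, ← hfst, ← hsnd, ← hmul, Category.assoc, hf,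
    comp_mul, Category.assoc, Category.assoc]

theorem lift_one_one_comp_mul : lift η[G] η[G] ≫ μ[G] = η[G] := by
  have h := _root_.mul_one (1 : 𝟙_ (Over (Spec (.of k))) ⟶ G)
  rwa [Hom.one_def, toUnit_unique (toUnit _) (𝟙 _), Category.id_comp, Hom.mul_def] at h

theorem pullback_one_of_mem_Z1 [IsSeparated H.hom] {c : Lie (baseChange K H) (baseChange K G)}
    (hc : c ∈ Z1 f) : Lie.pullback (baseChangeMap K η[G]) c = 0 := by
  have h := congr(Lie.pullback (baseChangeMap K (lift η[G] η[G]))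
    $((mem_Z1_iff_baseChangeMap f c).mp hc))
  rw [map_add, Lie.pullback_Ad, Lie.pullback_pullback, Lie.pullback_pullback,
    Lie.pullback_pullback, ← Category.assoc, ← Functor.map_comp, ← Functor.map_comp,
    ← Functor.map_comp, lift_fst, lift_snd, lift_one_one_comp_mul, baseChangeMap_one_comp,
    Lie.Ad_one] at h
  exact left_eq_add.mp h

end Hom

variable [IsSeparated H.hom] [LocallyOfFiniteType H.hom]
  (f : baseChange K G ⟶ baseChange K H) (hG : IsQcqs k G)

/-- The coaction on `Lie(H_K)` given by `Ad ∘ f`. -/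
def adCoact : lieAlg K H →ₗ[k] lieAlg K H ⊗[k] coordRing G :=
  (LinearEquiv.ofBijective _ (Lie.bijective_ofTensorBase hG)).symm.toLinearMap ∘ₗ
    (Lie.Ad f ∘ₗ Lie.pullback (toUnit (baseChange K G))).restrictScalars k

theorem ofTensorBase_adCoact (v : lieAlg K H) : Lie.ofTensorBase K G H (adCoact f hG v) =
    Lie.Ad f (Lie.pullback (toUnit (baseChange K G)) v) :=
  (LinearEquiv.ofBijective _ (Lie.bijective_ofTensorBase hG)).apply_symm_apply _

theorem ofTensorBase_lTensorKunneth_adCoact (z : lieAlg K H ⊗[k] coordRing G) :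
    Lie.ofTensorBase K (G ⊗ G) H (lTensorKunneth G G _ ((adCoact f hG).rTensor _ z)) =
      Lie.Ad (baseChangeMap K (fst G G) ≫ f)
        (Lie.pullback (baseChangeMap K (snd G G)) (Lie.ofTensorBase K G H z)) := by
  induction z with
  | zero => simp only [map_zero]
  | add x y hx hy => simp only [map_add, hx, hy]
  | tmul v b =>
    rw [LinearMap.rTensor_tmul, lTensorKunneth_tmul, Lie.ofTensorBase_lTensor_mulLeft,
      ← Lie.pullback_ofTensorBase, ofTensorBase_adCoact, Lie.pullback_Ad, Lie.ofTensorBase_tmul,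
      Lie.pullback_fmul, comorphism_baseChangeMap, Lie.Ad_fmul, Lie.pullback_pullback,
      Lie.pullback_pullback, comp_toUnit, comp_toUnit]

variable [GrpObj G] [IsMonHom f]

/-- The Lie algebra of `H_K` as a `G`-module over `k`, via `Ad ∘ f`. -/
def adRep : Rep G (lieAlg K H) where
  coact := adCoact f hG
  coact_one v := by
    apply (Lie.bijective_ofTensorBase (K := K) (H := H) (isQcqs_unit (K := k))).1
    rw [← Lie.pullback_ofTensorBase, ofTensorBase_adCoact, Lie.pullback_Ad,
      baseChangeMap_one_comp, Lie.Ad_one, Lie.pullback_pullback, comp_toUnit,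
      Lie.ofTensorBase_tmul_one]
  coact_mul v := by
    apply (Lie.bijective_ofTensorBase (K := K) (H := H) (isQcqs_tensor hG hG)).1
    refine Eq.trans ?_ (ofTensorBase_lTensorKunneth_adCoact f hG (adCoact f hG v)).symm
    rw [← Lie.pullback_ofTensorBase, ofTensorBase_adCoact, Lie.pullback_Ad, Lie.pullback_Ad,
      Lie.Ad_Ad, baseChangeMap_mul_comp, Lie.pullback_pullback, Lie.pullback_pullback, comp_toUnit,
      comp_toUnit]

variable {f}

theorem isCocycle_adRep {z : lieAlg K H ⊗[k] coordRing G}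
    (hz : Lie.ofTensorBase K G H z ∈ Z1 f) : (adRep f hG).IsCocycle z where
  one := by
    apply (Lie.bijective_ofTensorBase (K := K) (H := H) (isQcqs_unit (K := k))).1
    rw [← Lie.pullback_ofTensorBase, map_zero, pullback_one_of_mem_Z1 f hz]
  mul := by
    apply (Lie.bijective_ofTensorBase (K := K) (H := H) (isQcqs_tensor hG hG)).1
    rw [map_add, ← Lie.pullback_ofTensorBase, ← Lie.pullback_ofTensorBase,
      (mem_Z1_iff_baseChangeMap f _).mp hz]
    exact congrArg (_ + ·) (ofTensorBase_lTensorKunneth_adCoact f hG z).symm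

theorem Z1_le_B1_of_isLinearlyReductive [QuasiCompact G.hom] [QuasiSeparated G.hom]
    (hr : IsLinearlyReductive G) : Z1 f ≤ B1 f := by
  intro c hc
  have hG : IsQcqs k G := ⟨inferInstance, inferInstance⟩
  obtain ⟨z, rfl⟩ := (Lie.bijective_ofTensorBase (K := K) (H := H) hG).2 c
  obtain ⟨v, hv⟩ := (isCocycle_adRep hG hc).exists_eq_sub_of_isLinearlyReductive hr
  refine ⟨v, ?_⟩
  rw [hv, map_sub, Lie.ofTensorBase_tmul_one, d0_apply]
  exact congrArg (· - _) (ofTensorBase_adCoact f hG v).symm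

end LinearlyReductive

section Main

variable {k : Type u} [Field k] {G H M : Over (Spec (.of k))} [GrpObj G] [GrpObj H]

theorem subsingleton_H1_homOfPoint_iff [IsSeparated H.hom] (α : (homGp G H).RepresentableBy M)
    {K : Type u} [Field K] [Algebra k K] (f : algOver k K ⟶ M) :
    Subsingleton (H1 (homOfPoint α f)) ↔ IsInfinitesimallyRigid (pointEquiv α f) :=
  subsingleton_H1_iff_isInfinitesimallyRigid (pointEquiv α f)

theorem tfae_smooth_subsingleton_H1 [Smooth H.hom] [IsSeparated H.hom] [LocallyOfFiniteType M.hom]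
    (α : (homGp G H).RepresentableBy M) :
    List.TFAE
      [Smooth (conjGraph α).left,
        ∀ (K : Type u) [Field K] [Algebra k K] (f : algOver k K ⟶ M), Smooth (orbitMap α f).left,
        ∀ (K : Type u) [Field K] [Algebra k K] (f : algOver k K ⟶ M),
          Subsingleton (H1 (homOfPoint α f))] := by
  simp only [subsingleton_H1_homOfPoint_iff]
  tfae_have 1 → 2 := fun _ K _ _ f => smooth_orbitGraph_of_smooth_conjGraph α f
  tfae_have 2 → 3 := fun h K _ _ f =>
    have := h K f
    isInfinitesimallyRigid_of_smooth_orbitMap α f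
  tfae_have 3 → 1 := smooth_conjGraph_of_isInfinitesimallyRigid α
  tfae_finish

theorem subsingleton_H1_of_isLinearlyReductive [LocallyOfFiniteType H.hom] [IsSeparated H.hom]
    [QuasiCompact G.hom] [QuasiSeparated G.hom]
    (hG : IsLinearlyReductive ((affinization k).obj G)) {K : Type u} [Field K] [Algebra k K]
    (f : baseChange K G ⟶ baseChange K H) [IsMonHom f] : Subsingleton (H1 f) :=
  (subsingleton_H1_iff_Z1_le_B1 f).mpr
    (Z1_le_B1_of_isLinearlyReductive (isLinearlyReductive_of_affinization G hG))

end Main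

end HomScheme

end

theorem lemma3p4_general {k : Type u} [Field k] (G H M : Over (Spec (.of k)))
    [GrpObj G] [GrpObj H] [Smooth H.hom] [IsSeparated H.hom] [LocallyOfFiniteType M.hom]
    (α : (HomScheme.homGp G H).RepresentableBy M) :
    List.TFAE
      [Smooth (HomScheme.conjGraph α).left,
        ∀ (K : Type u) [Field K] [Algebra k K] (f : HomScheme.algOver k K ⟶ M),
          Smooth (HomScheme.orbitMap α f).left,
        ∀ (K : Type u) [Field K] [Algebra k K] (f : HomScheme.algOver k K ⟶ M),
          Subsingleton (HomScheme.H1 (HomScheme.homOfPoint α f))] ∧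
    ∀ [QuasiCompact G.hom] [QuasiSeparated G.hom],
      HomScheme.IsLinearlyReductive ((HomScheme.affinization k).obj G) →
        Smooth (HomScheme.conjGraph α).left ∧
          (∀ (K : Type u) [Field K] [Algebra k K] (f : HomScheme.algOver k K ⟶ M),
            Smooth (HomScheme.orbitMap α f).left) ∧
          ∀ (K : Type u) [Field K] [Algebra k K] (f : HomScheme.algOver k K ⟶ M),
            Subsingleton (HomScheme.H1 (HomScheme.homOfPoint α f)) := by
  have tfae := HomScheme.tfae_smooth_subsingleton_H1 α
  refine ⟨tfae, fun hG => ?_⟩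
  have vanishing : ∀ (K : Type u) [Field K] [Algebra k K] (f : HomScheme.algOver k K ⟶ M),
      Subsingleton (HomScheme.H1 (HomScheme.homOfPoint α f)) :=
    fun _ _ _ f => HomScheme.subsingleton_H1_of_isLinearlyReductive hG (HomScheme.homOfPoint α f)
  exact ⟨(tfae.out 2 0).mp vanishing, (tfae.out 2 1).mp vanishing, vanishing⟩

theorem lemma3p4 {k : Type u} [Field k] (G H M : Over (Spec (.of k)))
    [GrpObj G] [LocallyOfFiniteType G.hom] [QuasiCompact G.hom] [IsSeparated G.hom]
    [GrpObj H] [Smooth H.hom] [IsSeparated H.hom]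
    [LocallyOfFiniteType M.hom] [IsSeparated M.hom]
    (α : (HomScheme.homGp G H).RepresentableBy M) :
    List.TFAE
      [Smooth (HomScheme.conjGraph α).left,
        ∀ (K : Type u) [Field K] [Algebra k K] (f : HomScheme.algOver k K ⟶ M),
          Smooth (HomScheme.orbitMap α f).left,
        ∀ (K : Type u) [Field K] [Algebra k K] (f : HomScheme.algOver k K ⟶ M),
          Subsingleton (HomScheme.H1 (HomScheme.homOfPoint α f))] ∧
    (HomScheme.IsLinearlyReductive ((HomScheme.affinization k).obj G) →
      Smooth (HomScheme.conjGraph α).left ∧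
        (∀ (K : Type u) [Field K] [Algebra k K] (f : HomScheme.algOver k K ⟶ M),
          Smooth (HomScheme.orbitMap α f).left) ∧
        ∀ (K : Type u) [Field K] [Algebra k K] (f : HomScheme.algOver k K ⟶ M),
          Subsingleton (HomScheme.H1 (HomScheme.homOfPoint α f))) :=
  let ⟨tfae, reductive⟩ := lemma3p4_general G H M α
  ⟨tfae, reductive⟩
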